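/- **Theorem (single-source shortest paths on a weighted DAG).** Let $G=(V,E)$ be a directed acyclic graph with $n\ge 1$ vertices, $m=|E|$ edges and real edge weights $w(u,v)$, and let $s\in V$. For every vertex we are given the length of its list of out-neighbours and of its list of in-neighbours (in arbitrary order); the entries of the lists (a neighbour together with the weight of the edge) can be read only through classical queries or through the query unitary $|q\rangle|z\rangle|w\rangle\mapsto|q\rangle|z+x_q\rangle|w\rangle$ and its inverse. As usual in the query model, running time means the number of queries. Consider the following algorithm. *Minimum search.* $\mathrm{MIN}(x_1,\dots,x_d)$ is the Dürr–Høyer search: the threshold starts as a uniformly random $x_i$ and is repeatedly replaced by a smaller element, found by the exponential Grover search of Boyer, Brassard, Høyer and Tapp; the search is interrupted after time $O(\sqrt d)$, for a suitable fixed constant ($300(\lfloor\sqrt d\rfloor+1)$, where a round with $j$ Grover iterations takes time $j+1$), and the threshold is returned. The minimum of the empty list is $+\infty$. For a minimization procedure $Q$, $\hat Q^k$ denotes the least result of $k$ independent runs of $Q$. *First-one search.* For a vertex $v_i$ and a position $p$ of its list of out-neighbours, search for the first position $\ge p$ that holds an unvisited vertex of positive out-degree, by minimum searches among the first $1,2,4,\dots$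 of the remaining positions until such a position is found or the list is exhausted. This is run $\lceil 2\log_2 n\rceil$ times and the least position found is kept (or "none"). *Topological sort.* Starting from each unvisited source (vertex of in-degree $0$), run a depth-first search that marks the vertex as visited and, if it is not a sink, repeatedly uses the first-one search to find the next unvisited non-sink out-neighbour, recurses on it, and finally puts the vertex in front of the list $\mathit{order}$. The new enumeration of the vertices is $\mathit{order}$ followed by the sinks. *Main part.* Set $t[s]=0$ and $t[v]=+\infty$ for $v\ne s$. For each vertex $v$ behind $s$ in the new enumeration, in this order, set $$t[v]\leftarrow\hat Q^{\lceil 2\log_2 n\rceil}\bigl(t[u_1]+w(u_1,v),\dots,t[u_k]+w(u_k,v)\bigr),$$ where $Q=\mathrm{MIN}$ and $u_1,\dots,u_k$ are the in-neighbours of $v$. Return $t$. There is an absolute constant $C>0$ such that for all $n$, $G$, $w$, $s$ and all orders of the lists, the expected number of queries of this algorithm is at most $C\sqrt{nm}\,\log n$, and the probability that the returned array $t$ is wrong is at most $C/n$. Here $t$ is correct if for every vertex $v$, $t[v]$ is the length (total weight) of a shortest path from $s$ to $v$, and $t[v]=+\infty$ if $v$ is not reachable from $s$. -/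

import Mathlib

open scoped ENNReal

noncomputable section

namespace QuantumShortestPath

/-! ## The quantum query model

An input is a function `x : Q → A` from query addresses to answers; answers form an additive
group.  A program can read `x` only through classical queries and through the query unitary
`|q⟩|z⟩|w⟩ ↦ |q⟩|z + x q⟩|w⟩` and its inverse. -/

/-- The classical states of the registers of a quantum subroutine: the address register, the
answer register, and an auxiliary workspace of dimension `d`. -/
abbrev BasisState (Q A : Type) (d : ℕ) : Type := Q × A × Fin d

/-- The Hilbert space `ℓ²` with orthonormal basis `|q⟩|z⟩|w⟩`. -/
abbrev State (Q A : Type) (d : ℕ) : Type := lp (fun _ : BasisState Q A d => ℂ) 2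

/-- The isometry of `ℓ²` that permutes the basis, `|i⟩ ↦ |σ i⟩`. -/
def permGate {ι : Type} (σ : Equiv.Perm ι) :
    lp (fun _ : ι => ℂ) 2 ≃ₗᵢ[ℂ] lp (fun _ : ι => ℂ) 2 where
  toFun ψ := ⟨fun i => ψ (σ.symm i), (memℓp_gen_iff (by norm_num)).2
    (((memℓp_gen_iff (by norm_num)).1 (lp.memℓp ψ)).comp_injective σ.symm.injective)⟩
  invFun ψ := ⟨fun i => ψ (σ i), (memℓp_gen_iff (by norm_num)).2
    (((memℓp_gen_iff (by norm_num)).1 (lp.memℓp ψ)).comp_injective σ.injective)⟩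
  map_add' ψ φ := by ext i; rfl
  map_smul' c ψ := by ext i; rfl
  left_inv ψ := by ext i; simp
  right_inv ψ := by ext i; simp
  norm_map' ψ := by
    rw [lp.norm_eq_tsum_rpow (by norm_num), lp.norm_eq_tsum_rpow (by norm_num)]
    congr 1
    exact σ.symm.tsum_eq (fun i => ‖ψ i‖ ^ (2 : ℝ≥0∞).toReal)

/-- The isometry of `ℓ²` that flips the sign of the marked basis vectors. -/
def phaseGate {ι : Type} (mark : ι → Bool) :
    lp (fun _ : ι => ℂ) 2 ≃ₗᵢ[ℂ] lp (fun _ : ι => ℂ) 2 where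
  toFun ψ := ⟨fun i => if mark i then -ψ i else ψ i, (memℓp_gen_iff (by norm_num)).2 (by
    have h := (memℓp_gen_iff (p := 2) (by norm_num)).1 (lp.memℓp ψ)
    refine h.congr fun i => ?_
    split <;> simp)⟩
  invFun ψ := ⟨fun i => if mark i then -ψ i else ψ i, (memℓp_gen_iff (by norm_num)).2 (by
    have h := (memℓp_gen_iff (p := 2) (by norm_num)).1 (lp.memℓp ψ)
    refine h.congr fun i => ?_
    split <;> simp)⟩
  map_add' ψ φ := by
    ext i
    simp only [lp.coeFn_add, Pi.add_apply]
    split <;> ring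
  map_smul' c ψ := by
    ext i
    simp only [lp.coeFn_smul, Pi.smul_apply, smul_eq_mul, RingHom.id_apply]
    split <;> ring
  left_inv ψ := by
    ext i
    simp only
    split <;> simp
  right_inv ψ := by
    ext i
    simp only
    split <;> simp
  norm_map' ψ := by
    rw [lp.norm_eq_tsum_rpow (by norm_num), lp.norm_eq_tsum_rpow (by norm_num)]
    congr 1
    refine tsum_congr fun i => ?_
    simp only [LinearEquiv.coe_mk, LinearMap.coe_mk, AddHom.coe_mk]
    split <;> simp

/-- The permutation `(q, z, w) ↦ (q, z + x q, w)` of the basis. -/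
def queryPerm {Q A : Type} [AddCommGroup A] (d : ℕ) (x : Q → A) :
    Equiv.Perm (BasisState Q A d) where
  toFun b := (b.1, b.2.1 + x b.1, b.2.2)
  invFun b := (b.1, b.2.1 - x b.1, b.2.2)
  left_inv b := by simp
  right_inv b := by simp

/-- The query unitary `|q⟩|z⟩|w⟩ ↦ |q⟩|z + x q⟩|w⟩`. -/
def queryUnitary {Q A : Type} [AddCommGroup A] (d : ℕ) (x : Q → A) :
    State Q A d ≃ₗᵢ[ℂ] State Q A d :=
  permGate (queryPerm d x)

/-- One step of a quantum subroutine: a query, an inverse query, or a unitary that does not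
depend on the input. -/
inductive Gate (Q A : Type) (d : ℕ) : Type where
  | query : Gate Q A d
  | queryInv : Gate Q A d
  | unitary (U : State Q A d ≃ₗᵢ[ℂ] State Q A d) : Gate Q A d

/-- The unitary performed by a gate on the input `x`. -/
def Gate.apply {Q A : Type} [AddCommGroup A] {d : ℕ} (x : Q → A) :
    Gate Q A d → (State Q A d ≃ₗᵢ[ℂ] State Q A d)
  | .query => queryUnitary d x
  | .queryInv => (queryUnitary d x).symm
  | .unitary U => U

/-- The number of queries of a gate. -/
def Gate.cost {Q A : Type} {d : ℕ} : Gate Q A d → ℕ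
  | .query => 1
  | .queryInv => 1
  | .unitary _ => 0

/-- A quantum subroutine: a unit initial state, a sequence of gates (the head is applied first),
and at the end a measurement of all the registers in the standard basis. -/
structure Circuit (Q A : Type) : Type where
  dim : ℕ
  init : State Q A dim
  norm_init : ‖init‖ = 1
  gates : List (Gate Q A dim)

/-- The number of queries made by a quantum subroutine. -/
def Circuit.cost {Q A : Type} (c : Circuit Q A) : ℕ := (c.gates.map Gate.cost).sum

/-- The state right before the measurement. -/
def Circuit.finalState {Q A : Type} [AddCommGroup A] (c : Circuit Q A) (x : Q → A) :
    State Q A c.dim :=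
  c.gates.foldl (fun ψ g => g.apply x ψ) c.init

theorem norm_foldl_gates {Q A : Type} [AddCommGroup A] {d : ℕ} (x : Q → A)
    (l : List (Gate Q A d)) (ψ : State Q A d) :
    ‖l.foldl (fun ψ g => g.apply x ψ) ψ‖ = ‖ψ‖ := by
  induction l generalizing ψ with
  | nil => rfl
  | cons g l ih => rw [List.foldl_cons, ih, LinearIsometryEquiv.norm_map]

/-- The Born rule: the distribution of the outcome of measuring a unit vector of `ℓ²` in the
standard basis. -/
def born {ι : Type} (ψ : lp (fun _ : ι => ℂ) 2) (h : ‖ψ‖ = 1) : PMF ι :=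
  ⟨fun i => ENNReal.ofReal (‖ψ i‖ ^ 2), by
    have h2 : HasSum (fun i => ‖ψ i‖ ^ 2) 1 := by
      have := lp.hasSum_norm (p := 2) (by norm_num) ψ
      simpa [h] using this
    have h3 : ∑' i, ENNReal.ofReal (‖ψ i‖ ^ 2) = 1 := by
      rw [← ENNReal.ofReal_tsum_of_nonneg (fun i => by positivity) h2.summable, h2.tsum_eq,
        ENNReal.ofReal_one]
    exact h3 ▸ ENNReal.summable.hasSum⟩

/-- The distribution of the measurement outcome of a quantum subroutine on the input `x`. -/
def Circuit.measure {Q A : Type} [AddCommGroup A] (c : Circuit Q A) (x : Q → A) :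
    PMF (BasisState Q A c.dim) :=
  born (c.finalState x) ((norm_foldl_gates x c.gates c.init).trans c.norm_init)

/-- Classical randomized query programs with quantum subroutines, returning a value of type `α`:
return a value; make one classical query; draw a uniformly random element of `{0, …, N}`; run a
quantum subroutine and continue with its measurement outcome. -/
inductive Program (Q A : Type) (α : Type) : Type where
  | ret (a : α) : Program Q A α
  | ask (q : Q) (k : A → Program Q A α) : Program Q A α
  | coin (N : ℕ) (k : Fin (N + 1) → Program Q A α) : Program Q A α
  | quantum (c : Circuit Q A) (k : BasisState Q A c.dim → Program Q A α) : Program Q A α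

namespace Program

variable {Q A : Type}

/-- Sequential composition. -/
def bind {α β : Type} : Program Q A α → (α → Program Q A β) → Program Q A β
  | .ret a, f => f a
  | .ask q k, f => .ask q fun a => (k a).bind f
  | .coin N k, f => .coin N fun i => (k i).bind f
  | .quantum c k, f => .quantum c fun b => (k b).bind f

instance : Monad (Program Q A) where
  pure := Program.ret
  bind := Program.bind

/-- The joint distribution of the result of a program on the input `x` and of the number of
queries that it makes. -/
def run [AddCommGroup A] (x : Q → A) {α : Type} : Program Q A α → PMF (α × ℕ)
  | .ret a => PMF.pure (a, 0)
  | .ask q k => (run x (k (x q))).map fun r => (r.1, r.2 + 1)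
  | .coin N k => (PMF.uniformOfFintype (Fin (N + 1))).bind fun i => run x (k i)
  | .quantum c k =>
      (c.measure x).bind fun b => (run x (k b)).map fun r => (r.1, r.2 + c.cost)

/-- The expected number of queries on the input `x`. -/
def expectedQueries [AddCommGroup A] (x : Q → A) {α : Type} (P : Program Q A α) : ℝ≥0∞ :=
  ∑' r : α × ℕ, P.run x r * (r.2 : ℝ≥0∞)

/-- The probability that the result on the input `x` does not satisfy `good`. -/
def errorProbability [AddCommGroup A] (x : Q → A) {α : Type} (P : Program Q A α)
    (good : α → Prop) : ℝ≥0∞ :=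
  (P.run x).toOuterMeasure {r | ¬ good r.1}

/-- Run a minimization program `k` times and keep the least of the results. -/
def repeatMin {K : Type} [LinearOrder K] [OrderTop K] (P : Program Q A K) : ℕ → Program Q A K
  | 0 => pure ⊤
  | k + 1 => do
      let a ← P
      let b ← repeatMin P k
      pure (min a b)

end Program

/-! ## Grover iterations and the Dürr–Høyer minimum search -/

section Search

variable {Q A : Type} [AddCommGroup A] [DecidableEq Q] [DecidableEq A]

/-- The state `(N+1)^(-1/2) ∑ₖ |addr k⟩|0⟩`. -/
def uniformState {N : ℕ} (addr : Fin (N + 1) ↪ Q) : State Q A 1 :=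
  ∑ b ∈ Finset.univ.map (addr.trans ⟨fun q => ((q, 0, 0) : BasisState Q A 1),
      fun _ _ h => congrArg Prod.fst h⟩),
    lp.single 2 b (((Real.sqrt (N + 1))⁻¹ : ℝ) : ℂ)

theorem norm_uniformState {N : ℕ} (addr : Fin (N + 1) ↪ Q) :
    ‖(uniformState addr : State Q A 1)‖ = 1 := by
  have h := lp.norm_sum_single (E := fun _ : BasisState Q A 1 => ℂ) (p := 2) (by norm_num)
    (fun _ => (((Real.sqrt (N + 1))⁻¹ : ℝ) : ℂ))
    (Finset.univ.map (addr.trans ⟨fun q => ((q, 0, 0) : BasisState Q A 1),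
      fun _ _ h => congrArg Prod.fst h⟩))
  have hN : (0 : ℝ) < N + 1 := by positivity
  have h2 : ‖(uniformState addr : State Q A 1)‖ ^ 2 = 1 := by
    simp only [ENNReal.toReal_ofNat, Finset.sum_const, Finset.card_map, Finset.card_univ,
      Fintype.card_fin, Complex.norm_real, Real.rpow_ofNat] at h
    rw [uniformState, h, Real.norm_eq_abs, sq_abs, inv_pow, Real.sq_sqrt hN.le]
    rw [nsmul_eq_mul]
    push_cast
    field_simp
  exact (pow_eq_one_iff_of_nonneg (norm_nonneg _) two_ne_zero).1 h2

/-- One Grover iteration: compute the answer, flip the sign of the marked addresses, uncompute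
the answer, and reflect about the uniform state `ψ`, that is, apply `2|ψ⟩⟨ψ| - 1`. -/
def groverIteration {N : ℕ} (addr : Fin (N + 1) ↪ Q) (mark : Q → A → Bool) : List (Gate Q A 1) :=
  [.query, .unitary (phaseGate fun b => mark b.1 b.2.1), .queryInv,
    .unitary (Submodule.reflection (Submodule.span ℂ {uniformState addr}))]

/-- `j` Grover iterations on the uniform superposition of the addresses. -/
def grover {N : ℕ} (addr : Fin (N + 1) ↪ Q) (mark : Q → A → Bool) (j : ℕ) : Circuit Q A where
  dim := 1
  init := uniformState addr
  norm_init := norm_uniformState addr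
  gates := (List.replicate j (groverIteration addr mark)).flatten

/-- The main loop of the Dürr–Høyer search over `N + 1` addresses: `val` is the current threshold,
`time` is the remaining time, and `r` counts the unsuccessful rounds since the last change of the
threshold.  Each round belongs to the exponential search of Boyer, Brassard, Høyer and Tapp for an
address whose key is below the threshold: with `m = min ((6/5) ^ r) √(N + 1)`, choose `j`
uniformly among the nonnegative integers smaller than `m`, apply `j` Grover iterations, measure an
address and query it; if its key is below the threshold, it becomes the new threshold.  A round
takes time `j + 1`, and the loop is interrupted when the time is over. -/
def durrHoyerLoop {K : Type} [LinearOrder K] {N : ℕ} (addr : Fin (N + 1) ↪ Q) (key : Q → A → K)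
    (time r : ℕ) (val : K) : Program Q A K :=
  match time with
  | 0 => .ret val
  | T + 1 =>
      .coin (⌈min ((6 / 5 : ℝ) ^ r) (Real.sqrt (N + 1))⌉₊ - 1) fun j =>
        if (j : ℕ) ≤ T then
          .quantum (grover addr (fun q a => decide (key q a < val)) j) fun b =>
            .ask b.1 fun a =>
              if key b.1 a < val then durrHoyerLoop addr key (T - j) 0 (key b.1 a)
              else durrHoyerLoop addr key (T - j) (r + 1) val
        else .ret val
termination_by time
decreasing_by all_goals omega

/-- The Dürr–Høyer minimum search for the least key of `N` addresses: start from a uniformly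
random address as the threshold and run the main loop for time `O(√N)`.  The minimum of the empty
list is `⊤`. -/
def durrHoyer {K : Type} [LinearOrder K] [OrderTop K] :
    {N : ℕ} → (Fin N ↪ Q) → (Q → A → K) → Program Q A K
  | 0, _, _ => .ret ⊤
  | N + 1, addr, key =>
      .coin N fun i =>
        .ask (addr i) fun a =>
          durrHoyerLoop addr key (300 * (Nat.sqrt (N + 1) + 1)) 0 (key (addr i) a)

end Search

/-! ## Weighted DAGs and shortest paths -/

/-- A weighted directed acyclic graph with vertices `v₀, …, v_{n-1}`. -/
structure WeightedDAG (n : ℕ) where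
  edges : Finset (Fin n × Fin n)
  weight : Fin n → Fin n → ℝ
  acyclic : ∀ v, ¬ Relation.TransGen (fun u v => (u, v) ∈ edges) v v

/-- `G.HasPath u v ℓ`: there is a path of length (total weight) `ℓ` from `u` to `v`. -/
inductive WeightedDAG.HasPath {n : ℕ} (G : WeightedDAG n) (u : Fin n) : Fin n → ℝ → Prop where
  | nil : G.HasPath u u 0
  | snoc {v w : Fin n} {ℓ : ℝ} : G.HasPath u v ℓ → (v, w) ∈ G.edges →
      G.HasPath u w (ℓ + G.weight v w)

/-- `d` is the length of the shortest path from `u` to `v`, or `+∞` if `v` is not reachable. -/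
def WeightedDAG.IsShortestPathLength {n : ℕ} (G : WeightedDAG n) (u v : Fin n)
    (d : WithTop ℝ) : Prop :=
  (d = ⊤ ∧ ∀ ℓ, ¬ G.HasPath u v ℓ) ∨ ∃ ℓ : ℝ, d = (ℓ : WithTop ℝ) ∧ IsLeast {ℓ | G.HasPath u v ℓ} ℓ

/-- Adjacency lists of `G`: for each vertex the list of its out-neighbours and the list of its
in-neighbours, each in an arbitrary order and without repetitions. -/
structure AdjacencyLists {n : ℕ} (G : WeightedDAG n) where
  outList : Fin n → List (Fin n)
  inList : Fin n → List (Fin n)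
  nodup_outList : ∀ v, (outList v).Nodup
  nodup_inList : ∀ v, (inList v).Nodup
  mem_outList : ∀ u v, v ∈ outList u ↔ (u, v) ∈ G.edges
  mem_inList : ∀ u v, u ∈ inList v ↔ (u, v) ∈ G.edges

/-- A query address: a position in the list of in-neighbours or of out-neighbours of a vertex. -/
structure Address (n : ℕ) where
  incoming : Bool
  vertex : Fin n
  pos : ℕ
deriving DecidableEq

/-- An answer to a query: a neighbour and the weight of the edge that joins it. -/
abbrev Answer (n : ℕ) : Type := Fin n × ℝ

namespace AdjacencyLists

variable {n : ℕ} {G : WeightedDAG n}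

/-- The out-degrees. -/
def outDeg (L : AdjacencyLists G) (v : Fin n) : ℕ := (L.outList v).length

/-- The in-degrees. -/
def inDeg (L : AdjacencyLists G) (v : Fin n) : ℕ := (L.inList v).length

/-- The input as a function from addresses to answers; positions behind the end of a list carry
the answer `0`. -/
def oracle [NeZero n] (L : AdjacencyLists G) (q : Address n) : Answer n :=
  if q.incoming then
    ((L.inList q.vertex)[q.pos]?.map fun u => (u, G.weight u q.vertex)).getD 0
  else
    ((L.outList q.vertex)[q.pos]?.map fun u => (u, G.weight q.vertex u)).getD 0

end AdjacencyLists

/-! ## The algorithm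

As usual for adjacency lists, `n` and the lengths `dout v`, `din v` of the lists are known; the
entries of the lists are accessible through queries only. -/

/-- Programs that query the adjacency lists of a weighted graph with `n` vertices. -/
abbrev GraphProgram (n : ℕ) (α : Type) : Type := Program (Address n) (Answer n) α

/-- The addresses of the `N` consecutive positions `start, …, start + N - 1` of a list. -/
def window {n : ℕ} (incoming : Bool) (v : Fin n) (start N : ℕ) : Fin N ↪ Address n where
  toFun k := ⟨incoming, v, start + k⟩
  inj' k l h := by
    have := congrArg Address.pos h
    exact Fin.ext (by simpa using this)

/-- The number `2 log₂ n` of repetitions, rounded up to an integer. -/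
def repetitions (n : ℕ) : ℕ := ⌈2 * Real.logb 2 n⌉₊

section Algorithm

variable {n : ℕ} [NeZero n]

/-- Search for the minimal position `≥ start` of the out-neighbour list of `i` that holds an
unvisited vertex which is not a sink (`⊤` if none is found): minimum search among the marked
positions in the first `1, 2, 4, 8, …` remaining positions until one is found. -/
def firstOneSearchOnce (dout : Fin n → ℕ) (visited : Fin n → Bool) (i : Fin n) (start : ℕ) :
    GraphProgram n (WithTop ℕ) :=
  (List.range (Nat.clog 2 (dout i - start) + 1)).foldlM (fun z r =>
    if z = ⊤ then
      durrHoyer (window false i start (min (2 ^ r) (dout i - start)))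
        (fun q a => if visited a.1 = false ∧ 0 < dout a.1 then (q.pos : WithTop ℕ) else ⊤)
    else pure z) ⊤

/-- `FirstOneSearch'`: the search is repeated to reduce its one-sided error. -/
def firstOneSearch (dout : Fin n → ℕ) (visited : Fin n → Bool) (i : Fin n) (start : ℕ) :
    GraphProgram n (WithTop ℕ) :=
  Program.repeatMin (firstOneSearchOnce dout visited i start) (repetitions n)

/-- The state of the topological sort. -/
structure SortState (n : ℕ) where
  visited : Fin n → Bool
  order : List (Fin n)

/-- The while loop of `TopSortDFS(i)` from the position `start` on; `rec` is the recursive call.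
The position increases with each iteration, so `fuel = dout i` iterations suffice. -/
def neighbourLoop (dout : Fin n → ℕ) (rec : Fin n → SortState n → GraphProgram n (SortState n))
    (i : Fin n) : (fuel start : ℕ) → SortState n → GraphProgram n (SortState n)
  | 0, _, σ => pure σ
  | fuel + 1, start, σ => do
      match ← firstOneSearch dout σ.visited i start with
      | none => pure σ
      | some z =>
          let a ← Program.ask ⟨false, i, z⟩ Program.ret
          let σ' ← rec a.1 σ
          neighbourLoop dout rec i fuel (z + 1) σ'

/-- `TopSortDFS(i)`.  Each nested call marks a further vertex as visited, so that recursion depth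
`depth = n` suffices. -/
def topSortDFS (dout : Fin n → ℕ) : (depth : ℕ) → Fin n → SortState n → GraphProgram n (SortState n)
  | 0, _, σ => pure σ
  | depth + 1, i, σ => do
      let σ₁ : SortState n := ⟨Function.update σ.visited i true, σ.order⟩
      if 0 < dout i then
        let σ₂ ← neighbourLoop dout (topSortDFS dout depth) i (dout i) 0 σ₁
        pure ⟨σ₂.visited, i :: σ₂.order⟩
      else pure σ₁

/-- `TopSort`: start a search at each unvisited source; the new enumeration consists of the list
`order` of the non-sinks followed by the list of the sinks. -/
def topSort (dout din : Fin n → ℕ) : GraphProgram n (List (Fin n)) := do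
  let σ ← ((List.finRange n).filter fun i => din i = 0).foldlM
    (fun σ i => if σ.visited i then pure σ else topSortDFS dout n i σ)
    (⟨fun _ => false, []⟩ : SortState n)
  pure (σ.order ++ (List.finRange n).filter fun i => dout i = 0)

/-- The shortest path algorithm with source `s`: topological sort; then, for each vertex `v` behind
`s` in the new enumeration, `t v` becomes the result of the boosted Dürr–Høyer search for the
minimum of `t u + w(u, v)` over the in-neighbours `u` of `v`. -/
def shortestPathAlgorithm (dout din : Fin n → ℕ) (s : Fin n) :
    GraphProgram n (Fin n → WithTop ℝ) := do
  let enumeration ← topSort dout din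
  let t₀ : Fin n → WithTop ℝ := Function.update (fun _ => ⊤) s 0
  (enumeration.dropWhile (fun v => v ≠ s)).tail.foldlM (fun t v => do
    let d ← Program.repeatMin
      (durrHoyer (window true v 0 (din v)) fun _ a => t a.1 + (a.2 : WithTop ℝ)) (repetitions n)
    pure (Function.update t v d)) t₀

end Algorithm

end QuantumShortestPath

end

/-! Everything is computed with one functional, `wp`: the expectation of `κ` times the number of
queries plus a function of the result. With `κ = 1` it measures cost, with `κ = 0` probability. It
composes along `bind`, so loops and recursions are treated by induction with potential functions.

Minimum search. If `sin² θ` is the fraction of marked addresses, then `j` Grover iterations succeed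
with probability `sin² ((2 j + 1) θ)` (`tsum_measure_grover`), and the average over `j < M` is at
least `1 / 4` once `M sin θ ≥ 1` (`quarter_le_sum_sin_sq`). So if `t` of `N` keys lie below the
threshold, a smaller one is found in expected time `O(√(N / t))`. It is uniform among those `t`,
hence the whole descent takes expected time `O(√N)`; `searchTime` and `descentTime` are explicit
potentials for this. The interruption is handled by an induction on the available time `T`, which
shows that `T` times the failure probability is at most the potential
(`mul_wp_durrHoyerLoop_failure_le`). The search thus fails with probability at most `1 / 2`. Its
error is one-sided, so `⌈2 log₂ n⌉` repetitions reduce it to `1 / n²`.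

Cost. By doubling, one run of the first-one search makes `O(√ℓ)` queries, where `ℓ` is the distance
to the next candidate, not the degree (`wp_firstOneSearchOnce_le`). The linear bound `√ℓ ≤ a ℓ + b`
with `a = √(n m) / m` and `b = √(n m) / n` (`sqrt_le_add`) takes the place of Cauchy–Schwarz: the
stretches of one list that are charged are disjoint, so the linear parts add up to `a m`, and the
constants are charged to vertices and add up to `O(b n)`. Both are of order `√(n m)`; the
repetitions contribute the logarithm. The bounds must also hold on runs where searches fail. They
do, because any position that is returned still holds an unvisited non-sink, so that no vertex is
treated twice (`always_nodup_topSort`).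

Correctness. Each vertex is charged for two first-one searches and one minimum search, and `risk`
carries out the union bound, `3 n / n²` in total. If no search fails, the usual argument about gray
vertices (search started but not finished) shows that the order is topological (`LoopDone.finish`),
and the recurrence `isShortestPathLength_of_forall_ge` gives the distances. -/

noncomputable section

namespace QuantumShortestPath

/-! ### Calculus of expectations for query programs -/

namespace Program

variable {Q A : Type} [AddCommGroup A] (x : Q → A) {α β : Type}

/-- The expected value of `κ` times the number of queries plus `f` of the result. -/
def wp (κ : ℝ≥0∞) : Program Q A α → (α → ℝ≥0∞) → ℝ≥0∞
  | .ret a, f => f a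
  | .ask q k, f => κ + wp κ (k (x q)) f
  | .coin N k, f => ∑ i : Fin (N + 1), ((N : ℝ≥0∞) + 1)⁻¹ * wp κ (k i) f
  | .quantum c k, f => κ * c.cost + ∑' b, c.measure x b * wp κ (k b) f

/-- Every possible result satisfies `S`. -/
def Always (S : α → Prop) : Program Q A α → Prop
  | .ret a => S a
  | .ask q k => Always S (k (x q))
  | .coin _ k => ∀ i, Always S (k i)
  | .quantum c k => ∀ b, c.measure x b ≠ 0 → Always S (k b)

theorem sum_coin_const (N : ℕ) (c : ℝ≥0∞) :
    ∑ _i : Fin (N + 1), ((N : ℝ≥0∞) + 1)⁻¹ * c = c := by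
  rw [Finset.sum_const, Finset.card_univ, Fintype.card_fin, nsmul_eq_mul, ← mul_assoc]
  push_cast
  rw [ENNReal.mul_inv_cancel (by simp) (by simp), one_mul]

theorem wp_bind (κ : ℝ≥0∞) (P : Program Q A α) (k : α → Program Q A β) (f : β → ℝ≥0∞) :
    wp x κ (P >>= k) f = wp x κ P fun a => wp x κ (k a) f := by
  change wp x κ (P.bind k) f = _
  induction P with
  | ret a => rfl
  | ask q g ih => simp only [Program.bind, wp, ih]
  | coin N g ih => simp only [Program.bind, wp, ih]
  | quantum c g ih => simp only [Program.bind, wp, ih]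

@[simp] theorem wp_pure (κ : ℝ≥0∞) (a : α) (f : α → ℝ≥0∞) :
    wp x κ (pure a : Program Q A α) f = f a := rfl

@[simp] theorem wp_ret (κ : ℝ≥0∞) (a : α) (f : α → ℝ≥0∞) :
    wp x κ (.ret a : Program Q A α) f = f a := rfl

theorem always_bind {P : Program Q A α} {k : α → Program Q A β} {S : α → Prop} {T : β → Prop}
    (hP : P.Always x S) (hk : ∀ a, S a → (k a).Always x T) : (P >>= k).Always x T := by
  change (P.bind k).Always x T
  induction P with
  | ret a => exact hk a hP
  | ask q g ih => exact ih _ hP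
  | coin N g ih => exact fun i => ih i (hP i)
  | quantum c g ih => exact fun b hb => ih b (hP b hb)

theorem Always.mono {P : Program Q A α} {S T : α → Prop} (hP : P.Always x S)
    (h : ∀ a, S a → T a) : P.Always x T := by
  induction P with
  | ret a => exact h a hP
  | ask q g ih => exact ih _ hP
  | coin N g ih => exact fun i => ih i (hP i)
  | quantum c g ih => exact fun b hb => ih b (hP b hb)

theorem wp_mono_of_always {κ : ℝ≥0∞} {P : Program Q A α} {S : α → Prop} (hP : P.Always x S)
    {f g : α → ℝ≥0∞} (h : ∀ a, S a → f a ≤ g a) : wp x κ P f ≤ wp x κ P g := by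
  induction P with
  | ret a => exact h a hP
  | ask q k ih => exact add_le_add_right (ih _ hP) _
  | coin N k ih => exact Finset.sum_le_sum fun i _ => mul_le_mul_right (ih i (hP i)) _
  | quantum c k ih =>
    refine add_le_add_right (ENNReal.tsum_le_tsum fun b => ?_) _
    by_cases hb : c.measure x b = 0
    · simp [hb]
    · exact mul_le_mul_right (ih b (hP b hb)) _

theorem always_true (P : Program Q A α) : P.Always x fun _ => True := by
  induction P with
  | ret a => trivial
  | ask q g ih => exact ih _
  | coin N g ih => exact fun i => ih i
  | quantum c g ih => exact fun b _ => ih b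

theorem wp_mono {κ : ℝ≥0∞} (P : Program Q A α) {f g : α → ℝ≥0∞} (h : ∀ a, f a ≤ g a) :
    wp x κ P f ≤ wp x κ P g :=
  wp_mono_of_always x (P.always_true x) fun a _ => h a

/-- Linearity: expected queries and expected value of the result separate. -/
theorem wp_add (κ₁ κ₂ : ℝ≥0∞) (P : Program Q A α) (f g : α → ℝ≥0∞) :
    wp x (κ₁ + κ₂) P (fun a => f a + g a) = wp x κ₁ P f + wp x κ₂ P g := by
  induction P with
  | ret a => rfl
  | ask q k ih => simp only [wp, ih]; ring
  | coin N k ih => simp only [wp, ih, mul_add, Finset.sum_add_distrib]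
  | quantum c k ih => simp only [wp, ih, mul_add, ENNReal.tsum_add]; ring

theorem wp_zero_const (P : Program Q A α) (c : ℝ≥0∞) : wp x 0 P (fun _ => c) = c := by
  induction P with
  | ret a => rfl
  | ask q k ih => simp only [wp, ih]; ring
  | coin N k ih => simp only [wp, ih]; exact sum_coin_const N c
  | quantum d k ih =>
    simp only [wp, ih, ENNReal.tsum_mul_right, PMF.tsum_coe]; ring

theorem wp_add_const (κ : ℝ≥0∞) (P : Program Q A α) (f : α → ℝ≥0∞) (c : ℝ≥0∞) :
    wp x κ P (fun a => f a + c) = wp x κ P f + c := by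
  have := wp_add x κ 0 P f fun _ => c
  rwa [add_zero, wp_zero_const] at this

theorem wp_mul_const (P : Program Q A α) (f : α → ℝ≥0∞) (c : ℝ≥0∞) :
    wp x 0 P (fun a => f a * c) = wp x 0 P f * c := by
  induction P with
  | ret a => rfl
  | ask q k ih => simp only [wp, ih]; ring
  | coin N k ih => simp only [wp, ih, Finset.sum_mul, mul_assoc]
  | quantum d k ih => simp only [wp, ih, ← mul_assoc, ENNReal.tsum_mul_right]; ring

theorem wp_eq_add (P : Program Q A α) (f : α → ℝ≥0∞) :
    wp x 1 P f = wp x 1 P (fun _ => 0) + wp x 0 P f := by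
  simpa using wp_add x 1 0 P (fun _ => 0) f

theorem wp_const (κ : ℝ≥0∞) (P : Program Q A α) (c : ℝ≥0∞) :
    wp x κ P (fun _ => c) = wp x κ P (fun _ => 0) + c := by
  simpa using wp_add_const x κ P (fun _ => 0) c

theorem wp_le_of_always {κ : ℝ≥0∞} {P : Program Q A α} {S : α → Prop} (hP : P.Always x S)
    {f : α → ℝ≥0∞} {c : ℝ≥0∞} (h : ∀ a, S a → f a ≤ c) :
    wp x κ P f ≤ wp x κ P (fun _ => 0) + c :=
  (wp_mono_of_always x hP h).trans (wp_const x κ P c).le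

theorem wp_le_of_forall {P : Program Q A α} {S : α → Prop} (hP : P.Always x S)
    {f : α → ℝ≥0∞} {c : ℝ≥0∞} (h : ∀ a, S a → f a ≤ c) : wp x 0 P f ≤ c :=
  (wp_mono_of_always x hP h).trans (wp_zero_const x P c).le

theorem tsum_pmf_map {γ δ : Type*} (p : PMF γ) (h : γ → δ) (g : δ → ℝ≥0∞) :
    ∑' d, p.map h d * g d = ∑' c, p c * g (h c) := by
  classical
  simp only [PMF.map_apply, ← ENNReal.tsum_mul_right]
  rw [ENNReal.tsum_comm]
  refine tsum_congr fun c => ?_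
  rw [tsum_eq_single (h c)]
  · simp
  · intro d hd
    simp [hd]

theorem tsum_pmf_bind {γ δ : Type*} (p : PMF γ) (h : γ → PMF δ) (g : δ → ℝ≥0∞) :
    ∑' d, p.bind h d * g d = ∑' c, p c * ∑' d, h c d * g d := by
  simp only [PMF.bind_apply, ← ENNReal.tsum_mul_right]
  rw [ENNReal.tsum_comm]
  simp only [mul_assoc, ENNReal.tsum_mul_left]

/-- This ties the recursively defined `wp` to the joint distribution `run`; expected cost and error
probability are the special cases `κ = 1`, `f = 0` and `κ = 0`, `f` an indicator. -/
theorem tsum_run (κ : ℝ≥0∞) (P : Program Q A α) (f : α → ℝ≥0∞) :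
    ∑' r : α × ℕ, P.run x r * (κ * (r.2 : ℝ≥0∞) + f r.1) = wp x κ P f := by
  have key : ∀ (p : PMF (α × ℕ)) (c : ℕ),
      ∑' r, p.map (fun r : α × ℕ => (r.1, r.2 + c)) r * (κ * (r.2 : ℝ≥0∞) + f r.1)
        = κ * c + ∑' r, p r * (κ * (r.2 : ℝ≥0∞) + f r.1) := by
    intro p c
    rw [tsum_pmf_map]
    calc _ = ∑' r, (p r * (κ * c) + p r * (κ * (r.2 : ℝ≥0∞) + f r.1)) :=
          tsum_congr fun r => by push_cast; ring
      _ = _ := by rw [ENNReal.tsum_add, ENNReal.tsum_mul_right, PMF.tsum_coe, one_mul]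
  induction P with
  | ret a =>
    rw [run, tsum_eq_single (a, 0)]
    · simp [wp]
    · intro r hr
      simp [PMF.pure_apply, hr]
  | ask q k ih =>
    rw [run, wp, key, ih]
    simp
  | coin N k ih =>
    rw [run, wp, tsum_pmf_bind, tsum_fintype]
    refine Finset.sum_congr rfl fun i _ => ?_
    rw [ih]
    simp [PMF.uniformOfFintype_apply]
  | quantum c k ih =>
    rw [run, wp, tsum_pmf_bind]
    simp only [key, ih]
    simp only [mul_add]
    rw [ENNReal.tsum_add, ENNReal.tsum_mul_right, PMF.tsum_coe, one_mul]

theorem expectedQueries_eq_wp (P : Program Q A α) :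
    P.expectedQueries x = wp x 1 P fun _ => 0 := by
  rw [← tsum_run]
  simp [expectedQueries]

open Classical in
theorem errorProbability_eq_wp (P : Program Q A α) (good : α → Prop) :
    P.errorProbability x good = wp x 0 P fun a => if good a then 0 else 1 := by
  rw [← tsum_run, errorProbability, PMF.toOuterMeasure_apply]
  refine tsum_congr fun r => ?_
  by_cases h : good r.1 <;> simp [h]

/-- The function that is `1` outside of `S` and `min 1 e` on `S`: a bound for the probability of a
later failure. -/
def risk (S : α → Prop) (e : α → ℝ≥0∞) (a : α) : ℝ≥0∞ :=
  open Classical in if S a then min 1 (e a) else 1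

theorem risk_le_one (S : α → Prop) (e : α → ℝ≥0∞) (a : α) : risk S e a ≤ 1 := by
  unfold risk
  split <;> simp

/-- The union bound as a composition rule: off `S` the continuation is written off with risk `1`,
and on `S` its risk is at most `e a`. Since `e` may depend on the intermediate result, it can be a
potential. The `min 1` in `risk` is harmless because the risk of any continuation is at most `1`. -/
theorem wp_bind_risk_le {P : Program Q A α} {k : α → Program Q A β} {S : α → Prop}
    {e : α → ℝ≥0∞} {T : β → Prop} {e' : β → ℝ≥0∞} {c : ℝ≥0∞}
    (hP : wp x 0 P (risk S e) ≤ c) (hk : ∀ a, S a → wp x 0 (k a) (risk T e') ≤ e a) :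
    wp x 0 (P >>= k) (risk T e') ≤ c := by
  rw [wp_bind]
  refine (wp_mono x P fun a => ?_).trans hP
  have h1 : wp x 0 (k a) (risk T e') ≤ 1 :=
    wp_le_of_forall x ((k a).always_true x) fun b _ => risk_le_one T e' b
  unfold risk
  split
  · exact le_min h1 (hk a ‹_›)
  · exact h1

theorem risk_mono {S T : α → Prop} {e e' : α → ℝ≥0∞} {a : α} (h : S a → T a)
    (he : S a → e' a ≤ e a) : risk T e' a ≤ risk S e a := by
  unfold risk
  by_cases hS : S a
  · rw [if_pos hS, if_pos (h hS)]
    exact min_le_min le_rfl (he hS)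
  · rw [if_neg hS]
    exact risk_le_one T e' a

theorem risk_le_add (S : α → Prop) [DecidablePred S] (c : ℝ≥0∞) (a : α) :
    risk S (fun _ => c) a ≤ (if S a then 0 else 1) + c := by
  unfold risk
  by_cases h : S a <;> simp [h]

theorem wp_risk_le_of_failure {P : Program Q A α} {S : α → Prop} [DecidablePred S] {ε : ℝ≥0∞}
    (h : wp x 0 P (fun a => if S a then 0 else 1) ≤ ε) (c : ℝ≥0∞) :
    wp x 0 P (risk S fun _ => c) ≤ ε + c := by
  refine (wp_mono x P (risk_le_add S c)).trans ?_
  rw [wp_add_const]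
  gcongr

/-! ### Repetition of a minimization program -/

theorem wp_repeatMin_zero {K : Type} [LinearOrder K] [OrderTop K] (κ : ℝ≥0∞)
    (P : Program Q A K) (k : ℕ) :
    wp x κ (repeatMin P k) (fun _ => 0) = k * wp x κ P fun _ => 0 := by
  induction k with
  | zero => simp [repeatMin]
  | succ k ih =>
    simp only [repeatMin, wp_bind, wp_pure, ih]
    rw [wp_const]
    push_cast
    ring

theorem always_repeatMin {K : Type} [LinearOrder K] [OrderTop K] {P : Program Q A K}
    {S : K → Prop} (hP : P.Always x S) (htop : S ⊤) (k : ℕ) : (repeatMin P k).Always x S := by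
  induction k with
  | zero => exact htop
  | succ k ih =>
    refine always_bind x hP fun a ha => always_bind x ih fun b hb => ?_
    change S (min a b)
    rcases min_choice a b with h | h <;> rw [h] <;> assumption

/-- The error is one-sided: no run returns less than `m`, so the minimum is wrong only if all `k`
independent runs are wrong. -/
theorem wp_repeatMin_failure {K : Type} [LinearOrder K] [OrderTop K] {P : Program Q A K} {m : K}
    (hP : P.Always x fun a => m ≤ a) {ε : ℝ≥0∞}
    (h : wp x 0 P (fun a => if a = m then 0 else 1) ≤ ε) (k : ℕ) :
    wp x 0 (repeatMin P k) (fun a => if a = m then 0 else 1) ≤ ε ^ k := by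
  induction k with
  | zero =>
    simp only [repeatMin, wp_pure, pow_zero]
    split <;> simp
  | succ k ih =>
    simp only [repeatMin, wp_bind, wp_pure]
    have h1 : ∀ a, m ≤ a → wp x 0 (repeatMin P k) (fun b => if min a b = m then 0 else 1)
        ≤ (if a = m then 0 else 1) * ε ^ k := by
      intro a ha
      by_cases hm : a = m
      · rw [if_pos hm, zero_mul]
        refine wp_le_of_forall x (always_repeatMin x hP le_top k) fun b hb => ?_
        simp [hm, hb]
      · rw [if_neg hm, one_mul]
        refine (wp_mono_of_always x (always_repeatMin x hP le_top k) fun b hb => ?_).trans ih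
        by_cases hb' : b = m
        · simp [hb', ha]
        · simp [hb']
          split <;> simp
    refine (wp_mono_of_always x hP h1).trans ?_
    rw [wp_mul_const, pow_succ']
    gcongr

end Program

open Program

/-! ### Amplitudes and outcomes of Grover iterations -/

section Grover

variable {Q A : Type} [AddCommGroup A] [DecidableEq Q] [DecidableEq A]

/-- The state `∑ₖ c k |addr k⟩|0⟩`. -/
def addressState {N : ℕ} (addr : Fin (N + 1) ↪ Q) (c : Fin (N + 1) → ℂ) : State Q A 1 :=
  ∑ k, lp.single 2 ((addr k, 0, 0) : BasisState Q A 1) (c k)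

theorem addressState_apply {N : ℕ} (addr : Fin (N + 1) ↪ Q) (c : Fin (N + 1) → ℂ)
    (b : BasisState Q A 1) :
    (addressState addr c : State Q A 1) b = ∑ k, if b = (addr k, 0, 0) then c k else 0 := by
  rw [addressState, lp.coeFn_sum, Finset.sum_apply]
  refine Finset.sum_congr rfl fun k _ => ?_
  rw [lp.single_apply, Pi.single_apply]

theorem addressState_apply_address {N : ℕ} (addr : Fin (N + 1) ↪ Q) (c : Fin (N + 1) → ℂ)
    (k : Fin (N + 1)) : (addressState addr c : State Q A 1) (addr k, 0, 0) = c k := by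
  rw [addressState_apply, Finset.sum_eq_single k]
  · simp
  · intro l _ hl
    rw [if_neg]
    intro h
    exact hl (addr.injective (congrArg Prod.fst h)).symm
  · simp

theorem addressState_apply_of_forall_ne {N : ℕ} (addr : Fin (N + 1) ↪ Q) (c : Fin (N + 1) → ℂ)
    {b : BasisState Q A 1} (h : ∀ k, b ≠ (addr k, 0, 0)) :
    (addressState addr c : State Q A 1) b = 0 := by
  rw [addressState_apply]
  exact Finset.sum_eq_zero fun k _ => if_neg (h k)

theorem eq_addressState {N : ℕ} {addr : Fin (N + 1) ↪ Q} {c : Fin (N + 1) → ℂ}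
    {ψ : State Q A 1} (h : ∀ k, ψ (addr k, 0, 0) = c k)
    (h' : ∀ b, (∀ k, b ≠ (addr k, 0, 0)) → ψ b = 0) : ψ = addressState addr c := by
  ext b
  by_cases hb : ∀ k, b ≠ (addr k, 0, 0)
  · rw [h' b hb, addressState_apply_of_forall_ne addr c hb]
  · push Not at hb
    obtain ⟨k, rfl⟩ := hb
    rw [h, addressState_apply_address]

theorem uniformState_eq {N : ℕ} (addr : Fin (N + 1) ↪ Q) :
    (uniformState addr : State Q A 1)
      = addressState addr fun _ => (((Real.sqrt (N + 1))⁻¹ : ℝ) : ℂ) := by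
  rw [uniformState, Finset.sum_map]
  rfl

theorem inner_addressState {N : ℕ} (addr : Fin (N + 1) ↪ Q) (c d : Fin (N + 1) → ℂ) :
    inner ℂ (addressState addr c : State Q A 1) (addressState addr d)
      = ∑ k, d k * (starRingEnd ℂ) (c k) := by
  conv_lhs => rw [addressState, sum_inner]
  refine Finset.sum_congr rfl fun k _ => ?_
  rw [lp.inner_single_left, addressState_apply_address]
  rfl

/-- The action of a Grover iteration on real amplitudes. -/
def groverStep {N : ℕ} (marked : Fin (N + 1) → Prop) [DecidablePred marked]
    (c : Fin (N + 1) → ℝ) (k : Fin (N + 1)) : ℝ :=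
  2 / (N + 1) * (∑ l, if marked l then -c l else c l) - if marked k then -c k else c k

theorem foldl_groverIteration {N : ℕ} (x : Q → A) (addr : Fin (N + 1) ↪ Q) (mark : Q → A → Bool)
    (c : Fin (N + 1) → ℝ) :
    (groverIteration addr mark).foldl (fun ψ g => g.apply x ψ)
        (addressState addr fun k => (c k : ℂ))
      = addressState addr fun k =>
          (groverStep (fun k => mark (addr k) (x (addr k)) = true) c k : ℂ) := by
  have h1 : (queryUnitary 1 x).symm (phaseGate (fun b => mark b.1 b.2.1)
      (queryUnitary 1 x (addressState addr fun k => (c k : ℂ))))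
      = addressState addr fun k =>
        (((if mark (addr k) (x (addr k)) = true then -c k else c k : ℝ)) : ℂ) := by
    -- Query, phase flip and inverse query together are diagonal in the basis. On the address states
    -- the answer register holds `0`, so the sign depends on the true answer `x q`.
    have h2 : ∀ (ψ : State Q A 1) (b : BasisState Q A 1), ((queryUnitary 1 x).symm
        (phaseGate (fun b => mark b.1 b.2.1) (queryUnitary 1 x ψ))) b
        = if mark b.1 (b.2.1 + x b.1) then -ψ b else ψ b := by
      intro ψ b
      have : (queryPerm 1 x).symm (queryPerm 1 x b) = b := by simp
      change (if mark b.1 (b.2.1 + x b.1) = true then -ψ ((queryPerm 1 x).symm (queryPerm 1 x b))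
        else ψ ((queryPerm 1 x).symm (queryPerm 1 x b))) = _
      rw [this]
    refine eq_addressState (fun k => ?_) fun b hb => ?_
    · rw [h2, addressState_apply_address]
      simp only [zero_add]
      split <;> simp
    · rw [h2, addressState_apply_of_forall_ne _ _ hb]
      simp
  simp only [groverIteration, List.foldl_cons, List.foldl_nil, Gate.apply]
  rw [h1, Submodule.reflection_singleton_apply, norm_uniformState, uniformState_eq,
    inner_addressState]
  refine eq_addressState (fun k => ?_) fun b hb => ?_
  · simp only [lp.coeFn_sub, Pi.sub_apply, lp.coeFn_smul, Pi.smul_apply,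
      addressState_apply_address, groverStep, Complex.conj_ofReal, ← Finset.sum_mul,
      smul_eq_mul, two_smul, lp.coeFn_add, Pi.add_apply]
    have hN : (0 : ℝ) < N + 1 := by positivity
    have hs : (Real.sqrt (N + 1))⁻¹ * (Real.sqrt (N + 1))⁻¹ = 1 / ((N : ℝ) + 1) := by
      rw [← mul_inv, Real.mul_self_sqrt hN.le, one_div]
    rw [← Complex.ofReal_sum]
    generalize (∑ l, if mark (addr l) (x (addr l)) = true then -c l else c l) = y
    generalize (if mark (addr k) (x (addr k)) = true then -c k else c k) = z
    simp only [RCLike.ofReal_one, one_pow, div_one]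
    norm_cast
    push_cast
    rw [mul_assoc, hs]
    ring
  · rw [lp.coeFn_sub, Pi.sub_apply, addressState_apply_of_forall_ne _ _ hb, two_smul,
      lp.coeFn_add, Pi.add_apply, lp.coeFn_smul, Pi.smul_apply,
      addressState_apply_of_forall_ne _ _ hb]
    simp

theorem cost_groverIteration {N : ℕ} (addr : Fin (N + 1) ↪ Q) (mark : Q → A → Bool) :
    ((groverIteration addr mark : List (Gate Q A 1)).map Gate.cost).sum = 2 := rfl

theorem cost_grover {N : ℕ} (addr : Fin (N + 1) ↪ Q) (mark : Q → A → Bool) (j : ℕ) :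
    (grover addr mark j : Circuit Q A).cost = 2 * j := by
  change ((List.replicate j (groverIteration addr mark : List (Gate Q A 1))).flatten.map
    Gate.cost).sum = 2 * j
  induction j with
  | zero => rfl
  | succ j ih =>
    rw [List.replicate_succ, List.flatten_cons, List.map_append, List.sum_append, ih,
      cost_groverIteration]
    ring

theorem foldl_replicate_groverIteration {N : ℕ} (x : Q → A) (addr : Fin (N + 1) ↪ Q)
    (mark : Q → A → Bool) (j : ℕ) (c : Fin (N + 1) → ℝ) :
    (List.replicate j (groverIteration addr mark)).flatten.foldl (fun ψ g => g.apply x ψ)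
        (addressState addr fun k => (c k : ℂ))
      = addressState addr fun k =>
          ((groverStep fun k => mark (addr k) (x (addr k)) = true)^[j] c k : ℂ) := by
  induction j generalizing c with
  | zero => rfl
  | succ j ih =>
    rw [List.replicate_succ, List.flatten_cons, List.foldl_append, foldl_groverIteration, ih]
    rfl

/-- The amplitudes after `j` Grover iterations, where `sin² θ` is the fraction of the marked
addresses. -/
theorem groverStep_iterate {N : ℕ} (marked : Fin (N + 1) → Prop) [DecidablePred marked] (θ : ℝ)
    (hθ : (N + 1) * Real.sin θ ^ 2 = (Finset.univ.filter marked).card) (j : ℕ) :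
    ∃ a b : ℝ, Real.sin θ * a = Real.sin ((2 * j + 1) * θ) ∧
      Real.cos θ * b = Real.cos ((2 * j + 1) * θ) ∧
      ∀ k, (groverStep marked)^[j] (fun _ => (Real.sqrt (N + 1))⁻¹) k
        = (Real.sqrt (N + 1))⁻¹ * if marked k then a else b := by
  induction j with
  | zero => exact ⟨1, 1, by simp, by simp, fun k => by simp⟩
  | succ j ih =>
    obtain ⟨a, b, ha, hb, h⟩ := ih
    have hN : ((N : ℝ) + 1) ≠ 0 := by positivity
    have hcos : (N + 1) * Real.cos θ ^ 2 = (Finset.univ.filter fun k => ¬ marked k).card := by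
      have h1 := Finset.card_filter_add_card_filter_not (s := Finset.univ) marked
      rw [Finset.card_univ, Fintype.card_fin] at h1
      have h2 : ((Finset.univ.filter marked).card : ℝ)
          + (Finset.univ.filter fun k => ¬ marked k).card = N + 1 := by exact_mod_cast h1
      rw [Real.cos_sq', mul_sub, hθ]
      linarith
    -- Twice the mean after the sign flip. The fractions of marked and unmarked addresses are `sin²
    -- θ` and `cos² θ`, so the mean is, up to normalization, `cos θ · cos ((2 j + 1) θ) - sin θ ·
    -- sin ((2 j + 1) θ)`.
    have hsum : 2 / (N + 1) * (∑ l, if marked l then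
          -((Real.sqrt (N + 1))⁻¹ * if marked l then a else b)
          else (Real.sqrt (N + 1))⁻¹ * if marked l then a else b)
        = (Real.sqrt (N + 1))⁻¹ * (2 * Real.cos ((2 * j + 1) * θ + θ)) := by
      rw [Finset.sum_ite, Finset.sum_congr rfl (g := fun _ => -((Real.sqrt (N + 1))⁻¹ * a)),
        Finset.sum_congr (s₁ := Finset.univ.filter fun k => ¬ marked k) rfl
          (g := fun _ => (Real.sqrt (N + 1))⁻¹ * b), Finset.sum_const,
        Finset.sum_const, nsmul_eq_mul, nsmul_eq_mul, ← hθ, ← hcos, Real.cos_add, ← ha, ← hb]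
      · field_simp
        ring
      · intro k hk
        rw [if_neg (Finset.mem_filter.1 hk).2]
      · intro k hk
        rw [if_pos (Finset.mem_filter.1 hk).2]
    -- Inversion about the mean of `-a` and `b`. The invariant relates `sin θ * a` and `cos θ * b`
    -- to the angle, rather than `a` and `b` to quotients, because `sin θ` or `cos θ` vanishes when
    -- no or all addresses are marked.
    refine ⟨2 * Real.cos ((2 * j + 1) * θ + θ) + a, 2 * Real.cos ((2 * j + 1) * θ + θ) - b,
      ?_, ?_, fun k => ?_⟩
    · have h3 : Real.sin ((2 * j + 1) * θ) = Real.sin (((2 * j + 1) * θ + θ) - θ) := by ring_nf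
      have h4 : (2 * ((j + 1 : ℕ) : ℝ) + 1) * θ = ((2 * j + 1) * θ + θ) + θ := by push_cast; ring
      rw [h4, mul_add, ha, h3]
      generalize (2 * j + 1) * θ + θ = y
      rw [Real.sin_add, Real.sin_sub]
      ring
    · have h3 : Real.cos ((2 * j + 1) * θ) = Real.cos (((2 * j + 1) * θ + θ) - θ) := by ring_nf
      have h4 : (2 * ((j + 1 : ℕ) : ℝ) + 1) * θ = ((2 * j + 1) * θ + θ) + θ := by push_cast; ring
      rw [h4, mul_sub, hb, h3]
      generalize (2 * j + 1) * θ + θ = y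
      rw [Real.cos_add, Real.cos_sub]
      ring
    · rw [Function.iterate_succ_apply', funext h, groverStep, hsum]
      split <;> ring

/-- The measurement after `j` Grover iterations yields each marked address with the same
probability, `sin² ((2 j + 1) θ)` in total, and each unmarked one with the same probability. -/
theorem tsum_measure_grover {N : ℕ} (x : Q → A) (addr : Fin (N + 1) ↪ Q) (mark : Q → A → Bool)
    (θ : ℝ) (hθ : (N + 1) * Real.sin θ ^ 2
      = (Finset.univ.filter fun k => mark (addr k) (x (addr k)) = true).card) (j : ℕ) :
    ∃ p q : ℝ, 0 ≤ p ∧ 0 ≤ q ∧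
      (Finset.univ.filter fun k => mark (addr k) (x (addr k)) = true).card * p
        = Real.sin ((2 * j + 1) * θ) ^ 2 ∧
      (Finset.univ.filter fun k => ¬ mark (addr k) (x (addr k)) = true).card * q
        = 1 - Real.sin ((2 * j + 1) * θ) ^ 2 ∧
      ∀ F : BasisState Q A 1 → ℝ≥0∞, ∑' b, (grover addr mark j).measure x b * F b
        = ∑ k, ENNReal.ofReal (if mark (addr k) (x (addr k)) = true then p else q)
          * F (addr k, 0, 0) := by
  obtain ⟨a, b, ha, hb, h⟩ := groverStep_iterate _ θ hθ j
  have hN : (0 : ℝ) < N + 1 := by positivity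
  have hcos : (N + 1) * Real.cos θ ^ 2
      = (Finset.univ.filter fun k => ¬ mark (addr k) (x (addr k)) = true).card := by
    have h1 := Finset.card_filter_add_card_filter_not (s := Finset.univ)
      fun k => mark (addr k) (x (addr k)) = true
    rw [Finset.card_univ, Fintype.card_fin] at h1
    have h2 : ((Finset.univ.filter fun k => mark (addr k) (x (addr k)) = true).card : ℝ)
        + (Finset.univ.filter fun k => ¬ mark (addr k) (x (addr k)) = true).card = N + 1 := by
      exact_mod_cast h1
    rw [Real.cos_sq', mul_sub, hθ]
    linarith
  refine ⟨a ^ 2 / (N + 1), b ^ 2 / (N + 1), by positivity, by positivity, ?_, ?_, fun F => ?_⟩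
  · rw [← hθ, ← ha]
    field_simp
  · rw [← hcos, ← Real.cos_sq', ← hb]
    field_simp
  · let φ : State Q A 1 := addressState addr fun k =>
      (((Real.sqrt (N + 1))⁻¹ * if mark (addr k) (x (addr k)) = true then a else b : ℝ) : ℂ)
    have hfin : (grover addr mark j : Circuit Q A).finalState x = φ := by
      change (List.replicate j (groverIteration addr mark)).flatten.foldl
        (fun ψ g => g.apply x ψ) (uniformState addr) = _
      rw [uniformState_eq, foldl_replicate_groverIteration]
      simp only [h, φ]
    have hmeas : ∀ i : BasisState Q A 1, (grover addr mark j : Circuit Q A).measure x i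
        = ENNReal.ofReal (‖φ i‖ ^ 2) :=
      fun i => congrArg (fun ψ : State Q A 1 => ENNReal.ofReal (‖ψ i‖ ^ 2)) hfin
    have hinj : Function.Injective fun k => ((addr k, 0, 0) : BasisState Q A 1) :=
      fun k l hkl => addr.injective (congrArg Prod.fst hkl)
    refine (tsum_congr fun i => congrArg (· * F i) (hmeas i)).trans ?_
    change ∑' i : BasisState Q A 1, ENNReal.ofReal (‖φ i‖ ^ 2) * F i = _
    rw [tsum_eq_sum (s := Finset.univ.image fun k => ((addr k, 0, 0) : BasisState Q A 1)),
      Finset.sum_image hinj.injOn]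
    · refine Finset.sum_congr rfl fun k _ => ?_
      rw [addressState_apply_address]
      congr 2
      rw [Complex.norm_real, Real.norm_eq_abs, sq_abs, mul_pow, inv_pow, Real.sq_sqrt hN.le]
      split <;> field_simp
    · intro i hi
      rw [addressState_apply_of_forall_ne addr _ fun k hk => hi ?_]
      · simp
      · rw [hk]
        exact Finset.mem_image_of_mem _ (Finset.mem_univ k)

/-- The state never leaves the span of the address states. This is read off from
`tsum_measure_grover` with the indicator of `b` as test function; the angle is the arcsine of the
root of the marked fraction. -/
theorem exists_of_measure_grover_ne_zero {N : ℕ} (x : Q → A) (addr : Fin (N + 1) ↪ Q)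
    (mark : Q → A → Bool) (j : ℕ) {b : BasisState Q A 1}
    (hb : (grover addr mark j).measure x b ≠ 0) : ∃ k, b.1 = addr k := by
  classical
  by_contra! hk
  have hN : (0 : ℝ) < N + 1 := by positivity
  set t := (Finset.univ.filter fun k => mark (addr k) (x (addr k)) = true).card
  have ht : (t : ℝ) / (N + 1) ≤ 1 := by
    rw [div_le_one hN]
    have := Finset.card_le_univ (Finset.univ.filter fun k => mark (addr k) (x (addr k)) = true)
    rw [Fintype.card_fin] at this
    exact_mod_cast this
  obtain ⟨p, q, -, -, -, -, h⟩ := tsum_measure_grover x addr mark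
    (Real.arcsin (Real.sqrt (t / (N + 1)))) (by
      rw [Real.sin_arcsin (by linarith [Real.sqrt_nonneg ((t : ℝ) / (N + 1))])
        (Real.sqrt_le_one.2 ht), Real.sq_sqrt (by positivity)]
      field_simp
      rfl) j
  have h1 := h fun b' => if b' = b then 1 else 0
  rw [Finset.sum_eq_zero] at h1
  · rw [ENNReal.tsum_eq_zero] at h1
    simpa [hb] using h1 b
  · intro k _
    rw [if_neg fun h => hk k (congrArg Prod.fst h).symm, mul_zero]

end Grover

/-! ### The success probability of exponential search -/

/-- Each product is a difference of sines at consecutive multiples of `4 θ`, so the sum telescopes.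
-/
theorem two_mul_sin_mul_sum_cos (θ : ℝ) (M : ℕ) :
    2 * Real.sin (2 * θ) * ∑ j ∈ Finset.range M, Real.cos ((4 * j + 2) * θ)
      = Real.sin (4 * M * θ) := by
  induction M with
  | zero => simp
  | succ M ih =>
    rw [Finset.sum_range_succ, mul_add, ih]
    have h1 : 4 * ((M + 1 : ℕ) : ℝ) * θ = (4 * M + 2) * θ + 2 * θ := by push_cast; ring
    have h2 : 4 * (M : ℝ) * θ = (4 * M + 2) * θ - 2 * θ := by ring
    rw [h1, h2, Real.sin_add, Real.sin_sub]
    ring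

/-- As long as `2 M y ≤ π` the right side is nonnegative; beyond that, Jordan's inequality `sin y ≥
2 y / π` makes `M sin y` at least `1`. -/
theorem neg_mul_sin_le_sin_two_mul {y : ℝ} (h0 : 0 ≤ y) (h1 : y ≤ Real.pi / 2) (M : ℕ) :
    -(M * Real.sin y) ≤ Real.sin (2 * M * y) := by
  have hpi := Real.pi_pos
  have hs : 0 ≤ Real.sin y := Real.sin_nonneg_of_nonneg_of_le_pi h0 (by linarith)
  by_cases h : 2 * M * y ≤ Real.pi
  · have : 0 ≤ Real.sin (2 * M * y) := Real.sin_nonneg_of_nonneg_of_le_pi (by positivity) h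
    have : 0 ≤ M * Real.sin y := by positivity
    linarith
  · push Not at h
    have h2 := mul_le_mul_of_nonneg_left (Real.mul_le_sin h0 h1) (Nat.cast_nonneg' M)
    have h3 : 1 ≤ (M : ℝ) * (2 / Real.pi * y) := by
      rw [show (M : ℝ) * (2 / Real.pi * y) = 2 * M * y / Real.pi by ring, le_div_iff₀ hpi]
      linarith
    linarith [Real.neg_one_le_sin (2 * M * y)]

/-- By the telescoped formula it suffices that `sin (4 M θ) ≤ M sin (2 θ)`. Up to `π / 4` this
follows from `sin (2 θ) ≥ sin θ ≥ 1 / M`. Above `π / 4`, where `sin (2 θ)` may be tiny, it is the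
previous lemma for `y = π - 2 θ`. At `π / 2` one cannot divide by `sin (2 θ) = 0`, but there all
cosines are `-1`. -/
theorem sum_cos_le {θ : ℝ} (h0 : 0 ≤ θ) (h1 : θ ≤ Real.pi / 2) {M : ℕ}
    (hM : 1 ≤ M * Real.sin θ) :
    ∑ j ∈ Finset.range M, Real.cos ((4 * j + 2) * θ) ≤ M / 2 := by
  have hpi := Real.pi_pos
  have key := two_mul_sin_mul_sum_cos θ M
  have hM0 : (0 : ℝ) ≤ M := Nat.cast_nonneg M
  have hs : 0 < Real.sin θ := by
    by_contra! h
    nlinarith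
  rcases le_total (Real.pi / 4) θ with h | h
  · rcases h1.eq_or_lt with rfl | h1
    · have : ∀ j ∈ Finset.range M, Real.cos ((4 * (j : ℝ) + 2) * (Real.pi / 2)) = -1 := by
        intro j _
        rw [show (4 * (j : ℝ) + 2) * (Real.pi / 2) = Real.pi + j * (2 * Real.pi) by ring,
          Real.cos_add_nat_mul_two_pi, Real.cos_pi]
      rw [Finset.sum_congr rfl this, Finset.sum_const, Finset.card_range, nsmul_eq_mul]
      linarith
    · have h2 := neg_mul_sin_le_sin_two_mul (y := Real.pi - 2 * θ) (by linarith) (by linarith) M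
      have h3 : Real.sin (2 * M * (Real.pi - 2 * θ)) = -Real.sin (4 * M * θ) := by
        rw [show 2 * M * (Real.pi - 2 * θ) = -(4 * M * θ) + M * (2 * Real.pi) by ring,
          Real.sin_add_nat_mul_two_pi, Real.sin_neg]
      rw [h3, Real.sin_pi_sub] at h2
      have h4 : 0 < Real.sin (2 * θ) := Real.sin_pos_of_pos_of_lt_pi (by linarith) (by linarith)
      refine le_of_mul_le_mul_left ?_ (mul_pos two_pos h4)
      rw [key]
      linarith
  · have hc : Real.sqrt 2 / 2 ≤ Real.cos θ := by
      rw [← Real.cos_pi_div_four]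
      exact Real.cos_le_cos_of_nonneg_of_le_pi h0 (by linarith) h
    have h12 : (1 : ℝ) ≤ Real.sqrt 2 := Real.one_le_sqrt.2 (by norm_num)
    have h2 : Real.sin θ ≤ Real.sin (2 * θ) := by
      rw [Real.sin_two_mul]
      nlinarith
    refine le_of_mul_le_mul_left ?_ (mul_pos two_pos (hs.trans_le h2))
    rw [key]
    have := mul_le_mul_of_nonneg_left h2 hM0
    linarith [Real.sin_le_one (4 * M * θ)]

/-- With at least `1 / sin θ` possible numbers of iterations, the average success probability is at
least `1 / 4`. -/
theorem quarter_le_sum_sin_sq {θ : ℝ} (h0 : 0 ≤ θ) (h1 : θ ≤ Real.pi / 2) {M : ℕ}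
    (hM : 1 ≤ M * Real.sin θ) :
    (M : ℝ) / 4 ≤ ∑ j ∈ Finset.range M, Real.sin ((2 * j + 1) * θ) ^ 2 := by
  have h2 : ∀ j ∈ Finset.range M, Real.sin ((2 * (j : ℝ) + 1) * θ) ^ 2
      = 1 / 2 - Real.cos ((4 * j + 2) * θ) / 2 := by
    intro j _
    rw [Real.sin_sq_eq_half_sub]
    ring_nf
  rw [Finset.sum_congr rfl h2, Finset.sum_sub_distrib, Finset.sum_const, ← Finset.sum_div,
    Finset.card_range, nsmul_eq_mul]
  linarith [sum_cos_le h0 h1 hM]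

/-! ### Potentials for the expected time -/

/-- A bound for the expected time that the exponential search needs from round `r` on, when one
address in `m ^ 2` is marked and the number of iterations is capped at `cap`. -/
def searchTime (m cap : ℝ) (r : ℕ) : ℝ :=
  if (6 / 5 : ℝ) ^ r < m then 19 * m - 15 / 2 * (6 / 5 : ℝ) ^ r
  else 5 * min ((6 / 5 : ℝ) ^ r) cap + 4

theorem searchTime_nonneg {m cap : ℝ} (hc : 0 ≤ cap) (r : ℕ) :
    0 ≤ searchTime m cap r := by
  unfold searchTime
  have : (0 : ℝ) < (6 / 5 : ℝ) ^ r := by positivity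
  split
  · linarith
  · positivity

theorem searchTime_zero_le {m cap : ℝ} (hm : 1 ≤ m) : searchTime m cap 0 ≤ 19 * m := by
  unfold searchTime
  split
  · rw [pow_zero]
    linarith
  · rw [pow_zero]
    linarith [min_le_left 1 cap]

/-- The potential pays for a round of expected time at most `u / 2 + 1`, where `u = min ((6/5)^r)
cap`. Once `u ≥ m`, the failure probability is at most `3 / 4`, and `5 u + 4` solves the recurrence
exactly: `u / 2 + 1 + 3 / 4 * (6 u + 4) = 5 u + 4`. Before that no success is assumed: the term `-
15 / 2 * u` drops to `-9 u` in one round, which releases `3 / 2 * u ≥ u / 2 + 1`. The factor `19 =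
15 + 4` makes the two regimes fit, since `6 u + 4 ≤ 19 m - 9 u` for `1 ≤ u < m`. -/
theorem searchTime_step {m cap : ℝ} (hmc : m ≤ cap) (hc : 1 ≤ cap) (r : ℕ) {p : ℝ}
    (hp0 : 0 ≤ p) (hp : m ≤ min ((6 / 5 : ℝ) ^ r) cap → 1 / 4 ≤ p) :
    min ((6 / 5 : ℝ) ^ r) cap / 2 + 1 + (1 - p) * searchTime m cap (r + 1)
      ≤ searchTime m cap r := by
  have h1 : (1 : ℝ) ≤ (6 / 5 : ℝ) ^ r := one_le_pow₀ (by norm_num)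
  have hB := searchTime_nonneg (m := m) (cap := cap) (by linarith) (r + 1)
  by_cases h : (6 / 5 : ℝ) ^ r < m
  · have h2 : (1 - p) * searchTime m cap (r + 1) ≤ searchTime m cap (r + 1) := by nlinarith
    have h3 : searchTime m cap r = 19 * m - 15 / 2 * (6 / 5 : ℝ) ^ r := if_pos h
    rw [min_eq_left (by linarith), h3]
    have h4 : searchTime m cap (r + 1) ≤ 19 * m - 9 * (6 / 5 : ℝ) ^ r := by
      unfold searchTime
      split
      · rw [pow_succ]; linarith
      · have := min_le_left ((6 / 5 : ℝ) ^ (r + 1)) cap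
        rw [pow_succ] at this ⊢
        linarith
    linarith
  · have h' : m ≤ min ((6 / 5 : ℝ) ^ r) cap := le_min (not_lt.1 h) hmc
    have h3 : searchTime m cap r = 5 * min ((6 / 5 : ℝ) ^ r) cap + 4 := if_neg h
    have h5 : searchTime m cap (r + 1) = 5 * min ((6 / 5 : ℝ) ^ (r + 1)) cap + 4 := by
      refine if_neg ?_
      rw [pow_succ]
      linarith
    have h6 : min ((6 / 5 : ℝ) ^ (r + 1)) cap ≤ 6 / 5 * min ((6 / 5 : ℝ) ^ r) cap := by
      rw [pow_succ]
      rcases min_cases ((6 / 5 : ℝ) ^ r) cap with ⟨h7, -⟩ | ⟨h7, -⟩ <;> rw [h7]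
      · exact (min_le_left _ _).trans (by linarith)
      · exact (min_le_right _ _).trans (by linarith)
    have h7 : 0 ≤ min ((6 / 5 : ℝ) ^ r) cap := by positivity
    rw [h3]
    have h8 := hp h'
    have h9 : (1 - p) * searchTime m cap (r + 1) ≤ 3 / 4 * searchTime m cap (r + 1) := by
      nlinarith
    rw [h5] at h9 ⊢
    linarith

/-- A bound for the expected time of the minimum search among `b ^ 2` addresses, `t` of which are
below the threshold. -/
def descentTime (b : ℝ) (t : ℕ) : ℝ := if t = 0 then 0 else b * (38 - 19 / Real.sqrt t)

theorem descentTime_mono {b : ℝ} (hb : 0 ≤ b) : Monotone (descentTime b) := by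
  intro s t h
  unfold descentTime
  have h19 : ∀ u : ℕ, u ≠ 0 → 19 / Real.sqrt u ≤ 19 := by
    intro u hu
    refine div_le_self (by norm_num) (Real.one_le_sqrt.2 ?_)
    exact_mod_cast Nat.one_le_iff_ne_zero.2 hu
  by_cases hs : s = 0
  · rw [if_pos hs]
    split
    · exact le_rfl
    · exact mul_nonneg hb (by linarith [h19 t ‹_›])
  · have ht : t ≠ 0 := by omega
    rw [if_neg hs, if_neg ht]
    have : 0 < Real.sqrt s := Real.sqrt_pos.2 (by exact_mod_cast Nat.pos_of_ne_zero hs)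
    gcongr

theorem descentTime_le {b : ℝ} (hb : 0 ≤ b) (t : ℕ) : descentTime b t ≤ 38 * b := by
  unfold descentTime
  split
  · positivity
  · have : 0 ≤ 19 / Real.sqrt t := by positivity
    nlinarith

/-- A successful round moves to a uniformly random smaller rank, so the mean of the potential over
the ranks below `t` is needed; it is at most `b (38 - 38 / √t)`. The gap to `descentTime b t` is `19
b / √t`, just what a search from round `0` costs. The induction step is `√(t + 1) ≤ √t + 1 / (2
√t)`. -/
theorem sum_descentTime_le {b : ℝ} (hb : 0 ≤ b) {t : ℕ} (ht : t ≠ 0) :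
    ∑ i ∈ Finset.range t, descentTime b i ≤ b * (38 * (t - Real.sqrt t)) := by
  induction t with
  | zero => exact absurd rfl ht
  | succ t ih =>
    rcases Nat.eq_zero_or_pos t with rfl | h
    · simp [descentTime]
    · rw [Finset.sum_range_succ]
      refine (add_le_add_left (ih h.ne') _).trans ?_
      rw [descentTime, if_neg h.ne', ← mul_add]
      refine mul_le_mul_of_nonneg_left ?_ hb
      have h1 : 0 < Real.sqrt t := Real.sqrt_pos.2 (by exact_mod_cast h)
      have h2 : Real.sqrt t ^ 2 = t := Real.sq_sqrt (Nat.cast_nonneg t)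
      have h3 : Real.sqrt ((t + 1 : ℕ) : ℝ) ≤ Real.sqrt t + 1 / (2 * Real.sqrt t) := by
        rw [Real.sqrt_le_left (by positivity)]
        push_cast
        have : (Real.sqrt t + 1 / (2 * Real.sqrt t)) ^ 2
            = Real.sqrt t ^ 2 + 1 + (1 / (2 * Real.sqrt t)) ^ 2 := by field_simp; ring
        rw [this, h2]
        linarith [sq_nonneg (1 / (2 * Real.sqrt t))]
      have h4 : 19 / Real.sqrt t = 38 * (1 / (2 * Real.sqrt t)) := by field_simp; norm_num
      rw [h4]
      push_cast at h3 ⊢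
      linarith

/-- A sum over the ranks of the elements of `S`. -/
theorem sum_rank_le {ι K : Type*} [LinearOrder K] [DecidableEq ι] (f : ι → K) (g : ℕ → ℝ)
    (hg : Monotone g) (S : Finset ι) :
    ∑ k ∈ S, g (S.filter fun l => f l < f k).card ≤ ∑ i ∈ Finset.range S.card, g i := by
  induction S using Finset.induction_on_max_value f with
  | empty => simp
  | insert a S ha hmax ih =>
    rw [Finset.sum_insert ha, Finset.card_insert_of_notMem ha, Finset.sum_range_succ, add_comm]
    -- The new element has the largest key, so it changes no other rank. With ties its own rank may
    -- be less than the size of `S`; monotonicity of `g` absorbs this.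
    refine add_le_add ((Finset.sum_le_sum fun k hk => le_of_eq ?_).trans ih) (hg ?_)
    · rw [Finset.filter_insert, if_neg (not_lt.2 (hmax k hk))]
    · rw [Finset.filter_insert, if_neg (lt_irrefl _)]
      exact Finset.card_filter_le _ _

/-! ### The main loop of the minimum search: queries and failure -/

section DurrHoyer

variable {Q A : Type} [AddCommGroup A] [DecidableEq Q] [DecidableEq A] {K : Type} [LinearOrder K]
  {N : ℕ} (x : Q → A) (addr : Fin (N + 1) ↪ Q) (key : Q → A → K)

/-- The loop returns either the threshold or a smaller key. -/
theorem always_durrHoyerLoop (T r : ℕ) (val : K) :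
    (durrHoyerLoop addr key T r val).Always x fun z =>
      z ≤ val ∧ (z = val ∨ ∃ k, z = key (addr k) (x (addr k))) := by
  induction T using Nat.strong_induction_on generalizing r val with
  | _ T ih =>
    match T with
    | 0 =>
      rw [durrHoyerLoop.eq_1]
      exact ⟨le_rfl, Or.inl rfl⟩
    | T + 1 =>
      rw [durrHoyerLoop.eq_2]
      intro j
      beta_reduce
      by_cases hj : (j : ℕ) ≤ T
      · rw [if_pos hj]
        intro b hb
        obtain ⟨k, hk⟩ := exists_of_measure_grover_ne_zero x addr _ _ hb
        change Always x _ (if key b.1 (x b.1) < val then _ else _)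
        split
        · rename_i hlt
          refine (ih (T - j) (by omega) 0 (key b.1 (x b.1))).mono x fun z hz =>
            ⟨hz.1.trans hlt.le, Or.inr ?_⟩
          rcases hz.2 with h | h
          · exact ⟨k, by rw [h, hk]⟩
          · exact h
        · exact ih (T - j) (by omega) (r + 1) val
      · rw [if_neg hj]
        exact ⟨le_rfl, Or.inl rfl⟩

omit [DecidableEq Q] [DecidableEq A] in
theorem wp_quantum_le {α : Type} {C : ℝ≥0∞} (c : Circuit Q A)
    (k : BasisState Q A c.dim → Program Q A α) (f : α → ℝ≥0∞) (h : ∀ b, wp x 1 (k b) f ≤ C) :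
    wp x 1 (.quantum c k) f ≤ c.cost + C := by
  rw [wp, one_mul]
  refine add_le_add_right ((ENNReal.tsum_le_tsum fun b => mul_le_mul_right (h b) _).trans ?_) _
  rw [ENNReal.tsum_mul_right, PMF.tsum_coe, one_mul]

/-- A round of time `j + 1` makes `2 j` queries in the Grover iterations and one classical query,
hence at most `2 (j + 1)`. -/
theorem wp_durrHoyerLoop_le (T r : ℕ) (val : K) :
    wp x 1 (durrHoyerLoop addr key T r val) (fun _ => 0) ≤ 2 * T := by
  induction T using Nat.strong_induction_on generalizing r val with
  | _ T ih =>
    match T with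
    | 0 =>
      rw [durrHoyerLoop.eq_1]
      simp
    | T + 1 =>
      rw [durrHoyerLoop.eq_2]
      change ∑ j : Fin _, _ ≤ _
      refine (Finset.sum_le_sum fun j _ => mul_le_mul_right ?_ _).trans (sum_coin_const _ _).le
      beta_reduce
      by_cases hj : (j : ℕ) ≤ T
      · rw [if_pos hj]
        refine (wp_quantum_le x (C := 1 + 2 * ((T - j : ℕ) : ℝ≥0∞)) _ _ _ fun b => ?_).trans ?_
        · change 1 + wp x 1 (if key b.1 (x b.1) < val then
            durrHoyerLoop addr key (T - j) 0 (key b.1 (x b.1))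
            else durrHoyerLoop addr key (T - j) (r + 1) val) _ ≤ _
          refine add_le_add_right ?_ _
          split <;> exact ih (T - j) (by omega) _ _
        rw [cost_grover]
        obtain ⟨d, rfl⟩ := Nat.exists_eq_add_of_le hj
        rw [Nat.add_sub_cancel_left]
        norm_cast
        omega
      · rw [if_neg hj]
        simp

/-- The number of addresses whose keys are below `val`. -/
def rankBelow (val : K) : ℕ := (Finset.univ.filter fun k => key (addr k) (x (addr k)) < val).card

/-- A bound for the expected remaining time of the main loop. -/
def loopTime (N r t : ℕ) : ℝ :=
  if t = 0 then 0
  else searchTime (Real.sqrt (N + 1) / Real.sqrt t) (Real.sqrt (N + 1)) r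
    + Real.sqrt (N + 1) * (38 - 38 / Real.sqrt t)

theorem loopTime_nonneg (N r t : ℕ) : 0 ≤ loopTime N r t := by
  unfold loopTime
  split
  · exact le_rfl
  · have h1 : 1 ≤ Real.sqrt t := by
      refine Real.one_le_sqrt.2 ?_
      exact_mod_cast Nat.one_le_iff_ne_zero.2 ‹_›
    have h2 : 38 / Real.sqrt t ≤ 38 := div_le_self (by norm_num) h1
    have h3 := searchTime_nonneg (m := Real.sqrt (N + 1) / Real.sqrt t)
      (Real.sqrt_nonneg ((N : ℝ) + 1)) r
    have h4 : 0 ≤ Real.sqrt ((N : ℝ) + 1) * (38 - 38 / Real.sqrt t) :=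
      mul_nonneg (Real.sqrt_nonneg _) (by linarith)
    linarith

/-- The recursion closes here: a fresh search costs at most `19 √(N + 1) / √t`, and adding the mean
potential of the next threshold gives back `descentTime`. -/
theorem loopTime_zero_le {N t : ℕ} (ht : t ≤ N + 1) :
    loopTime N 0 t ≤ descentTime (Real.sqrt (N + 1)) t := by
  unfold loopTime descentTime
  split
  · exact le_rfl
  · have h1 : 0 < Real.sqrt t := Real.sqrt_pos.2 (by exact_mod_cast Nat.pos_of_ne_zero ‹_›)
    have h2 : 1 ≤ Real.sqrt (N + 1) / Real.sqrt t := by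
      rw [one_le_div h1]
      exact Real.sqrt_le_sqrt (by exact_mod_cast ht)
    have h3 := searchTime_zero_le (cap := Real.sqrt (N + 1)) h2
    have h4 : Real.sqrt (N + 1) * (38 - 19 / Real.sqrt t) = 19 * (Real.sqrt (N + 1) / Real.sqrt t)
      + Real.sqrt (N + 1) * (38 - 38 / Real.sqrt t) := by ring
    linarith

omit [AddCommGroup A] [DecidableEq Q] [DecidableEq A] in
theorem rankBelow_le (val : K) : rankBelow x addr key val ≤ N + 1 := by
  have := Finset.card_le_univ (Finset.univ.filter fun k => key (addr k) (x (addr k)) < val)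
  rwa [Fintype.card_fin] at this

omit [AddCommGroup A] [DecidableEq Q] [DecidableEq A] in
-- A key below `val` has the same rank among the marked keys as among all keys, so the sum over the
-- marked addresses becomes a sum over ranks.
theorem sum_marked_le (val : K) :
    ∑ k ∈ Finset.univ.filter (fun k => key (addr k) (x (addr k)) < val),
        loopTime N 0 (rankBelow x addr key (key (addr k) (x (addr k))))
      ≤ ∑ i ∈ Finset.range (rankBelow x addr key val), descentTime (Real.sqrt (N + 1)) i := by
  refine (Finset.sum_le_sum fun k hk => ?_).trans
    (sum_rank_le (fun k => key (addr k) (x (addr k))) _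
      (descentTime_mono (Real.sqrt_nonneg ((N : ℝ) + 1))) _)
  refine (loopTime_zero_le (rankBelow_le x addr key _)).trans (le_of_eq ?_)
  congr 1
  rw [rankBelow, Finset.filter_filter]
  congr 1
  refine Finset.filter_congr fun l _ => ⟨fun h => ⟨h.trans (Finset.mem_filter.1 hk).2, h⟩,
    fun h => h.2⟩

omit [AddCommGroup A] [DecidableEq Q] [DecidableEq A] in
/-- One round of the main loop with `j` Grover iterations: the expected value of the time bound
after the round, when `s` is the success probability. -/
theorem sum_loopTime_le (val : K) (r : ℕ) {t : ℕ} (ht : rankBelow x addr key val = t)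
    (ht0 : t ≠ 0) {p q s : ℝ} (hp : 0 ≤ p) (hps : t * p = s)
    (hqs : (Finset.univ.filter fun k => ¬ key (addr k) (x (addr k)) < val).card * q = 1 - s) :
    ∑ k, (if key (addr k) (x (addr k)) < val then p else q) *
        (if key (addr k) (x (addr k)) < val then
          loopTime N 0 (rankBelow x addr key (key (addr k) (x (addr k))))
          else loopTime N (r + 1) t)
      ≤ Real.sqrt (N + 1) * (38 - 38 / Real.sqrt t) + (1 - s) *
        searchTime (Real.sqrt (N + 1) / Real.sqrt t) (Real.sqrt (N + 1)) (r + 1) := by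
  have h1 : ∀ k, (if key (addr k) (x (addr k)) < val then p else q) *
        (if key (addr k) (x (addr k)) < val then
          loopTime N 0 (rankBelow x addr key (key (addr k) (x (addr k))))
          else loopTime N (r + 1) t)
      = if key (addr k) (x (addr k)) < val then
          p * loopTime N 0 (rankBelow x addr key (key (addr k) (x (addr k))))
          else q * loopTime N (r + 1) t := fun k => by split <;> rfl
  rw [Finset.sum_congr rfl fun k _ => h1 k, Finset.sum_ite, ← Finset.mul_sum, Finset.sum_const,
    nsmul_eq_mul, ← mul_assoc, hqs]
  have h2 := sum_marked_le x addr key val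
  rw [ht] at h2
  replace h2 := h2.trans (sum_descentTime_le (Real.sqrt_nonneg ((N : ℝ) + 1)) ht0)
  have h3 := mul_le_mul_of_nonneg_left h2 hp
  have hst : 0 < Real.sqrt t := Real.sqrt_pos.2 (by exact_mod_cast Nat.pos_of_ne_zero ht0)
  have htt : Real.sqrt t * Real.sqrt t = t := Real.mul_self_sqrt (Nat.cast_nonneg t)
  have h4 : (t : ℝ) - Real.sqrt t = t * (1 - 1 / Real.sqrt t) := by
    field_simp
    linarith
  rw [h4, show p * (Real.sqrt (N + 1) * (38 * (t * (1 - 1 / Real.sqrt t))))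
    = (t * p) * (Real.sqrt (N + 1) * (38 - 38 / Real.sqrt t)) by ring, hps] at h3
  rw [loopTime, if_neg ht0]
  linarith

omit [DecidableEq Q] [DecidableEq A] in
theorem mul_wp_coin_le {α : Type} {M : ℕ} {k : Fin (M + 1) → Program Q A α} {f : α → ℝ≥0∞}
    {T : ℝ≥0∞} {g : ℕ → ℝ} (hg : ∀ j, 0 ≤ g j)
    (h : ∀ j, T * wp x 0 (k j) f ≤ ENNReal.ofReal (g j)) :
    T * wp x 0 (.coin M k) f
      ≤ ENNReal.ofReal ((M + 1 : ℝ)⁻¹ * ∑ j ∈ Finset.range (M + 1), g j) := by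
  have hM : ((M : ℝ≥0∞) + 1)⁻¹ = ENNReal.ofReal ((M + 1 : ℝ)⁻¹) := by
    rw [ENNReal.ofReal_inv_of_pos (by positivity), ENNReal.ofReal_add (by positivity)
      (by norm_num)]
    simp
  rw [wp, ← Finset.mul_sum, mul_left_comm, hM, ENNReal.ofReal_mul (by positivity), Finset.mul_sum,
    ENNReal.ofReal_sum_of_nonneg fun j _ => hg j, ← Fin.sum_univ_eq_sum_range
      (fun j => ENNReal.ofReal (g j))]
  exact mul_le_mul_right (Finset.sum_le_sum fun j _ => h j) _

/-- The substitute for Markov's inequality, one round at a time: split `T + 1 = (j + 1) + (T - j)`,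
bound the failure probability `w` by `1` against the time just spent, and use the inductive bound
against the time that remains. -/
theorem mul_sum_le_of_remaining {ι : Type*} [Fintype ι] {w : ι → ℝ≥0∞} {p c : ι → ℝ} {T j : ℕ}
    (hj : j ≤ T) (hp : ∀ k, 0 ≤ p k) (hp1 : ∑ k, p k = 1) (hc : ∀ k, 0 ≤ c k)
    (hw : ∀ k, w k ≤ 1) (hwc : ∀ k, ((T - j : ℕ) : ℝ≥0∞) * w k ≤ ENNReal.ofReal (c k)) :
    ((T + 1 : ℕ) : ℝ≥0∞) * ∑ k, ENNReal.ofReal (p k) * w k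
      ≤ ENNReal.ofReal (j + 1 + ∑ k, p k * c k) := by
  have h1 : ((T + 1 : ℕ) : ℝ≥0∞) = ((j + 1 : ℕ) : ℝ≥0∞) + ((T - j : ℕ) : ℝ≥0∞) := by
    norm_cast
    omega
  have h2 : ∀ k, ((T + 1 : ℕ) : ℝ≥0∞) * (ENNReal.ofReal (p k) * w k)
      ≤ ENNReal.ofReal (p k * (j + 1) + p k * c k) := by
    intro k
    rw [← mul_add, ENNReal.ofReal_mul (hp k), mul_left_comm]
    refine mul_le_mul_right ?_ _
    rw [h1, add_mul, ENNReal.ofReal_add (by positivity) (hc k)]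
    refine add_le_add ((mul_le_mul_right (hw k) _).trans (le_of_eq ?_)) (hwc k)
    rw [mul_one, ← ENNReal.ofReal_natCast]
    push_cast
    rfl
  rw [Finset.mul_sum]
  refine (Finset.sum_le_sum fun k _ => h2 k).trans ?_
  rw [← ENNReal.ofReal_sum_of_nonneg, Finset.sum_add_distrib, ← Finset.sum_mul, hp1, one_mul]
  intro k _
  have := hp k
  have := hc k
  positivity

/-- The contribution of a choice of `j` iterations in a round of the main loop. -/
theorem mul_wp_round_le {bad : K → ℝ≥0∞} (hbad : ∀ z, bad z ≤ 1) {T r j : ℕ} {val : K} {t : ℕ}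
    (ht : rankBelow x addr key val = t) (ht0 : t ≠ 0) {θ : ℝ} (hθ : (N + 1) * Real.sin θ ^ 2 = t)
    (ih : ∀ r' val', (∃ k, val' = key (addr k) (x (addr k))) ∨ val' = val →
      ((T - j : ℕ) : ℝ≥0∞) * wp x 0 (durrHoyerLoop addr key (T - j) r' val') bad
        ≤ ENNReal.ofReal (loopTime N r' (rankBelow x addr key val'))) :
    ((T + 1 : ℕ) : ℝ≥0∞) * wp x 0 (if j ≤ T then
        .quantum (grover addr (fun q a => decide (key q a < val)) j) fun b =>
          .ask b.1 fun a =>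
            if key b.1 a < val then durrHoyerLoop addr key (T - j) 0 (key b.1 a)
            else durrHoyerLoop addr key (T - j) (r + 1) val
        else .ret val) bad
      ≤ ENNReal.ofReal (j + 1 + (Real.sqrt (N + 1) * (38 - 38 / Real.sqrt t)
        + (1 - Real.sin ((2 * j + 1) * θ) ^ 2) *
          searchTime (Real.sqrt (N + 1) / Real.sqrt t) (Real.sqrt (N + 1)) (r + 1))) := by
  by_cases hj : j ≤ T
  · rw [if_pos hj]
    obtain ⟨p, q, hp, hq, hps, hqs, hF⟩ := tsum_measure_grover x addr
      (fun q a => decide (key q a < val)) θ (by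
        rw [hθ, ← ht, rankBelow]
        simp only [decide_eq_true_eq]) j
    simp only [decide_eq_true_eq] at hps hqs hF
    have h0 : ∀ (c : Circuit Q A) (k : BasisState Q A c.dim → Program Q A K),
        wp x 0 (.quantum c k) bad = ∑' b, c.measure x b * wp x 0 (k b) bad :=
      fun c k => by simp only [wp, zero_mul, zero_add]
    rw [h0]
    refine (mul_le_mul_right (hF fun b => wp x 0 (.ask b.1 fun a =>
      if key b.1 a < val then durrHoyerLoop addr key (T - j) 0 (key b.1 a)
      else durrHoyerLoop addr key (T - j) (r + 1) val) bad).le _).trans ?_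
    refine (mul_sum_le_of_remaining hj (c := fun k => if key (addr k) (x (addr k)) < val then
        loopTime N 0 (rankBelow x addr key (key (addr k) (x (addr k))))
        else loopTime N (r + 1) t) (fun k => ?_) ?_ (fun k => ?_)
        (fun k => wp_le_of_forall x (always_true x _) fun z _ => hbad z) fun k => ?_).trans ?_
    · split <;> assumption
    · rw [Finset.sum_ite, Finset.sum_const, Finset.sum_const, nsmul_eq_mul, nsmul_eq_mul,
        hps, hqs]
      ring
    · split <;> exact loopTime_nonneg _ _ _
    · simp only [wp, zero_add]
      split
      · exact ih 0 _ (Or.inl ⟨k, rfl⟩)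
      · rw [← ht]
        exact ih (r + 1) val (Or.inr rfl)
    · refine ENNReal.ofReal_le_ofReal (add_le_add_right ?_ _)
      refine sum_loopTime_le x addr key val r ht ht0 hp ?_ hqs
      rw [← ht]
      exact hps
  -- The round does not fit into the remaining time and the loop is interrupted. Failure may be
  -- certain, but then `T + 1 ≤ j + 1`, so the round's own time covers it.
  · rw [if_neg hj]
    have hTj : ((T + 1 : ℕ) : ℝ≥0∞) = ENNReal.ofReal (T + 1) := by
      rw [← ENNReal.ofReal_natCast]
      push_cast
      rfl
    refine (mul_le_mul_right (hbad val) _).trans ?_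
    rw [mul_one, hTj]
    refine ENNReal.ofReal_le_ofReal ?_
    have h1 : (T : ℝ) ≤ j := by exact_mod_cast (not_le.1 hj).le
    have h2 : 0 ≤ 1 - Real.sin ((2 * j + 1) * θ) ^ 2 := by
      linarith [Real.sin_sq_le_one ((2 * j + 1) * θ)]
    have h3 := mul_nonneg h2 (searchTime_nonneg (m := Real.sqrt (N + 1) / Real.sqrt t)
      (Real.sqrt_nonneg ((N : ℝ) + 1)) (r + 1))
    have h4 : 38 / Real.sqrt t ≤ 38 := div_le_self (by norm_num) (Real.one_le_sqrt.2
      (by exact_mod_cast Nat.one_le_iff_ne_zero.2 ht0))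
    have h5 := mul_nonneg (Real.sqrt_nonneg ((N : ℝ) + 1)) (sub_nonneg.2 h4)
    linarith

/-- Averaging over `j ≤ M` gives the time `M / 2 + 1` and the mean success probability, which is at
least `1 / 4` as soon as `M + 1 ≥ 1 / sin θ`. What remains is `searchTime_step`; `a` is the part of
the potential that the round leaves alone. -/
theorem average_round_le {b c θ : ℝ} {M r : ℕ} (hb : 1 ≤ b) (hc : 1 ≤ c)
    (hθ0 : 0 ≤ θ) (hθ1 : θ ≤ Real.pi / 2) (hθ : Real.sin θ = c / b)
    (hM : (M : ℝ) ≤ min ((6 / 5 : ℝ) ^ r) b) (hM' : min ((6 / 5 : ℝ) ^ r) b ≤ M + 1) (a : ℝ) :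
    (M + 1 : ℝ)⁻¹ * ∑ j ∈ Finset.range (M + 1), ((j : ℝ) + 1 +
        (a + (1 - Real.sin ((2 * j + 1) * θ) ^ 2) * searchTime (b / c) b (r + 1)))
      ≤ searchTime (b / c) b r + a := by
  have hMpos : (0 : ℝ) < M + 1 := by positivity
  have hg : ∑ j ∈ Finset.range (M + 1), (j : ℝ) = (M + 1) * (M / 2) := by
    have h1 := Finset.sum_range_id_mul_two (M + 1)
    have h2 : ((∑ j ∈ Finset.range (M + 1), j : ℕ) : ℝ) * 2 = (M + 1) * M := by
      exact_mod_cast h1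
    push_cast at h2
    linarith
  have hs0 : 0 ≤ ∑ j ∈ Finset.range (M + 1), Real.sin ((2 * j + 1) * θ) ^ 2 :=
    Finset.sum_nonneg fun j _ => sq_nonneg _
  have hq : b / c ≤ min ((6 / 5 : ℝ) ^ r) b →
      ((M + 1 : ℕ) : ℝ) / 4 ≤ ∑ j ∈ Finset.range (M + 1), Real.sin ((2 * j + 1) * θ) ^ 2 := by
    intro hm
    refine quarter_le_sum_sin_sq hθ0 hθ1 ?_
    rw [hθ, ← div_le_iff₀ (by positivity), one_div_div]
    push_cast
    exact hm.trans hM'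
  simp only [Finset.sum_add_distrib, sub_mul, Finset.sum_sub_distrib, ← Finset.sum_mul,
    Finset.sum_const, Finset.card_range, nsmul_eq_mul, hg]
  generalize ∑ j ∈ Finset.range (M + 1), Real.sin ((2 * j + 1) * θ) ^ 2 = s at hs0 hq ⊢
  have hstep := searchTime_step (m := b / c) (cap := b) (div_le_self (by linarith) hc) hb r
    (p := s / (M + 1)) (by positivity) (fun hm => by
      rw [le_div_iff₀ hMpos]
      have := hq hm
      push_cast at this
      linarith)
  generalize searchTime (b / c) b (r + 1) = B at hstep ⊢
  push_cast
  have hfin : (M + 1 : ℝ)⁻¹ * ((M + 1) * (M / 2) + (M + 1) * 1 + ((M + 1) * a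
      + ((M + 1) * 1 * B - s * B))) = M / 2 + 1 + (1 - s / (M + 1)) * B + a := by
    field_simp
    ring
  rw [hfin]
  linarith

open Classical in
/-- The main loop misses the minimum with a probability at most the expected time that it needs
divided by the available time. -/
theorem mul_wp_durrHoyerLoop_failure_le (T r : ℕ) (val : K)
    (hval : ∃ k, val = key (addr k) (x (addr k))) :
    T * wp x 0 (durrHoyerLoop addr key T r val)
        (fun z => if ∀ k, z ≤ key (addr k) (x (addr k)) then 0 else 1)
      ≤ ENNReal.ofReal (loopTime N r (rankBelow x addr key val)) := by
  induction T using Nat.strong_induction_on generalizing r val with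
  | _ T ih =>
    set bad : K → ℝ≥0∞ := fun z => if ∀ k, z ≤ key (addr k) (x (addr k)) then 0 else 1 with hbad
    have hbad1 : ∀ z, bad z ≤ 1 := fun z => by rw [hbad]; dsimp only; split <;> simp
    -- With nothing below the threshold the minimum is already attained, and the loop never raises
    -- the threshold.
    by_cases ht0 : rankBelow x addr key val = 0
    · have hmin : ∀ k, val ≤ key (addr k) (x (addr k)) := by
        intro k
        by_contra! h
        rw [rankBelow, Finset.card_eq_zero, Finset.filter_eq_empty_iff] at ht0
        exact ht0 (Finset.mem_univ k) h
      have h0 : wp x 0 (durrHoyerLoop addr key T r val) bad ≤ 0 :=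
        wp_le_of_forall x (always_durrHoyerLoop x addr key T r val) fun z hz => by
          rw [hbad]
          dsimp only
          rw [if_pos fun k => hz.1.trans (hmin k)]
      rw [le_zero_iff.1 h0, mul_zero]
      exact zero_le
    match T with
    | 0 => simp
    | T + 1 =>
      set t := rankBelow x addr key val with ht
      have htN : t ≤ N + 1 := rankBelow_le x addr key val
      have hNpos : (0 : ℝ) < N + 1 := by positivity
      have htpos : (0 : ℝ) < t := by exact_mod_cast Nat.pos_of_ne_zero ht0
      have htN' : (t : ℝ) ≤ N + 1 := by exact_mod_cast htN
      set sN := Real.sqrt ((N : ℝ) + 1) with hsN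
      set st := Real.sqrt t with hst
      have hsN1 : 1 ≤ sN := Real.one_le_sqrt.2 (by linarith [Nat.cast_nonneg (α := ℝ) N])
      have hst1 : 1 ≤ st := Real.one_le_sqrt.2 (by
        exact_mod_cast Nat.one_le_iff_ne_zero.2 ht0)
      have hstN : st ≤ sN := Real.sqrt_le_sqrt htN'
      set u := min ((6 / 5 : ℝ) ^ r) sN with hu
      have hu1 : 1 ≤ u := le_min (one_le_pow₀ (by norm_num)) hsN1
      -- Hence the natural subtraction `⌈u⌉₊ - 1` in the program does not truncate, and there are
      -- exactly `M + 1 = ⌈u⌉₊` choices of `j`.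
      have hceil : 1 ≤ ⌈u⌉₊ := Nat.one_le_ceil_iff.2 (by linarith)
      obtain ⟨M, hM⟩ : ∃ M, ⌈u⌉₊ = M + 1 := ⟨⌈u⌉₊ - 1, by omega⟩
      have hMu : (M : ℝ) ≤ u := by
        have := Nat.ceil_lt_add_one (a := u) (by linarith)
        rw [hM] at this
        push_cast at this
        linarith
      have huM : u ≤ M + 1 := by
        have := Nat.le_ceil u
        rw [hM] at this
        exact_mod_cast this
      set θ := Real.arcsin (st / sN) with hθdef
      have hsinθ : Real.sin θ = st / sN := by
        refine Real.sin_arcsin ?_ ((div_le_one (by linarith)).2 hstN)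
        have : 0 ≤ st / sN := by positivity
        linarith
      have hθ0 : 0 ≤ θ := Real.arcsin_nonneg.2 (by positivity)
      have hθ1 : θ ≤ Real.pi / 2 := Real.arcsin_le_pi_div_two _
      have hθ : (N + 1) * Real.sin θ ^ 2 = t := by
        rw [hsinθ, div_pow, hst, hsN, Real.sq_sqrt htpos.le, Real.sq_sqrt hNpos.le]
        field_simp
      set B := searchTime (sN / st) sN (r + 1) with hB
      set a := sN * (38 - 38 / st) with ha
      have ha0 : 0 ≤ a := mul_nonneg (by linarith)
        (by have : 38 / st ≤ 38 := div_le_self (by norm_num) hst1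
            linarith)
      have hB0 : 0 ≤ B := searchTime_nonneg (by linarith) _
      rw [durrHoyerLoop.eq_2, ← hsN, ← hu, hM, Nat.add_sub_cancel]
      refine (mul_wp_coin_le x (g := fun j => (j : ℝ) + 1 +
        (a + (1 - Real.sin ((2 * j + 1) * θ) ^ 2) * B)) (fun j => ?_) fun j => ?_).trans ?_
      · have hsle : 0 ≤ 1 - Real.sin ((2 * j + 1) * θ) ^ 2 := by
          linarith [Real.sin_sq_le_one ((2 * j + 1) * θ)]
        positivity
      · refine mul_wp_round_le x addr key hbad1 ht.symm ht0 hθ fun r' val' hval' => ?_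
        refine ih (T - (j : ℕ)) (by omega) r' val' ?_
        rcases hval' with h | h
        · exact h
        · rw [h]
          exact hval
      refine ENNReal.ofReal_le_ofReal ?_
      rw [loopTime, if_neg ht0]
      exact average_round_le hsN1 hst1 hθ0 hθ1 hsinθ hMu huM a

end DurrHoyer

/-! ### The minimum search as a whole -/

section DurrHoyerCorrectness

variable {Q A : Type} [AddCommGroup A] [DecidableEq Q] [DecidableEq A] {K : Type} [LinearOrder K]
  [OrderTop K] (x : Q → A) (key : Q → A → K)

/-- The least key of the addresses (`⊤` if there are none). -/
def leastKey {N : ℕ} (addr : Fin N ↪ Q) : K := Finset.univ.inf fun k => key (addr k) (x (addr k))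

theorem always_durrHoyer {N : ℕ} (addr : Fin N ↪ Q) :
    (durrHoyer addr key).Always x fun z =>
      leastKey x key addr ≤ z ∧ (z = ⊤ ∨ ∃ k, z = key (addr k) (x (addr k))) := by
  match N with
  | 0 => exact ⟨le_top, Or.inl rfl⟩
  | N + 1 =>
    intro i
    refine (always_durrHoyerLoop x addr key _ 0 (key (addr i) (x (addr i)))).mono x fun z hz => ?_
    have hex : ∃ k, z = key (addr k) (x (addr k)) := hz.2.elim (fun h => ⟨i, h⟩) id
    refine ⟨?_, Or.inr hex⟩
    obtain ⟨k, rfl⟩ := hex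
    exact Finset.inf_le (Finset.mem_univ k)

theorem wp_durrHoyer_le {N : ℕ} (addr : Fin N ↪ Q) :
    wp x 1 (durrHoyer addr key) (fun _ => 0) ≤ ENNReal.ofReal (1201 * Real.sqrt N) := by
  match N with
  | 0 => simp [durrHoyer]
  | N + 1 =>
    refine (Finset.sum_le_sum fun i _ => mul_le_mul_right
      (add_le_add_right (wp_durrHoyerLoop_le x addr key _ 0 _) 1) _).trans ?_
    rw [sum_coin_const]
    -- The count is `1 + 2 * 300 * (⌊√d⌋ + 1)` for `d` addresses; as `√d ≥ 1`, the constant `601` is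
    -- absorbed and `1201 √d` results.
    have h1 : (1 : ℝ) ≤ Real.sqrt ((N + 1 : ℕ) : ℝ) := Real.one_le_sqrt.2 (by
      push_cast
      linarith [Nat.cast_nonneg (α := ℝ) N])
    have h2 : ((Nat.sqrt (N + 1) : ℕ) : ℝ) ≤ Real.sqrt ((N + 1 : ℕ) : ℝ) := Real.nat_sqrt_le_real_sqrt
    have h3 : (1 : ℝ≥0∞) + 2 * ((300 * (Nat.sqrt (N + 1) + 1) : ℕ) : ℝ≥0∞)
        = ENNReal.ofReal (((1 + 2 * (300 * (Nat.sqrt (N + 1) + 1)) : ℕ) : ℝ)) := by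
      rw [ENNReal.ofReal_natCast]
      push_cast
      ring
    rw [h3]
    refine ENNReal.ofReal_le_ofReal ?_
    push_cast at h1 h2 ⊢
    linarith

open Classical in
/-- The minimum search fails with probability at most `1 / 2`. -/
theorem wp_durrHoyer_failure_le {N : ℕ} (addr : Fin N ↪ Q) :
    wp x 0 (durrHoyer addr key) (fun z => if z = leastKey x key addr then 0 else 1) ≤ 2⁻¹ := by
  match N with
  | 0 =>
    change (if (⊤ : K) = leastKey x key addr then (0 : ℝ≥0∞) else 1) ≤ 2⁻¹
    rw [if_pos]
    · simp
    · rw [leastKey, Finset.univ_eq_empty, Finset.inf_empty]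
  | N + 1 =>
    refine (Finset.sum_le_sum fun i _ => mul_le_mul_right (?_ : _ ≤ (2⁻¹ : ℝ≥0∞)) _).trans
      (sum_coin_const _ _).le
    change 0 + wp x 0 (durrHoyerLoop addr key _ 0 (key (addr i) (x (addr i)))) _ ≤ _
    rw [zero_add]
    set T := 300 * (Nat.sqrt (N + 1) + 1) with hT
    have hT0 : (T : ℝ≥0∞) ≠ 0 := by
      rw [hT]
      exact Nat.cast_ne_zero.2 (by positivity)
    have h1 := mul_wp_durrHoyerLoop_failure_le x addr key T 0 (key (addr i) (x (addr i))) ⟨i, rfl⟩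
    have h2 : wp x 0 (durrHoyerLoop addr key T 0 (key (addr i) (x (addr i))))
        (fun z => if z = leastKey x key addr then 0 else 1)
        ≤ wp x 0 (durrHoyerLoop addr key T 0 (key (addr i) (x (addr i))))
          (fun z => if ∀ k, z ≤ key (addr k) (x (addr k)) then 0 else 1) := by
      refine wp_mono_of_always x (always_durrHoyerLoop x addr key T 0 _) fun z hz => ?_
      by_cases hk : ∀ k, z ≤ key (addr k) (x (addr k))
      · rw [if_pos hk, if_pos]
        refine le_antisymm (Finset.le_inf fun k _ => hk k) ?_
        obtain ⟨k, rfl⟩ : ∃ k, z = key (addr k) (x (addr k)) := hz.2.elim (fun h => ⟨i, h⟩) id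
        exact Finset.inf_le (Finset.mem_univ k)
      · rw [if_neg hk]
        split <;> simp
    refine h2.trans ?_
    rw [mul_comm, ← ENNReal.le_div_iff_mul_le (Or.inl hT0) (Or.inl (by simp))] at h1
    refine h1.trans (ENNReal.div_le_of_le_mul ?_)
    have h3 : (2⁻¹ : ℝ≥0∞) * T = ENNReal.ofReal (2⁻¹ * T) := by
      rw [ENNReal.ofReal_mul (by norm_num), ENNReal.ofReal_natCast,
        ENNReal.ofReal_inv_of_pos (by norm_num)]
      simp
    rw [h3]
    refine ENNReal.ofReal_le_ofReal ?_
    -- Whatever the initial threshold, the potential is at most `38 √(N + 1)`, well below half of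
    -- the available time.
    have h4 := (loopTime_zero_le (rankBelow_le x addr key (key (addr i) (x (addr i))))).trans
      (descentTime_le (Real.sqrt_nonneg ((N : ℝ) + 1)) _)
    have h5 : Real.sqrt ((N : ℝ) + 1) ≤ Nat.sqrt (N + 1) + 1 := by
      have := Real.real_sqrt_le_nat_sqrt_succ (a := N + 1)
      push_cast at this
      exact this
    rw [hT]
    push_cast
    linarith [Nat.cast_nonneg (α := ℝ) (Nat.sqrt (N + 1))]

end DurrHoyerCorrectness

/-! ### Searches with doubling windows -/

section Doubling

variable {Q A : Type} [AddCommGroup A] (x : Q → A) (S : ℕ → Program Q A (WithTop ℕ))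

/-- Run the programs of a list until the first result that is not `⊤`. -/
def firstSuccess (l : List ℕ) (z : WithTop ℕ) : Program Q A (WithTop ℕ) :=
  l.foldlM (fun z r => if z = ⊤ then S r else pure z) z

theorem wp_firstSuccess_cons (κ : ℝ≥0∞) (r : ℕ) (l : List ℕ) (f : WithTop ℕ → ℝ≥0∞) :
    wp x κ (firstSuccess S (r :: l) ⊤) f = wp x κ (S r) fun z => wp x κ (firstSuccess S l z) f := by
  rw [firstSuccess, List.foldlM_cons, if_pos rfl, wp_bind]
  rfl

theorem wp_firstSuccess_of_ne_top (κ : ℝ≥0∞) (l : List ℕ) {z : WithTop ℕ} (hz : z ≠ ⊤)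
    (f : WithTop ℕ → ℝ≥0∞) : wp x κ (firstSuccess S l z) f = f z := by
  induction l with
  | nil => rfl
  | cons r l ih =>
    rw [firstSuccess, List.foldlM_cons, if_neg hz, wp_bind, wp_pure]
    exact ih

theorem always_firstSuccess {T : WithTop ℕ → Prop} (l : List ℕ)
    (hS : ∀ r ∈ l, (S r).Always x T) {z : WithTop ℕ} (hz : T z) :
    (firstSuccess S l z).Always x T := by
  induction l generalizing z with
  | nil => exact hz
  | cons r l ih =>
    rw [firstSuccess, List.foldlM_cons]
    refine always_bind x (S := T) ?_ fun a ha => ih (fun r hr => hS r (List.mem_cons_of_mem _ hr)) ha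
    split
    · exact hS r List.mem_cons_self
    · exact hz

open Classical in
/-- If program `r₀` returns `M` with probability at least `1 / 2`, and the earlier ones return
`⊤`, then `M` is found with probability at least `1 / 2`. -/
theorem wp_firstSuccess_failure_le {M : WithTop ℕ} (hM : M ≠ ⊤) {r₀ : ℕ}
    (h0 : ∀ r < r₀, (S r).Always x fun z => z = ⊤)
    (h1 : wp x 0 (S r₀) (fun z => if z = M then 0 else 1) ≤ 2⁻¹) (len r : ℕ) (hr : r ≤ r₀)
    (hlen : r₀ < r + len) :
    wp x 0 (firstSuccess S (List.range' r len) ⊤) (fun z => if z = M then 0 else 1) ≤ 2⁻¹ := by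
  induction len generalizing r with
  | zero => omega
  | succ len ih =>
    rw [List.range'_succ, wp_firstSuccess_cons]
    rcases hr.eq_or_lt with rfl | hr
    · refine (wp_mono x _ fun z => ?_).trans h1
      by_cases hz : z = M
      · rw [if_pos hz, wp_firstSuccess_of_ne_top x S 0 _ (hz ▸ hM), if_pos hz]
      · rw [if_neg hz]
        refine wp_le_of_forall x (always_true x _) fun a _ => ?_
        split <;> simp
    · refine wp_le_of_forall x (h0 r hr) fun z hz => ?_
      rw [hz]
      exact ih (r + 1) hr (by omega)

/-- The expected number of queries when the costs grow geometrically and the search ends with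
probability at least `1 / 2` in each round from `r₀` on. -/
theorem wp_firstSuccess_le {c : ℝ} (hc : 0 ≤ c) {R r₀ : ℕ}
    (hcost : ∀ r, wp x 1 (S r) (fun _ => 0) ≤ ENNReal.ofReal (c * Real.sqrt 2 ^ r))
    (hhalf : ∀ r, r₀ ≤ r → r < R → wp x 0 (S r) (fun z => if z = ⊤ then 1 else 0) ≤ 2⁻¹)
    (len r : ℕ) (hlen : r + len ≤ R) :
    wp x 1 (firstSuccess S (List.range' r len) ⊤) (fun _ => 0) ≤ ENNReal.ofReal
      (c * if r < r₀ then 8 * Real.sqrt 2 ^ r₀ - 3 * Real.sqrt 2 ^ r else 4 * Real.sqrt 2 ^ r) := by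
  -- The bounds for `√2` that make the potential pay for each round. From `r₀` on, the next round
  -- happens with probability at most `1 / 2`, and `1 + 2 √2 ≤ 4` uses the upper bound. Before `r₀`
  -- every round may happen, and `4 ≤ 3 √2` uses the lower bound; the coefficient `8` covers the
  -- transition to the second regime.
  have hlo : (7 / 5 : ℝ) ≤ Real.sqrt 2 := Real.le_sqrt_of_sq_le (by norm_num)
  have hhi : Real.sqrt 2 ≤ 3 / 2 := Real.sqrt_le_iff.2 (by norm_num)
  induction len generalizing r with
  | zero => exact zero_le
  | succ len ih =>
    rw [List.range'_succ, wp_firstSuccess_cons, wp_eq_add]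
    have hpos : 0 < Real.sqrt 2 ^ r := by positivity
    set V := c * if r + 1 < r₀ then 8 * Real.sqrt 2 ^ r₀ - 3 * Real.sqrt 2 ^ (r + 1)
      else 4 * Real.sqrt 2 ^ (r + 1) with hV
    have hstep : ∀ z, wp x 1 (firstSuccess S (List.range' (r + 1) len) z) (fun _ => 0)
        ≤ (if z = ⊤ then 1 else 0) * ENNReal.ofReal V := by
      intro z
      by_cases hz : z = ⊤
      · rw [hz, if_pos rfl, one_mul]
        exact ih (r + 1) (by omega)
      · rw [wp_firstSuccess_of_ne_top x S 1 _ hz]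
        exact zero_le
    refine (add_le_add (hcost r) (wp_mono x _ hstep)).trans ?_
    rw [wp_mul_const]
    by_cases hr : r < r₀
    · have h1 : wp x 0 (S r) (fun z => if z = ⊤ then 1 else 0) ≤ 1 :=
        wp_le_of_forall x (always_true x _) fun z _ => by split <;> simp
      have hle : Real.sqrt 2 ^ (r + 1) ≤ Real.sqrt 2 ^ r₀ := pow_le_pow_right₀ (by linarith) hr
      have hV0 : 0 ≤ V := by
        rw [hV]
        split
        · refine mul_nonneg hc ?_
          have := pow_pos (show (0 : ℝ) < Real.sqrt 2 by linarith) r₀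
          linarith
        · positivity
      refine (add_le_add_right (mul_le_mul_left h1 _) _).trans ?_
      rw [one_mul, ← ENNReal.ofReal_add (by positivity) hV0]
      refine ENNReal.ofReal_le_ofReal ?_
      rw [if_pos hr, hV, ← mul_add]
      refine mul_le_mul_of_nonneg_left ?_ hc
      rw [pow_succ] at hle ⊢
      split
      · nlinarith
      · have h4 : r₀ = r + 1 := by omega
        rw [h4, pow_succ]
        nlinarith
    · refine (add_le_add_right (mul_le_mul_left (hhalf r (by omega) (by omega)) _) _).trans ?_
      have h2 : (2⁻¹ : ℝ≥0∞) * ENNReal.ofReal V = ENNReal.ofReal (2⁻¹ * V) := by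
        rw [ENNReal.ofReal_mul (show (0 : ℝ) ≤ 2⁻¹ by norm_num),
          ENNReal.ofReal_inv_of_pos two_pos]
        simp
      have hV' : V = c * (4 * Real.sqrt 2 ^ (r + 1)) := by rw [hV, if_neg (by omega)]
      rw [h2, hV', ← ENNReal.ofReal_add (by positivity) (by positivity)]
      refine ENNReal.ofReal_le_ofReal ?_
      rw [if_neg hr, pow_succ, mul_left_comm, ← mul_add]
      refine mul_le_mul_of_nonneg_left ?_ hc
      nlinarith

end Doubling

/-! ### The first-one search -/

section FirstOne

variable {n : ℕ} [NeZero n] {G : WeightedDAG n} (L : AdjacencyLists G) (visited : Fin n → Bool)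
  (i : Fin n)

/-- Position `p` of the list of out-neighbours of `i` holds an unvisited vertex which is not a
sink. -/
def IsCandidate (p : ℕ) : Prop :=
  ∃ u, (L.outList i)[p]? = some u ∧ visited u = false ∧ 0 < L.outDeg u

omit [NeZero n] in
theorem IsCandidate.lt {L : AdjacencyLists G} {visited : Fin n → Bool} {i : Fin n} {p : ℕ}
    (h : IsCandidate L visited i p) : p < L.outDeg i := by
  obtain ⟨u, hu, -⟩ := h
  exact (List.getElem?_eq_some_iff.1 hu).1

open Classical in
/-- The key of position `p` in the first-one search. -/
def candidateKey (p : ℕ) : WithTop ℕ := if IsCandidate L visited i p then p else ⊤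

variable {L visited i} in
omit [NeZero n] in
theorem candidateKey_of_isCandidate {p : ℕ} (h : IsCandidate L visited i p) :
    candidateKey L visited i p = p := if_pos h

variable {L visited i} in
omit [NeZero n] in
theorem candidateKey_of_not {p : ℕ} (h : ¬ IsCandidate L visited i p) :
    candidateKey L visited i p = ⊤ := if_neg h

/-- The first candidate position from `start` on. -/
def nextCandidate (start : ℕ) : WithTop ℕ :=
  (Finset.Ico start (L.outDeg i)).inf (candidateKey L visited i)

omit [NeZero n] in
theorem nextCandidate_le {start p : ℕ} (h : IsCandidate L visited i p) (hp : start ≤ p) :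
    nextCandidate L visited i start ≤ p := by
  refine (Finset.inf_le (Finset.mem_Ico.2 ⟨hp, h.lt⟩)).trans ?_
  rw [candidateKey_of_isCandidate h]

omit [NeZero n] in
theorem not_isCandidate_of_lt {start p : ℕ} (hp : start ≤ p)
    (h : (p : WithTop ℕ) < nextCandidate L visited i start) : ¬ IsCandidate L visited i p :=
  fun hc => (nextCandidate_le L visited i hc hp).not_gt h

omit [NeZero n] in
theorem nextCandidate_eq_top_or (start : ℕ) : nextCandidate L visited i start = ⊤ ∨
    ∃ p : ℕ, nextCandidate L visited i start = (p : WithTop ℕ) ∧ start ≤ p ∧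
      IsCandidate L visited i p := by
  rcases (Finset.Ico start (L.outDeg i)).eq_empty_or_nonempty with h | h
  · left
    rw [nextCandidate, h, Finset.inf_empty]
  · obtain ⟨p, hp, hpe⟩ := Finset.exists_mem_eq_inf _ h (candidateKey L visited i)
    rw [nextCandidate, hpe]
    by_cases hc : IsCandidate L visited i p
    · exact Or.inr ⟨p, candidateKey_of_isCandidate hc, (Finset.mem_Ico.1 hp).1, hc⟩
    · exact Or.inl (candidateKey_of_not hc)

/-- The key that is used by the first-one search. -/
def searchKey (q : Address n) (a : Answer n) : WithTop ℕ :=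
  if visited a.1 = false ∧ 0 < L.outDeg a.1 then (q.pos : WithTop ℕ) else ⊤

/-- Only inside the list does the oracle return a real neighbour; behind the end it answers `0`,
which could look like a candidate. This is why the windows are cut off at the degree. -/
theorem searchKey_eq {p : ℕ} (hp : p < L.outDeg i) :
    searchKey L visited ⟨false, i, p⟩ (L.oracle ⟨false, i, p⟩) = candidateKey L visited i p := by
  have hget : (L.outList i)[p]? = some ((L.outList i)[p]'hp) := List.getElem?_eq_getElem hp
  have ho : (L.oracle ⟨false, i, p⟩).1 = (L.outList i)[p]'hp := by
    simp [AdjacencyLists.oracle, hget]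
  have hiff : IsCandidate L visited i p ↔
      visited (L.outList i)[p] = false ∧ 0 < L.outDeg (L.outList i)[p] := by
    rw [IsCandidate, hget]
    simp
  rw [searchKey, ho]
  split
  · rw [candidateKey_of_isCandidate (hiff.2 ‹_›)]
  · rw [candidateKey_of_not fun h => absurd (hiff.1 h) ‹_›]

theorem leastKey_window {start N : ℕ} (hN : start + N ≤ L.outDeg i) :
    leastKey L.oracle (searchKey L visited) (window false i start N)
      = (Finset.Ico start (start + N)).inf (candidateKey L visited i) := by
  refine le_antisymm (Finset.le_inf fun p hp => ?_) (Finset.le_inf fun k _ => ?_)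
  · rw [Finset.mem_Ico] at hp
    have h : window false i start N ⟨p - start, by omega⟩ = ⟨false, i, p⟩ := by
      change Address.mk false i (start + (p - start)) = _
      rw [Nat.add_sub_cancel' hp.1]
    rw [← searchKey_eq L visited i (by omega), ← h]
    exact Finset.inf_le (Finset.mem_univ _)
  · have hk := k.isLt
    change _ ≤ searchKey L visited ⟨false, i, start + k⟩ (L.oracle ⟨false, i, start + k⟩)
    rw [searchKey_eq L visited i (by omega)]
    exact Finset.inf_le (Finset.mem_Ico.2 ⟨by omega, by omega⟩)

/-- The result of a first-one search is `⊤` or a candidate position. -/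
def IsCandidateOrTop (start : ℕ) (z : WithTop ℕ) : Prop :=
  z = ⊤ ∨ ∃ p : ℕ, z = (p : WithTop ℕ) ∧ start ≤ p ∧ IsCandidate L visited i p

omit [NeZero n] in
theorem IsCandidateOrTop.nextCandidate_le {start : ℕ} {z : WithTop ℕ}
    (h : IsCandidateOrTop L visited i start z) : nextCandidate L visited i start ≤ z := by
  rcases h with rfl | ⟨p, rfl, hp, hc⟩
  · exact le_top
  · exact QuantumShortestPath.nextCandidate_le L visited i hc hp

/-- The minimum search of round `r` of the first-one search. -/
def windowSearch (start r : ℕ) : GraphProgram n (WithTop ℕ) :=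
  durrHoyer (window false i start (min (2 ^ r) (L.outDeg i - start))) (searchKey L visited)

theorem firstOneSearchOnce_eq (start : ℕ) : firstOneSearchOnce L.outDeg visited i start
    = firstSuccess (windowSearch L visited i start)
      (List.range' 0 (Nat.clog 2 (L.outDeg i - start) + 1)) ⊤ := by
  rw [← List.range_eq_range']
  rfl

theorem always_windowSearch (start r : ℕ) (hs : start ≤ L.outDeg i) :
    (windowSearch L visited i start r).Always L.oracle fun z =>
      (Finset.Ico start (start + min (2 ^ r) (L.outDeg i - start))).inf (candidateKey L visited i)
        ≤ z ∧ IsCandidateOrTop L visited i start z := by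
  refine (always_durrHoyer L.oracle (searchKey L visited) _).mono L.oracle fun z hz => ?_
  rw [leastKey_window L visited i (by omega)] at hz
  refine ⟨hz.1, hz.2.imp_right ?_ |>.elim Or.inl id⟩
  rintro ⟨k, rfl⟩
  have hk := k.isLt
  change IsCandidateOrTop L visited i start
    (searchKey L visited ⟨false, i, start + k⟩ (L.oracle ⟨false, i, start + k⟩))
  rw [searchKey_eq L visited i (by omega)]
  by_cases hc : IsCandidate L visited i (start + k)
  · exact Or.inr ⟨_, candidateKey_of_isCandidate hc, by omega, hc⟩
  · exact Or.inl (candidateKey_of_not hc)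

theorem always_firstOneSearchOnce (start : ℕ) (hs : start ≤ L.outDeg i) :
    (firstOneSearchOnce L.outDeg visited i start).Always L.oracle
      (IsCandidateOrTop L visited i start) := by
  rw [firstOneSearchOnce_eq]
  exact always_firstSuccess _ _ _
    (fun r _ => (always_windowSearch L visited i start r hs).mono _ fun z hz => hz.2) (Or.inl rfl)

omit [NeZero n] in
theorem window_inf_eq_top {start r p : ℕ} (hp : nextCandidate L visited i start = (p : WithTop ℕ))
    (hr : start + 2 ^ r ≤ p) :
    (Finset.Ico start (start + min (2 ^ r) (L.outDeg i - start))).inf (candidateKey L visited i)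
      = ⊤ := by
  refine top_le_iff.1 (Finset.le_inf fun q hq => ?_)
  rw [Finset.mem_Ico] at hq
  rw [candidateKey_of_not]
  refine not_isCandidate_of_lt L visited i hq.1 ?_
  rw [hp]
  have : q < p := by omega
  exact_mod_cast this

omit [NeZero n] in
theorem window_inf_eq {start r p : ℕ} (hp : nextCandidate L visited i start = (p : WithTop ℕ))
    (hsp : start ≤ p) (hpd : p < L.outDeg i) (hr : p < start + 2 ^ r) :
    (Finset.Ico start (start + min (2 ^ r) (L.outDeg i - start))).inf (candidateKey L visited i)
      = p := by
  refine le_antisymm ?_ ?_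
  · refine (Finset.inf_le (Finset.mem_Ico.2 ⟨hsp, by omega⟩)).trans (le_of_eq (candidateKey_of_isCandidate ?_))
    rcases nextCandidate_eq_top_or L visited i start with h | ⟨p', h, -, h'⟩
    · rw [h] at hp
      exact absurd hp (WithTop.top_ne_coe)
    · rw [h] at hp
      obtain rfl : p' = p := by exact_mod_cast hp
      exact h'
  · rw [← hp]
    exact Finset.inf_mono (Finset.Ico_subset_Ico_right (by omega))

open Classical in
theorem wp_windowSearch_failure_le {start r p : ℕ} (hs : start ≤ L.outDeg i)
    (hp : nextCandidate L visited i start = (p : WithTop ℕ))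
    (hsp : start ≤ p) (hpd : p < L.outDeg i) (hr : p < start + 2 ^ r) :
    wp L.oracle 0 (windowSearch L visited i start r)
      (fun z => if z = (p : WithTop ℕ) then 0 else 1) ≤ 2⁻¹ := by
  have h := wp_durrHoyer_failure_le L.oracle (searchKey L visited)
    (window false i start (min (2 ^ r) (L.outDeg i - start)))
  rwa [leastKey_window L visited i (by omega), window_inf_eq L visited i hp hsp hpd hr] at h

open Classical in
-- Windows that end before the first candidate contain only keys `⊤` and surely return `⊤`. The
-- first window that reaches the candidate has it as its minimum and finds it with probability at
-- least `1 / 2`. If there is no candidate, the search cannot err.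
theorem wp_firstOneSearchOnce_failure_le (start : ℕ) (hs : start ≤ L.outDeg i) :
    wp L.oracle 0 (firstOneSearchOnce L.outDeg visited i start)
      (fun z => if z = nextCandidate L visited i start then 0 else 1) ≤ 2⁻¹ := by
  rcases nextCandidate_eq_top_or L visited i start with h | ⟨p, h, hsp, hc⟩
  · refine wp_le_of_forall _ (always_firstOneSearchOnce L visited i start hs) fun z hz => ?_
    have := hz.nextCandidate_le
    rw [h, top_le_iff] at this
    rw [h, if_pos this]
    exact zero_le
  · have hpd := hc.lt
    rw [h, firstOneSearchOnce_eq]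
    have hle : p - start + 1 ≤ 2 ^ Nat.clog 2 (p - start + 1) := Nat.le_pow_clog (by norm_num) _
    refine wp_firstSuccess_failure_le _ _ WithTop.coe_ne_top
      (r₀ := Nat.clog 2 (p - start + 1)) (fun r hr => ?_) ?_ _ 0 (Nat.zero_le _) ?_
    · refine (always_windowSearch L visited i start r hs).mono _ fun z hz => ?_
      have := Nat.pow_lt_of_lt_clog hr
      rw [window_inf_eq_top L visited i h (by omega)] at hz
      exact top_le_iff.1 hz.1
    · exact wp_windowSearch_failure_le L visited i hs h hsp hpd (by omega)
    -- The round of the decisive window is among those that the program runs.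
    · have := Nat.clog_mono_right 2 (show p - start + 1 ≤ L.outDeg i - start by omega)
      omega

/-- The number of positions that the first-one search has to look at. -/
def searchLength (start : ℕ) : ℕ :=
  match nextCandidate L visited i start with
  | none => L.outDeg i - start
  | some p => p - start + 1

theorem sqrt_two_pow (r : ℕ) : Real.sqrt 2 ^ r = Real.sqrt (2 ^ r) := by
  rw [← Real.sqrt_sq (show 0 ≤ Real.sqrt 2 ^ r by positivity), ← pow_mul, mul_comm r, pow_mul,
    Real.sq_sqrt (by norm_num)]

theorem sqrt_two_pow_le {r m : ℕ} (h : 2 ^ r ≤ 4 * m) :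
    Real.sqrt 2 ^ r ≤ 2 * Real.sqrt m := by
  have h2 : (2 : ℝ) * Real.sqrt m = Real.sqrt (4 * m) := by
    rw [Real.sqrt_mul (by norm_num), show (4 : ℝ) = 2 ^ 2 by norm_num,
      Real.sqrt_sq (by norm_num)]
  rw [sqrt_two_pow, h2]
  exact Real.sqrt_le_sqrt (by exact_mod_cast h)

/-- The cost is governed by the distance to the first candidate, not by the rest of the list: every
window from the decisive one on stops the search with probability at least `1 / 2`, while the costs
grow only by the factor `√2`. The amortization over a whole list depends on this. -/
theorem wp_firstOneSearchOnce_le (start : ℕ) (hs : start ≤ L.outDeg i) :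
    wp L.oracle 1 (firstOneSearchOnce L.outDeg visited i start) (fun _ => 0)
      ≤ ENNReal.ofReal (20000 * Real.sqrt (searchLength L visited i start)) := by
  have hcost : ∀ r, wp L.oracle 1 (windowSearch L visited i start r) (fun _ => 0)
      ≤ ENNReal.ofReal (1201 * Real.sqrt (min (2 ^ r) (L.outDeg i - start) : ℕ)) :=
    fun r => wp_durrHoyer_le _ _ _
  have hcost' : ∀ r, wp L.oracle 1 (windowSearch L visited i start r) (fun _ => 0)
      ≤ ENNReal.ofReal (1201 * Real.sqrt 2 ^ r) := by
    intro r
    refine (hcost r).trans (ENNReal.ofReal_le_ofReal ?_)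
    rw [sqrt_two_pow]
    gcongr
    exact_mod_cast min_le_left _ _
  rw [firstOneSearchOnce_eq]
  have hclog : ∀ m : ℕ, 1 ≤ m → 2 ^ Nat.clog 2 m ≤ 2 * m := by
    intro m hm
    rcases hm.eq_or_lt with rfl | hm
    · simp
    · have h1 := Nat.pow_pred_clog_lt_self (b := 2) (by norm_num) hm
      have h2 := Nat.clog_pos (b := 2) (by norm_num) hm
      obtain ⟨c, hc⟩ : ∃ c, Nat.clog 2 m = c + 1 := ⟨Nat.clog 2 m - 1, by omega⟩
      rw [hc] at h1 ⊢
      simp only [Nat.pred_succ] at h1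
      rw [pow_succ]
      omega
  -- The constant: `1201 * 8 * 2 ≤ 20000`, where the `2` comes from `√2 ^ r₀ ≤ 2 √m`.
  have hfin : ∀ {r₀ m : ℕ}, 2 ^ r₀ ≤ 4 * m →
      (1201 * if 0 < r₀ then 8 * Real.sqrt 2 ^ r₀ - 3 * Real.sqrt 2 ^ 0 else 4 * Real.sqrt 2 ^ 0)
        ≤ 20000 * Real.sqrt m := by
    intro r₀ m h
    have h1 := sqrt_two_pow_le h
    split
    · rw [pow_zero]
      linarith [Real.sqrt_nonneg (m : ℝ)]
    · have h0 : r₀ = 0 := by omega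
      rw [h0] at h1
      rw [pow_zero] at *
      linarith [Real.sqrt_nonneg (m : ℝ)]
  rcases nextCandidate_eq_top_or L visited i start with h | ⟨p, h, hsp, hc⟩
  · have hlen : searchLength L visited i start = L.outDeg i - start := by
      rw [searchLength, h]
    rw [hlen]
    rcases Nat.eq_zero_or_pos (L.outDeg i - start) with h0 | hpos
    · have := wp_firstSuccess_le L.oracle (windowSearch L visited i start) (c := 0) le_rfl
        (R := 1) (r₀ := 1) (fun r => (hcost r).trans (by simp [h0]))
        (fun r h1 h2 => by omega) 1 0 le_rfl
      rw [h0]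
      simpa using this
    -- Without a candidate no round succeeds. Choosing `r₀` behind the last round makes the
    -- condition on success vacuous.
    · refine (wp_firstSuccess_le L.oracle (windowSearch L visited i start) (by norm_num)
        (r₀ := Nat.clog 2 (L.outDeg i - start) + 1) hcost' (fun r h1 h2 => by omega) _ 0
        (zero_add _).le).trans (ENNReal.ofReal_le_ofReal (hfin ?_))
      have := hclog _ hpos
      rw [pow_succ]
      omega
  · have hlen : searchLength L visited i start = p - start + 1 := by
      rw [searchLength, h]
      rfl
    have hpd := hc.lt
    rw [hlen]
    have hle : p - start + 1 ≤ 2 ^ Nat.clog 2 (p - start + 1) := Nat.le_pow_clog (by norm_num) _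
    refine (wp_firstSuccess_le L.oracle (windowSearch L visited i start) (by norm_num)
        (r₀ := Nat.clog 2 (p - start + 1)) hcost' (fun r h1 h2 => ?_) _ 0
        (zero_add _).le).trans (ENNReal.ofReal_le_ofReal (hfin ?_))
    · have hr : 2 ^ Nat.clog 2 (p - start + 1) ≤ 2 ^ r := Nat.pow_le_pow_right (by norm_num) h1
      refine (wp_mono _ _ fun z => ?_).trans
        (wp_windowSearch_failure_le L visited i hs h hsp hpd (r := r) (by omega))
      by_cases hz : z = ⊤
      · rw [if_pos hz, if_neg]
        rw [hz]
        exact WithTop.top_ne_coe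
      · rw [if_neg hz]
        exact zero_le
    · have := hclog (p - start + 1) (by omega)
      omega

theorem always_firstOneSearch (start : ℕ) (hs : start ≤ L.outDeg i) :
    (firstOneSearch L.outDeg visited i start).Always L.oracle
      (IsCandidateOrTop L visited i start) :=
  always_repeatMin _ (always_firstOneSearchOnce L visited i start hs) (Or.inl rfl) _

theorem wp_firstOneSearch_le (start : ℕ) (hs : start ≤ L.outDeg i) :
    wp L.oracle 1 (firstOneSearch L.outDeg visited i start) (fun _ => 0)
      ≤ repetitions n * ENNReal.ofReal (20000 * Real.sqrt (searchLength L visited i start)) := by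
  rw [firstOneSearch, wp_repeatMin_zero]
  exact mul_le_mul_right (wp_firstOneSearchOnce_le L visited i start hs) _

open Classical in
theorem wp_firstOneSearch_failure_le (start : ℕ) (hs : start ≤ L.outDeg i) :
    wp L.oracle 0 (firstOneSearch L.outDeg visited i start)
      (fun z => if z = nextCandidate L visited i start then 0 else 1)
      ≤ 2⁻¹ ^ repetitions n := by
  exact wp_repeatMin_failure L.oracle ((always_firstOneSearchOnce L visited i start hs).mono _
    fun z hz => hz.nextCandidate_le) (wp_firstOneSearchOnce_failure_le L visited i start hs) _

end FirstOne

/-! ### Depth-first search: monotonicity and expected cost -/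

section DepthFirstSearch

variable {n : ℕ} [NeZero n] {G : WeightedDAG n} (L : AdjacencyLists G)

/-- The total weight of the unvisited vertices which are not sinks. -/
def potential (w : Fin n → ℝ≥0∞) (visited : Fin n → Bool) : ℝ≥0∞ :=
  ∑ v, if visited v = false ∧ 0 < L.outDeg v then w v else 0

/-- Mark a vertex as visited. -/
def SortState.mark (σ : SortState n) (i : Fin n) : SortState n :=
  ⟨Function.update σ.visited i true, σ.order⟩

omit [NeZero n] in
theorem SortState.mark_visited (σ : SortState n) (i v : Fin n) :
    (σ.mark i).visited v = true ↔ v = i ∨ σ.visited v = true := by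
  by_cases h : v = i <;> simp [SortState.mark, h]

omit [NeZero n] in
theorem potential_mark_le (w : Fin n → ℝ≥0∞) (σ : SortState n) (i : Fin n) :
    potential L w (σ.mark i).visited ≤ potential L w σ.visited := by
  refine Finset.sum_le_sum fun v _ => ?_
  by_cases hv : v = i
  · simp [SortState.mark, hv]
  · simp [SortState.mark, Function.update_of_ne hv]

omit [NeZero n] in
theorem potential_eq_mark_add (w : Fin n → ℝ≥0∞) {σ : SortState n} {i : Fin n}
    (hi : σ.visited i = false) (hd : 0 < L.outDeg i) :
    potential L w σ.visited = potential L w (σ.mark i).visited + w i := by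
  rw [potential, potential, ← Finset.sum_erase_add _ _ (Finset.mem_univ i),
    ← Finset.sum_erase_add (f := fun v => if (σ.mark i).visited v = false ∧ 0 < L.outDeg v
      then w v else 0) _ (Finset.mem_univ i), if_pos ⟨hi, hd⟩]
  have h1 : (σ.mark i).visited i = true := (σ.mark_visited i i).2 (Or.inl rfl)
  rw [h1, if_neg (by simp), add_zero]
  congr 1
  refine Finset.sum_congr rfl fun v hv => ?_
  have hv' : v ≠ i := Finset.ne_of_mem_erase hv
  simp [SortState.mark, Function.update_of_ne hv']

/-- The number of unvisited vertices. -/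
def SortState.unvisitedCount (σ : SortState n) : ℕ :=
  (Finset.univ.filter fun v => σ.visited v = false).card

/-- Visited vertices remain visited. -/
def SortState.Grows (σ σ' : SortState n) : Prop := ∀ v, σ.visited v = true → σ'.visited v = true

omit [NeZero n] in
theorem SortState.Grows.unvisitedCount_le {σ σ' : SortState n} (h : σ.Grows σ') :
    σ'.unvisitedCount ≤ σ.unvisitedCount := by
  refine Finset.card_le_card fun v hv => ?_
  simp only [Finset.mem_filter, Finset.mem_univ, true_and] at hv ⊢
  by_contra hc
  have := h v (by simpa using hc)
  simp [hv] at this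

omit [NeZero n] in
theorem SortState.grows_mark (σ : SortState n) (i : Fin n) : σ.Grows (σ.mark i) :=
  fun v hv => (σ.mark_visited i v).2 (Or.inr hv)

omit [NeZero n] in
theorem SortState.unvisitedCount_mark_lt {σ : SortState n} {i : Fin n}
    (hi : σ.visited i = false) : (σ.mark i).unvisitedCount < σ.unvisitedCount := by
  refine Finset.card_lt_card ⟨fun v hv => ?_, fun h => ?_⟩
  · simp only [Finset.mem_filter, Finset.mem_univ, true_and] at hv ⊢
    by_contra hc
    have := σ.grows_mark i v (by simpa using hc)
    simp [hv] at this
  · have h1 := h (Finset.mem_filter.2 ⟨Finset.mem_univ i, hi⟩)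
    have h2 := (σ.mark_visited i i).2 (Or.inl rfl)
    simp [h2] at h1

omit [NeZero n] in
theorem SortState.unvisitedCount_le (σ : SortState n) : σ.unvisitedCount ≤ n := by
  have := Finset.card_le_univ (Finset.univ.filter fun v => σ.visited v = false)
  rwa [Fintype.card_fin] at this

theorem oracle_out_fst {i u : Fin n} {p : ℕ} (h : (L.outList i)[p]? = some u) :
    (L.oracle ⟨false, i, p⟩).1 = u := by
  simp [AdjacencyLists.oracle, h]

theorem wp_neighbourLoop_succ {dout : Fin n → ℕ}
    {rec : Fin n → SortState n → GraphProgram n (SortState n)} {i : Fin n} {fuel start : ℕ}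
    {σ : SortState n} (κ : ℝ≥0∞) (f : SortState n → ℝ≥0∞) :
    wp L.oracle κ (neighbourLoop dout rec i (fuel + 1) start σ) f
      = wp L.oracle κ (firstOneSearch dout σ.visited i start) fun z =>
        match z with
        | none => f σ
        | some p => κ + wp L.oracle κ (rec (L.oracle ⟨false, i, p⟩).1 σ) fun σ' =>
            wp L.oracle κ (neighbourLoop dout rec i fuel (p + 1) σ') f := by
  rw [neighbourLoop, wp_bind]
  congr 1
  ext z
  match z with
  | none => rfl
  | some p =>
    dsimp only
    rw [wp_bind]
    change κ + wp L.oracle κ (rec _ σ >>= fun σ' => neighbourLoop dout rec i fuel (p + 1) σ') f = _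
    rw [wp_bind]

theorem topSortDFS_succ_of_pos {dout : Fin n → ℕ} {i : Fin n} (hi : 0 < dout i) (depth : ℕ)
    (σ : SortState n) : topSortDFS dout (depth + 1) i σ
      = neighbourLoop dout (topSortDFS dout depth) i (dout i) 0 (σ.mark i) >>= fun σ₂ =>
          pure ⟨σ₂.visited, i :: σ₂.order⟩ := by
  rw [topSortDFS, if_pos hi]
  rfl

theorem topSortDFS_succ_of_eq_zero {dout : Fin n → ℕ} {i : Fin n} (hi : dout i = 0) (depth : ℕ)
    (σ : SortState n) : topSortDFS dout (depth + 1) i σ = pure (σ.mark i) := by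
  rw [topSortDFS, if_neg (by omega)]
  rfl

theorem always_grows_neighbourLoop {dout : Fin n → ℕ}
    {rec : Fin n → SortState n → GraphProgram n (SortState n)}
    (hrec : ∀ j σ, (rec j σ).Always L.oracle σ.Grows) (i : Fin n) (fuel start : ℕ)
    (σ : SortState n) : (neighbourLoop dout rec i fuel start σ).Always L.oracle σ.Grows := by
  induction fuel generalizing start σ with
  | zero => exact fun v hv => hv
  | succ fuel ih =>
    rw [neighbourLoop]
    refine always_bind _ (always_true _ _) fun z _ => ?_
    match z with
    | none => exact fun v hv => hv
    | some p =>
      refine always_bind _ (always_true _ _) fun a _ => always_bind _ (hrec a.1 σ) fun σ' h => ?_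
      exact (ih (p + 1) σ').mono _ fun σ'' h' v hv => h' v (h v hv)

theorem always_grows_topSortDFS (dout : Fin n → ℕ) (depth : ℕ) (i : Fin n) (σ : SortState n) :
    (topSortDFS dout depth i σ).Always L.oracle σ.Grows := by
  induction depth generalizing i σ with
  | zero => exact fun v hv => hv
  | succ depth ih =>
    rcases Nat.eq_zero_or_pos (dout i) with hi | hi
    · rw [topSortDFS_succ_of_eq_zero hi]
      exact σ.grows_mark i
    · rw [topSortDFS_succ_of_pos hi]
      exact always_bind _ (always_grows_neighbourLoop L ih i _ _ _) fun σ₂ h v hv =>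
        h v (σ.grows_mark i v hv)

/-! ### Expected cost -/

/-- Amortized analysis. The linear bound `a * D + b` for a search of length `D` telescopes along the
list, which leaves `a` times the remaining length, and the `b` of the last search. When a vertex `u`
is found, its weight leaves the potential: `a * L.outDeg u + b` pays for the recursive call, and `b
+ 1` for the query that reads the entry and the constant part of the search after it. -/
theorem wp_neighbourLoop_cost_le {a b : ℝ≥0∞}
    (hab : ∀ D : ℕ, repetitions n * ENNReal.ofReal (20000 * Real.sqrt D) ≤ a * D + b)
    {rec : Fin n → SortState n → GraphProgram n (SortState n)} {depth : ℕ}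
    (hgrows : ∀ j σ, (rec j σ).Always L.oracle σ.Grows)
    (hrec : ∀ j σ, σ.visited j = false → 0 < L.outDeg j → σ.unvisitedCount ≤ depth →
      wp L.oracle 1 (rec j σ) (fun σ' => potential L (fun v => a * L.outDeg v + b + (b + 1)) σ'.visited)
        ≤ potential L (fun v => a * L.outDeg v + b + (b + 1)) (σ.mark j).visited
          + (a * L.outDeg j + b))
    (i : Fin n) (fuel start : ℕ) (σ : SortState n) (hs : start ≤ L.outDeg i)
    (hσ : σ.unvisitedCount ≤ depth) :
    wp L.oracle 1 (neighbourLoop L.outDeg rec i fuel start σ)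
        (fun σ' => potential L (fun v => a * L.outDeg v + b + (b + 1)) σ'.visited)
      ≤ potential L (fun v => a * L.outDeg v + b + (b + 1)) σ.visited
        + (a * (L.outDeg i - start : ℕ) + b) := by
  set w : Fin n → ℝ≥0∞ := fun v => a * L.outDeg v + b + (b + 1) with hw
  induction fuel generalizing start σ with
  | zero => exact le_self_add
  | succ fuel ih =>
    rw [wp_neighbourLoop_succ]
    have hcost := (wp_firstOneSearch_le L σ.visited i start hs).trans (hab _)
    have halw := always_firstOneSearch L σ.visited i start hs
    rcases nextCandidate_eq_top_or L σ.visited i start with h | ⟨p, h, hsp, hc⟩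
    · refine (wp_le_of_always L.oracle halw (c := potential L w σ.visited) fun z hz => ?_).trans ?_
      · have := hz.nextCandidate_le
        rw [h, top_le_iff] at this
        rw [this]
      · rw [add_comm]
        refine add_le_add_right (hcost.trans (le_of_eq ?_)) _
        rw [searchLength, h]
    · refine (wp_le_of_always L.oracle halw
        (c := potential L w σ.visited + a * (L.outDeg i - (p + 1) : ℕ)) fun z hz => ?_).trans ?_
      · rcases hz with hz | ⟨q, hz, hsq, hq⟩
        · rw [hz]
          exact le_self_add
        -- A failed search may return a later candidate `q` instead of the first one `p`. The cost
        -- bound survives: the search itself is charged up to `p`, and from `q + 1` on less of the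
        -- list is left.
        · have hpq := nextCandidate_le L σ.visited i hq hsq
          rw [h] at hpq
          replace hpq : p ≤ q := by exact_mod_cast hpq
          have hqd := hq.lt
          obtain ⟨u, hu, huv, hud⟩ := hq
          rw [hz]
          change 1 + wp L.oracle 1 (rec (L.oracle ⟨false, i, q⟩).1 σ) _ ≤ _
          rw [oracle_out_fst L hu]
          refine (add_le_add_right (wp_mono_of_always L.oracle (hgrows u σ) fun σ' hσ' =>
            ih (q + 1) σ' (by omega) (hσ'.unvisitedCount_le.trans hσ)) 1).trans ?_
          rw [wp_add_const, potential_eq_mark_add L w huv hud]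
          refine (add_le_add_right (add_le_add_left (hrec u σ huv hud hσ) _) 1).trans ?_
          have hsub : (L.outDeg i - (q + 1) : ℕ) ≤ L.outDeg i - (p + 1) := by omega
          calc _ = potential L w (σ.mark u).visited + w u + a * (L.outDeg i - (q + 1) : ℕ) := by
                rw [hw]
                ring
            _ ≤ _ := by gcongr
      · have hpd := hc.lt
        have hlen : searchLength L σ.visited i start = p - start + 1 := by
          rw [searchLength, h]
          rfl
        rw [hlen] at hcost
        refine (add_le_add_left hcost _).trans (le_of_eq ?_)
        have hsplit : L.outDeg i - start = (p - start + 1) + (L.outDeg i - (p + 1)) := by omega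
        rw [hsplit]
        push_cast
        ring

theorem wp_topSortDFS_cost_le {a b : ℝ≥0∞}
    (hab : ∀ D : ℕ, repetitions n * ENNReal.ofReal (20000 * Real.sqrt D) ≤ a * D + b)
    (depth : ℕ) (i : Fin n) (σ : SortState n) (hi : σ.visited i = false) (hd : 0 < L.outDeg i)
    (hσ : σ.unvisitedCount ≤ depth) :
    wp L.oracle 1 (topSortDFS L.outDeg depth i σ)
        (fun σ' => potential L (fun v => a * L.outDeg v + b + (b + 1)) σ'.visited)
      ≤ potential L (fun v => a * L.outDeg v + b + (b + 1)) (σ.mark i).visited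
        + (a * L.outDeg i + b) := by
  have hlt := SortState.unvisitedCount_mark_lt hi
  induction depth generalizing i σ with
  | zero => omega
  | succ depth ih =>
    rw [topSortDFS_succ_of_pos hd, wp_bind]
    exact wp_neighbourLoop_cost_le L hab (always_grows_topSortDFS L _ depth)
      (fun j σ' hj hjd hc => ih j σ' hj hjd hc (SortState.unvisitedCount_mark_lt hj)) i _ 0 _
      (Nat.zero_le _) (by omega)

theorem wp_topSort_cost_le {a b : ℝ≥0∞}
    (hab : ∀ D : ℕ, repetitions n * ENNReal.ofReal (20000 * Real.sqrt D) ≤ a * D + b) :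
    wp L.oracle 1 (topSort L.outDeg L.inDeg) (fun _ => 0)
      ≤ ∑ v, if 0 < L.outDeg v then a * L.outDeg v + b + (b + 1) else 0 := by
  set w : Fin n → ℝ≥0∞ := fun v => a * L.outDeg v + b + (b + 1) with hw
  have key : ∀ (l : List (Fin n)) (σ : SortState n), wp L.oracle 1
      (l.foldlM (fun σ i => if σ.visited i then pure σ else topSortDFS L.outDeg n i σ) σ)
      (fun σ' => potential L w σ'.visited) ≤ potential L w σ.visited := by
    intro l
    induction l with
    | nil => exact fun σ => le_rfl
    | cons i l ih =>
      intro σ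
      rw [List.foldlM_cons, wp_bind]
      refine (wp_mono _ _ ih).trans ?_
      split
      · exact le_rfl
      · have hi : σ.visited i = false := by simpa using ‹¬ σ.visited i = true›
        rcases Nat.eq_zero_or_pos (L.outDeg i) with hd | hd
        · obtain ⟨m, rfl⟩ := Nat.exists_eq_succ_of_ne_zero (NeZero.ne n)
          rw [topSortDFS_succ_of_eq_zero hd]
          exact potential_mark_le L w σ i
        · refine (wp_topSortDFS_cost_le L hab n i σ hi hd σ.unvisitedCount_le).trans ?_
          rw [potential_eq_mark_add L w hi hd]
          refine add_le_add_right ?_ _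
          rw [hw]
          exact le_self_add
  rw [topSort, wp_bind]
  refine (wp_mono _ _ fun σ => ?_).trans ((key _ _).trans (le_of_eq ?_))
  · exact zero_le
  · simp [potential, hw]

end DepthFirstSearch

/-! ### Correctness of the topological sort -/

section TopologicalSort

variable {n : ℕ} [NeZero n] {G : WeightedDAG n} (L : AdjacencyLists G)

/-- The list `order` is topologically sorted, and it is closed under successors which are not
sinks. -/
structure SortState.IsSorted (σ : SortState n) : Prop where
  nodup : σ.order.Nodup
  visited : ∀ v ∈ σ.order, σ.visited v = true
  nonsink : ∀ v ∈ σ.order, 0 < L.outDeg v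
  closed : ∀ u ∈ σ.order, ∀ w, (u, w) ∈ G.edges → 0 < L.outDeg w → w ∈ σ.order
  sorted : σ.order.Pairwise fun u w => (w, u) ∉ G.edges

/-- A vertex whose search has started but is not finished. -/
def SortState.IsGray (σ : SortState n) (v : Fin n) : Prop :=
  σ.visited v = true ∧ 0 < L.outDeg v ∧ v ∉ σ.order

/-- The state `σ'` arises from `σ` by finishing some searches of unvisited vertices. -/
structure SortState.Extends (σ σ' : SortState n) : Prop where
  grows : σ.Grows σ'
  gray : ∀ v, σ'.IsGray L v → σ.IsGray L v
  order : ∀ v ∈ σ.order, v ∈ σ'.order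
  new : ∀ v ∈ σ'.order, v ∈ σ.order ∨ σ.visited v = false

variable {L}

omit [NeZero n] in
theorem SortState.Extends.refl (σ : SortState n) : σ.Extends L σ :=
  ⟨fun _ h => h, fun _ h => h, fun _ h => h, fun _ h => Or.inl h⟩

omit [NeZero n] in
theorem SortState.Extends.trans {σ₁ σ₂ σ₃ : SortState n} (h : σ₁.Extends L σ₂)
    (h' : σ₂.Extends L σ₃) : σ₁.Extends L σ₃ where
  grows v hv := h'.grows v (h.grows v hv)
  gray v hv := h.gray v (h'.gray v hv)
  order v hv := h'.order v (h.order v hv)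
  new v hv := by
    rcases h'.new v hv with h1 | h1
    · exact h.new v h1
    · right
      by_contra h2
      have := h.grows v (by simpa using h2)
      simp [h1] at this

/-- A correct run of the depth-first search from `i`. -/
structure SearchDone (L : AdjacencyLists G) (i : Fin n) (σ σ' : SortState n) : Prop where
  sorted : σ'.IsSorted L
  extend : σ.Extends L σ'
  mem : i ∈ σ'.order

/-- A correct run of the loop over the neighbours of `i`. -/
structure LoopDone (L : AdjacencyLists G) (i : Fin n) (σ σ' : SortState n) : Prop where
  sorted : σ'.IsSorted L
  extend : σ.Extends L σ'
  neighbours : ∀ u, (i, u) ∈ G.edges → 0 < L.outDeg u → σ'.visited u = true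

omit [NeZero n] in
theorem SortState.IsSorted.mark {σ : SortState n} (h : σ.IsSorted L) (i : Fin n) :
    (σ.mark i).IsSorted L where
  nodup := h.nodup
  visited v hv := σ.grows_mark i v (h.visited v hv)
  nonsink := h.nonsink
  closed := h.closed
  sorted := h.sorted

omit [NeZero n] in
theorem SortState.IsGray.of_mark {σ : SortState n} {i v : Fin n} (h : (σ.mark i).IsGray L v) :
    v = i ∨ σ.IsGray L v := by
  obtain ⟨h1, h2, h3⟩ := h
  rcases (σ.mark_visited i v).1 h1 with h | h
  · exact Or.inl h
  · exact Or.inr ⟨h, h2, h3⟩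

omit [NeZero n] in
/-- Finishing the search of `i` after the loop over its neighbours. -/
theorem LoopDone.finish {i : Fin n} {σ σ₂ : SortState n} (h : LoopDone L i (σ.mark i) σ₂)
    (hσ : σ.IsSorted L) (hi : σ.visited i = false) (hd : 0 < L.outDeg i)
    (hgray : ∀ g, σ.IsGray L g → Relation.TransGen (fun u v => (u, v) ∈ G.edges) g i) :
    SearchDone L i σ ⟨σ₂.visited, i :: σ₂.order⟩ := by
  have hmark : (σ.mark i).visited i = true := (σ.mark_visited i i).2 (Or.inl rfl)
  have hi2 : i ∉ σ₂.order := by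
    intro hmem
    rcases h.extend.new i hmem with h1 | h1
    · have := hσ.visited i h1
      simp [hi] at this
    · simp [hmark] at h1
  refine ⟨⟨?_, ?_, ?_, ?_, ?_⟩, ⟨?_, ?_, ?_, ?_⟩, List.mem_cons_self⟩
  · exact List.nodup_cons.2 ⟨hi2, h.sorted.nodup⟩
  · intro v hv
    rcases List.mem_cons.1 hv with rfl | hv
    · exact h.extend.grows v hmark
    · exact h.sorted.visited v hv
  · intro v hv
    rcases List.mem_cons.1 hv with rfl | hv
    · exact hd
    · exact h.sorted.nonsink v hv
  · intro u hu w huw hw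
    rcases List.mem_cons.1 hu with rfl | hu
    · by_contra hnot
      have hw2 : w ∉ σ₂.order := fun h' => hnot (List.mem_cons_of_mem _ h')
      rcases (h.extend.gray w ⟨h.neighbours w huw hw, hw, hw2⟩).of_mark with rfl | hg
      · exact G.acyclic w (.single huw)
      · exact G.acyclic w ((hgray w hg).tail huw)
    · exact List.mem_cons_of_mem _ (h.sorted.closed u hu w huw hw)
  -- Putting `i` in front is legitimate: an edge from a finished `w` to the non-sink `i` would force
  -- `i` into the list already, by closure.
  · exact List.pairwise_cons.2 ⟨fun w hw hwi => hi2 (h.sorted.closed w hw i hwi hd),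
      h.sorted.sorted⟩
  · exact fun v hv => h.extend.grows v (σ.grows_mark i v hv)
  · rintro v ⟨h1, h2, h3⟩
    rw [List.mem_cons, not_or] at h3
    exact ((h.extend.gray v ⟨h1, h2, h3.2⟩).of_mark).resolve_left h3.1
  · exact fun v hv => List.mem_cons_of_mem _ (h.extend.order v hv)
  · intro v hv
    rcases List.mem_cons.1 hv with rfl | hv
    · exact Or.inr hi
    · rcases h.extend.new v hv with h1 | h1
      · exact Or.inl h1
      · right
        by_contra hc
        have := σ.grows_mark i v (by simpa using hc)
        simp [h1] at this

/-- The same accounting as for the cost, now for failure probabilities: each found vertex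
contributes `ε` for its recursive call and `ε` for the search after it, and the additional `ε` is
that of the search at hand. The number `c` is a budget for whatever follows; keeping it arbitrary
lets the recursive call be used with the rest of the loop as its continuation. -/
theorem wp_neighbourLoop_risk_le {ε : ℝ≥0∞} (hε : (2⁻¹ : ℝ≥0∞) ^ repetitions n ≤ ε)
    {rec : Fin n → SortState n → GraphProgram n (SortState n)} {depth : ℕ}
    (hrec : ∀ j σ (c : ℝ≥0∞), σ.visited j = false → 0 < L.outDeg j → σ.unvisitedCount ≤ depth →
      σ.IsSorted L →
      (∀ g, σ.IsGray L g → Relation.TransGen (fun u v => (u, v) ∈ G.edges) g j) →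
      wp L.oracle 0 (rec j σ)
          (risk (SearchDone L j σ) fun σ' => potential L (fun _ => ε + ε) σ'.visited + c)
        ≤ potential L (fun _ => ε + ε) (σ.mark j).visited + ε + c)
    (i : Fin n) (fuel start : ℕ) (σ : SortState n) (c : ℝ≥0∞) (hs : start ≤ L.outDeg i)
    (hfuel : L.outDeg i ≤ start + fuel) (hσ : σ.unvisitedCount ≤ depth) (hsort : σ.IsSorted L)
    (hgray : ∀ g, σ.IsGray L g → Relation.ReflTransGen (fun u v => (u, v) ∈ G.edges) g i)
    (hpre : ∀ p < start, ∀ u, (L.outList i)[p]? = some u → 0 < L.outDeg u →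
      σ.visited u = true) :
    wp L.oracle 0 (neighbourLoop L.outDeg rec i fuel start σ)
        (risk (LoopDone L i σ) fun σ' => potential L (fun _ => ε + ε) σ'.visited + c)
      ≤ potential L (fun _ => ε + ε) σ.visited + ε + c := by
  set w : Fin n → ℝ≥0∞ := fun _ => ε + ε with hw
  have hdone : (∀ p, start ≤ p → ¬ IsCandidate L σ.visited i p) → LoopDone L i σ σ := by
    refine fun hno => ⟨hsort, .refl σ, fun u hu hud => ?_⟩
    obtain ⟨p, hp⟩ := List.mem_iff_getElem?.1 ((L.mem_outList i u).2 hu)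
    rcases lt_or_ge p start with hlt | hge
    · exact hpre p hlt u hp hud
    · by_contra hc
      exact hno p hge ⟨u, hp, by simpa using hc, hud⟩
  have hret : LoopDone L i σ σ → ∀ d, risk (LoopDone L i σ)
      (fun σ' => potential L w σ'.visited + d) σ ≤ potential L w σ.visited + d := by
    intro h d
    rw [risk, if_pos h]
    exact min_le_right _ _
  induction fuel generalizing start σ c with
  | zero =>
    refine (hret (hdone fun p hp hc => ?_) c).trans ?_
    -- The fuel runs out only when `start` has reached the end of the list, so nothing has been
    -- missed.
    · have := hc.lt
      omega
    · gcongr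
      exact le_self_add
  | succ fuel ih =>
    rw [wp_neighbourLoop_succ]
    set e := potential L w σ.visited + c with he
    have hsearch := wp_risk_le_of_failure L.oracle
      ((wp_firstOneSearch_failure_le L σ.visited i start hs).trans hε) e
    rw [show potential L w σ.visited + ε + c = ε + e by rw [he]; ring]
    refine (wp_mono _ _ fun z => ?_).trans hsearch
    have hle1 : ∀ P : GraphProgram n (SortState n), wp L.oracle 0 P
        (risk (LoopDone L i σ) fun σ' => potential L w σ'.visited + c) ≤ 1 :=
      fun P => wp_le_of_forall _ (always_true _ P) fun a _ => risk_le_one _ _ a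
    conv_rhs => rw [risk]
    split_ifs with hz
    · refine le_min ?_ ?_
      · match z with
        | none => exact risk_le_one _ _ _
        | some q =>
          dsimp only
          rw [zero_add]
          exact wp_le_of_forall _ (always_true _ _) fun σ' _ => hle1 _
      · rcases nextCandidate_eq_top_or L σ.visited i start with h | ⟨q, h, hsq, hq⟩
        · rw [hz, h]
          refine hret (hdone fun p hp => not_isCandidate_of_lt L σ.visited i hp ?_) c
          rw [h]
          exact WithTop.coe_lt_top p
        · have hqd := hq.lt
          obtain ⟨u, hu, huv, hud⟩ := hq
          have hiu : (i, u) ∈ G.edges := (L.mem_outList i u).1 (List.mem_of_getElem? hu)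
          rw [hz, h]
          change 0 + wp L.oracle 0 (rec (L.oracle ⟨false, i, q⟩).1 σ) _ ≤ _
          rw [zero_add, oracle_out_fst L hu]
          -- The budget `ε + c` hands the rest of the loop, whose next search may fail, over to the
          -- recursive call. Every gray vertex reaches `i`, hence reaches `u` by a path of positive
          -- length.
          have hr := hrec u σ (ε + c) huv hud hσ hsort fun g hg => .tail' (hgray g hg) hiu
          have hbind := wp_bind_risk_le L.oracle (P := rec u σ)
            (k := fun σ' => neighbourLoop L.outDeg rec i fuel (q + 1) σ')
            (T := LoopDone L i σ) (e' := fun σ' => potential L w σ'.visited + c) hr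
            fun σ' hσ' => ?_
          · rw [wp_bind] at hbind
            refine hbind.trans (le_of_eq ?_)
            rw [he, potential_eq_mark_add L w huv hud, hw]
            ring
          -- Positions before `start` are known, those between `start` and `q` hold no candidate
          -- because the search was correct, and the vertex at `q` has just been finished.
          · have hpre' : ∀ p < q + 1, ∀ u', (L.outList i)[p]? = some u' → 0 < L.outDeg u' →
                σ'.visited u' = true := by
              intro p hp u' hu' hud'
              rcases lt_or_ge p start with hlt | hge
              · exact hσ'.extend.grows u' (hpre p hlt u' hu' hud')
              · rcases (Nat.lt_succ_iff.1 hp).eq_or_lt with rfl | hlt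
                · rw [hu] at hu'
                  obtain rfl := Option.some.inj hu'
                  exact hσ'.sorted.visited _ hσ'.mem
                · refine hσ'.extend.grows u' ?_
                  by_contra hc
                  refine not_isCandidate_of_lt L σ.visited i hge ?_
                    ⟨u', hu', by simpa using hc, hud'⟩
                  rw [h]
                  exact_mod_cast hlt
            have hgray' : ∀ g, σ'.IsGray L g →
                Relation.ReflTransGen (fun u v => (u, v) ∈ G.edges) g i :=
              fun g hg => hgray g (hσ'.extend.gray g hg)
            have hdone' : (∀ p, q + 1 ≤ p → ¬ IsCandidate L σ'.visited i p) →
                LoopDone L i σ' σ' := by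
              refine fun hno => ⟨hσ'.sorted, .refl σ', fun u' hu' hud' => ?_⟩
              obtain ⟨p, hp⟩ := List.mem_iff_getElem?.1 ((L.mem_outList i u').2 hu')
              rcases lt_or_ge p (q + 1) with hlt | hge
              · exact hpre' p hlt u' hp hud'
              · by_contra hc
                exact hno p hge ⟨u', hp, by simpa using hc, hud'⟩
            refine (wp_mono _ _ fun σ'' => ?_).trans ((ih (q + 1) σ' c (by omega) (by omega)
              (hσ'.extend.grows.unvisitedCount_le.trans hσ) hσ'.sorted hgray' hpre' hdone'
              fun h' d => ?_).trans (le_of_eq (add_assoc _ _ _)))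
            · exact risk_mono (fun h' => ⟨h'.sorted, hσ'.extend.trans h'.extend, h'.neighbours⟩)
                fun _ => le_rfl
            · rw [risk, if_pos h']
              exact min_le_right _ _
    · match z with
      | none => exact risk_le_one _ _ _
      | some q =>
        dsimp only
        rw [zero_add]
        exact wp_le_of_forall _ (always_true _ _) fun σ' _ => hle1 _

theorem wp_topSortDFS_risk_le {ε : ℝ≥0∞} (hε : (2⁻¹ : ℝ≥0∞) ^ repetitions n ≤ ε)
    (depth : ℕ) (i : Fin n) (σ : SortState n) (c : ℝ≥0∞) (hi : σ.visited i = false)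
    (hd : 0 < L.outDeg i) (hσ : σ.unvisitedCount ≤ depth) (hsort : σ.IsSorted L)
    (hgray : ∀ g, σ.IsGray L g → Relation.TransGen (fun u v => (u, v) ∈ G.edges) g i) :
    wp L.oracle 0 (topSortDFS L.outDeg depth i σ)
        (risk (SearchDone L i σ) fun σ' => potential L (fun _ => ε + ε) σ'.visited + c)
      ≤ potential L (fun _ => ε + ε) (σ.mark i).visited + ε + c := by
  induction depth generalizing i σ c with
  | zero =>
    have := SortState.unvisitedCount_mark_lt hi
    omega
  | succ depth ih =>
    have hlt := SortState.unvisitedCount_mark_lt hi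
    rw [topSortDFS_succ_of_pos hd]
    refine wp_bind_risk_le L.oracle (S := LoopDone L i (σ.mark i))
      (wp_neighbourLoop_risk_le hε ih i (L.outDeg i) 0 (σ.mark i) c (Nat.zero_le _) (by omega)
        (by omega) (hsort.mark i) (fun g hg => ?_) fun p hp => absurd hp (Nat.not_lt_zero p))
      fun σ₂ h₂ => ?_
    · rcases hg.of_mark with rfl | hg
      · exact .refl
      · exact (hgray g hg).to_reflTransGen
    · rw [wp_pure, risk, if_pos (h₂.finish hsort hi hd hgray)]
      exact min_le_right _ _

/-- A correct result of the topological sort. -/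
structure IsTopologicalOrder (G : WeightedDAG n) (l : List (Fin n)) : Prop where
  nodup : l.Nodup
  mem : ∀ v, v ∈ l
  sorted : l.Pairwise fun u w => (w, u) ∉ G.edges

omit [NeZero n] in
theorem WeightedDAG.wellFounded (G : WeightedDAG n) :
    WellFounded fun u v => (u, v) ∈ G.edges := by
  have : Std.Irrefl (Relation.TransGen fun u v => (u, v) ∈ G.edges) := ⟨G.acyclic⟩
  exact Subrelation.wf (fun h => Relation.TransGen.single h)
    (Finite.wellFounded_of_trans_of_irrefl
      (Relation.TransGen fun u v => (u, v) ∈ G.edges))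

omit [NeZero n] in
-- By well-founded induction along the edges every non-sink is in the list: it is a source, or it
-- has an in-neighbour, which is a non-sink in the list, and the list is closed. Sinks have no
-- outgoing edges, so they may follow in any order.
theorem SortState.IsSorted.isTopologicalOrder {σ : SortState n} (h : σ.IsSorted L)
    (hsrc : ∀ i, L.inDeg i = 0 → 0 < L.outDeg i → i ∈ σ.order) :
    IsTopologicalOrder G (σ.order ++ (List.finRange n).filter fun i => L.outDeg i = 0) := by
  have hall : ∀ v, 0 < L.outDeg v → v ∈ σ.order := by
    intro v
    induction v using G.wellFounded.induction with
    | _ v ih =>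
      intro hv
      rcases Nat.eq_zero_or_pos (L.inDeg v) with h0 | hpos
      · exact hsrc v h0 hv
      · obtain ⟨u, hu⟩ := List.exists_mem_of_length_pos hpos
        have huv := (L.mem_inList u v).1 hu
        exact h.closed u (ih u huv (List.length_pos_of_mem ((L.mem_outList u v).2 huv))) v huv hv
  refine ⟨List.nodup_append.2 ⟨h.nodup, (List.nodup_finRange n).filter _, ?_⟩, fun v => ?_,
    List.pairwise_append.2 ⟨h.sorted, ?_, ?_⟩⟩
  · intro a ha b hb hab
    have h1 := h.nonsink a ha
    have h2 := (List.mem_filter.1 hb).2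
    rw [← hab] at h2
    simp only [decide_eq_true_eq] at h2
    omega
  · rcases Nat.eq_zero_or_pos (L.outDeg v) with h0 | hpos
    · exact List.mem_append_right _ (List.mem_filter.2 ⟨List.mem_finRange v, by simpa using h0⟩)
    · exact List.mem_append_left _ (hall v hpos)
  · refine List.Pairwise.imp_of_mem (R := fun _ _ => True) (fun {u w} _ hw _ hwu => ?_)
      (List.pairwise_of_forall fun _ _ => trivial)
    have h1 := List.length_pos_of_mem ((L.mem_outList w u).2 hwu)
    have h2 : (L.outList w).length = 0 := by
      simpa [AdjacencyLists.outDeg] using (List.mem_filter.1 hw).2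
    omega
  · intro u _ w hw hwu
    have h1 := List.length_pos_of_mem ((L.mem_outList w u).2 hwu)
    have h2 : (L.outList w).length = 0 := by
      simpa [AdjacencyLists.outDeg] using (List.mem_filter.1 hw).2
    omega

/-- The state after the searches from the vertices of the list `l`. -/
structure SourcesDone (L : AdjacencyLists G) (l : List (Fin n)) (σ σ' : SortState n) : Prop where
  sorted : σ'.IsSorted L
  order : ∀ v ∈ σ.order, v ∈ σ'.order
  mem : ∀ i ∈ l, 0 < L.outDeg i → i ∈ σ'.order

/-- Between two searches at the top level nothing is gray. So a source that is skipped because it is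
visited is a sink or already in the list, and the path condition for the next search is vacuous. -/
theorem wp_sources_risk_le {ε : ℝ≥0∞} (hε : (2⁻¹ : ℝ≥0∞) ^ repetitions n ≤ ε) (c : ℝ≥0∞)
    (l : List (Fin n)) (σ : SortState n) (hsort : σ.IsSorted L) (hgray : ∀ g, ¬ σ.IsGray L g) :
    wp L.oracle 0
        (l.foldlM (fun σ i => if σ.visited i then pure σ else topSortDFS L.outDeg n i σ) σ)
        (risk (SourcesDone L l σ) fun _ => c)
      ≤ potential L (fun _ => ε + ε) σ.visited + c := by
  induction l generalizing σ with
  | nil =>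
    change risk _ _ σ ≤ _
    rw [risk, if_pos ⟨hsort, fun _ h => h, fun i hi => absurd hi List.not_mem_nil⟩]
    exact (min_le_right _ _).trans le_add_self
  | cons i l ih =>
    rw [List.foldlM_cons]
    have hnext : ∀ σ' : SortState n, σ'.IsSorted L → (∀ g, ¬ σ'.IsGray L g) →
        (∀ v ∈ σ.order, v ∈ σ'.order) → (0 < L.outDeg i → i ∈ σ'.order) →
        wp L.oracle 0
          (l.foldlM (fun σ i => if σ.visited i then pure σ else topSortDFS L.outDeg n i σ) σ')
          (risk (SourcesDone L (i :: l) σ) fun _ => c)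
          ≤ potential L (fun _ => ε + ε) σ'.visited + c := by
      intro σ' h1 h2 h3 h4
      refine (wp_mono _ _ fun σ'' => ?_).trans (ih σ' h1 h2)
      refine risk_mono (fun h => ⟨h.sorted, fun v hv => h.order v (h3 v hv), fun j hj hjd => ?_⟩)
        fun _ => le_rfl
      rcases List.mem_cons.1 hj with rfl | hj
      · exact h.order j (h4 hjd)
      · exact h.mem j hj hjd
    by_cases hi : σ.visited i = true
    · rw [if_pos hi, wp_bind, wp_pure]
      refine hnext σ hsort hgray (fun _ h => h) fun hd => ?_
      by_contra hnot
      exact hgray i ⟨hi, hd, hnot⟩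
    · rw [if_neg hi]
      have hi' : σ.visited i = false := by simpa using hi
      rcases Nat.eq_zero_or_pos (L.outDeg i) with hd | hd
      · have hdfs : topSortDFS L.outDeg n i σ = pure (σ.mark i) := by
          obtain ⟨m, hm⟩ := Nat.exists_eq_succ_of_ne_zero (NeZero.ne n)
          -- Only the recursion depth is to be replaced by a successor; `n` also occurs in the types
          -- and has to stay.
          have : ∀ k, k = m.succ → topSortDFS L.outDeg k i σ = pure (σ.mark i) := by
            rintro k rfl
            exact topSortDFS_succ_of_eq_zero hd m σ
          exact this n hm
        rw [hdfs, wp_bind, wp_pure]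
        refine (hnext (σ.mark i) (hsort.mark i) (fun g hg => ?_) (fun _ h => h)
          fun h => absurd h (by omega)).trans (add_le_add_left (potential_mark_le L _ σ i) _)
        rcases hg.of_mark with rfl | hg'
        · have := hg.2.1
          omega
        · exact hgray g hg'
      · refine (wp_bind_risk_le L.oracle (wp_topSortDFS_risk_le hε n i σ c hi' hd
          σ.unvisitedCount_le hsort fun g hg => absurd hg (hgray g)) fun σ' h' => ?_).trans ?_
        · exact hnext σ' h'.sorted (fun g hg => hgray g (h'.extend.gray g hg)) h'.extend.order
            fun _ => h'.mem
        · rw [potential_eq_mark_add L _ hi' hd, add_assoc, add_assoc, add_assoc]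
          refine add_le_add_right (add_le_add_right ?_ _) _
          exact le_add_self

theorem wp_topSort_risk_le {ε : ℝ≥0∞} (hε : (2⁻¹ : ℝ≥0∞) ^ repetitions n ≤ ε) (c : ℝ≥0∞) :
    wp L.oracle 0 (topSort L.outDeg L.inDeg) (risk (IsTopologicalOrder G) fun _ => c)
      ≤ n * (ε + ε) + c := by
  rw [topSort]
  refine (wp_bind_risk_le L.oracle (e := fun _ => c) (wp_sources_risk_le (L := L) hε c
    ((List.finRange n).filter fun i => L.inDeg i = 0)
    ⟨fun _ => false, []⟩ ⟨List.nodup_nil, ?_, ?_, ?_, List.Pairwise.nil⟩ ?_)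
    fun σ hσ => ?_).trans ?_
  · exact fun v hv => absurd hv List.not_mem_nil
  · exact fun v hv => absurd hv List.not_mem_nil
  · exact fun v hv => absurd hv List.not_mem_nil
  · rintro g ⟨h, -⟩
    simp at h
  · rw [wp_pure, risk, if_pos]
    · exact min_le_right _ _
    · refine hσ.sorted.isTopologicalOrder fun i hi hd => hσ.mem i ?_ hd
      exact List.mem_filter.2 ⟨List.mem_finRange i, by simpa using hi⟩
  · refine add_le_add_left ?_ _
    rw [potential]
    refine (Finset.sum_le_sum (g := fun _ => ε + ε) fun v _ => ?_).trans (le_of_eq ?_)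
    · split <;> simp
    · rw [Finset.sum_const, Finset.card_univ, Fintype.card_fin, nsmul_eq_mul]

end TopologicalSort

/-! ### The enumeration has no repetitions, even if searches fail -/

section Enumeration

variable {n : ℕ} [NeZero n] {G : WeightedDAG n} (L : AdjacencyLists G)

/-- The list `order` consists of distinct visited vertices which are not sinks. -/
structure SortState.IsProper (σ : SortState n) : Prop where
  nodup : σ.order.Nodup
  visited : ∀ v ∈ σ.order, σ.visited v = true
  nonsink : ∀ v ∈ σ.order, 0 < L.outDeg v

/-- The state `σ'` is proper, and its new elements are unvisited in `σ`. -/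
structure SortState.ProperStep (σ σ' : SortState n) : Prop where
  proper : σ'.IsProper L
  grows : σ.Grows σ'
  new : ∀ v ∈ σ'.order, v ∈ σ.order ∨ σ.visited v = false

variable {L}

omit [NeZero n] in
theorem SortState.IsProper.refl {σ : SortState n} (h : σ.IsProper L) : σ.ProperStep L σ :=
  ⟨h, fun _ h => h, fun _ h => Or.inl h⟩

omit [NeZero n] in
theorem SortState.IsProper.mark {σ : SortState n} (h : σ.IsProper L) (i : Fin n) :
    (σ.mark i).IsProper L :=
  ⟨h.nodup, fun v hv => σ.grows_mark i v (h.visited v hv), h.nonsink⟩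

omit [NeZero n] in
theorem SortState.ProperStep.trans {σ₁ σ₂ σ₃ : SortState n} (h : σ₁.ProperStep L σ₂)
    (h' : σ₂.ProperStep L σ₃) : σ₁.ProperStep L σ₃ where
  proper := h'.proper
  grows v hv := h'.grows v (h.grows v hv)
  new v hv := by
    rcases h'.new v hv with h1 | h1
    · exact h.new v h1
    · right
      by_contra h2
      have := h.grows v (by simpa using h2)
      simp [h1] at this

/-- A search that misses the first candidate still returns `⊤` or some unvisited non-sink, so no
vertex is entered twice. This holds on every run, as the bound for the expected cost of the main
part requires. -/
theorem always_properStep_neighbourLoop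
    {rec : Fin n → SortState n → GraphProgram n (SortState n)}
    (hrec : ∀ j σ, σ.IsProper L → σ.visited j = false → 0 < L.outDeg j →
      (rec j σ).Always L.oracle (σ.ProperStep L))
    (i : Fin n) (fuel start : ℕ) (σ : SortState n) (hσ : σ.IsProper L)
    (hs : start ≤ L.outDeg i) :
    (neighbourLoop L.outDeg rec i fuel start σ).Always L.oracle (σ.ProperStep L) := by
  induction fuel generalizing start σ with
  | zero => exact hσ.refl
  | succ fuel ih =>
    rw [neighbourLoop]
    refine always_bind _ (always_firstOneSearch L σ.visited i start hs) fun z hz => ?_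
    match z with
    | none => exact hσ.refl
    | some p =>
      have hp : IsCandidate L σ.visited i p := by
        rcases hz with hz | ⟨q, hz, -, hq⟩
        · exact absurd hz (Option.some_ne_none p)
        · obtain rfl := Option.some.inj hz
          exact hq
      have hlt := hp.lt
      obtain ⟨u, hu, huv, hud⟩ := hp
      refine always_bind _ (S := fun a : Answer n => a.1 = u)
        (show (Program.ask _ Program.ret).Always L.oracle _ from oracle_out_fst L hu) fun a ha => ?_
      rw [ha]
      refine always_bind _ (hrec u σ hσ huv hud) fun σ' h => ?_
      exact (ih (p + 1) σ' h.proper hlt).mono _ fun σ'' h' => h.trans h'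

theorem always_properStep_topSortDFS (depth : ℕ) (i : Fin n) (σ : SortState n)
    (hσ : σ.IsProper L) (hi : σ.visited i = false) :
    (topSortDFS L.outDeg depth i σ).Always L.oracle (σ.ProperStep L) := by
  induction depth generalizing i σ with
  | zero => exact hσ.refl
  | succ depth ih =>
    rcases Nat.eq_zero_or_pos (L.outDeg i) with hd | hd
    · rw [topSortDFS_succ_of_eq_zero hd]
      exact ⟨hσ.mark i, σ.grows_mark i, fun v hv => Or.inl hv⟩
    · rw [topSortDFS_succ_of_pos hd]
      refine always_bind _ (always_properStep_neighbourLoop (fun j σ' h1 h2 _ => ih j σ' h1 h2) i _ _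
        _ (hσ.mark i) (Nat.zero_le _)) fun σ₂ h => ?_
      have hmark : (σ.mark i).visited i = true := (σ.mark_visited i i).2 (Or.inl rfl)
      have hi2 : i ∉ σ₂.order := by
        intro hmem
        rcases h.new i hmem with h1 | h1
        · have := hσ.visited i h1
          simp [hi] at this
        · simp [hmark] at h1
      refine ⟨⟨List.nodup_cons.2 ⟨hi2, h.proper.nodup⟩, fun v hv => ?_, fun v hv => ?_⟩,
        fun v hv => h.grows v (σ.grows_mark i v hv), fun v hv => ?_⟩
      · rcases List.mem_cons.1 hv with rfl | hv
        · exact h.grows v hmark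
        · exact h.proper.visited v hv
      · rcases List.mem_cons.1 hv with rfl | hv
        · exact hd
        · exact h.proper.nonsink v hv
      · rcases List.mem_cons.1 hv with rfl | hv
        · exact Or.inr hi
        · rcases h.new v hv with h1 | h1
          · exact Or.inl h1
          · right
            by_contra hc
            have := σ.grows_mark i v (by simpa using hc)
            simp [h1] at this

/-- Even if searches fail, the topological sort returns distinct vertices. -/
theorem always_nodup_topSort :
    (topSort L.outDeg L.inDeg).Always L.oracle List.Nodup := by
  have key : ∀ (l : List (Fin n)) (σ : SortState n), σ.IsProper L →
      (l.foldlM (fun (σ : SortState n) i =>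
        if σ.visited i then pure σ else topSortDFS L.outDeg n i σ) σ).Always L.oracle
        (SortState.IsProper L) := by
    intro l
    induction l with
    | nil => exact fun σ h => h
    | cons i l ih =>
      intro σ hσ
      rw [List.foldlM_cons]
      refine always_bind _ (S := SortState.IsProper L) ?_ ih
      split
      · exact hσ
      · exact (always_properStep_topSortDFS n i σ hσ (by simpa using ‹¬ σ.visited i = true›)).mono
          _ fun σ' h => h.proper
  rw [topSort]
  refine always_bind _ (key _ _ ⟨List.nodup_nil, fun v hv => absurd hv List.not_mem_nil,
    fun v hv => absurd hv List.not_mem_nil⟩) fun σ h => ?_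
  refine List.nodup_append.2 ⟨h.nodup, (List.nodup_finRange n).filter _, ?_⟩
  intro a ha b hb hab
  have h1 := h.nonsink a ha
  have h2 : L.outDeg b = 0 := by simpa using (List.mem_filter.1 hb).2
  rw [← hab] at h2
  omega

end Enumeration

/-! ### The recurrence for shortest paths -/

section ShortestPaths

variable {n : ℕ} {G : WeightedDAG n} {s : Fin n}

theorem WeightedDAG.HasPath.reflTransGen {v : Fin n} {ℓ : ℝ} (h : G.HasPath s v ℓ) :
    Relation.ReflTransGen (fun u v => (u, v) ∈ G.edges) s v := by
  induction h with
  | nil => exact .refl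
  | snoc _ he ih => exact ih.tail he

/-- A nonempty path from `s` to `s` would be a cycle; therefore negative weights do no harm. -/
theorem WeightedDAG.HasPath.eq_zero {ℓ : ℝ} (h : G.HasPath s s ℓ) : ℓ = 0 := by
  cases h with
  | nil => rfl
  | snoc h he => exact absurd (Relation.TransGen.tail' h.reflTransGen he) (G.acyclic s)

theorem isShortestPathLength_self : G.IsShortestPathLength s s ((0 : ℝ) : WithTop ℝ) :=
  Or.inr ⟨0, rfl, .nil, fun _ h => h.eq_zero.ge⟩

theorem WeightedDAG.HasPath.exists_of_ne {v : Fin n} {ℓ : ℝ} (h : G.HasPath s v ℓ) (hv : v ≠ s) :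
    ∃ u ℓ', G.HasPath s u ℓ' ∧ (u, v) ∈ G.edges ∧ ℓ = ℓ' + G.weight u v := by
  cases h with
  | nil => exact absurd rfl hv
  | snoc h he => exact ⟨_, _, h, he, rfl⟩

/-- The recurrence for shortest path lengths. -/
theorem isShortestPathLength_of_forall_ge {t : Fin n → WithTop ℝ} {v : Fin n} (hv : v ≠ s)
    (ht : ∀ u, (u, v) ∈ G.edges → G.IsShortestPathLength s u (t u)) {m : WithTop ℝ}
    (hle : ∀ u, (u, v) ∈ G.edges → m ≤ t u + (G.weight u v : WithTop ℝ))
    (hmem : m = ⊤ ∨ ∃ u, (u, v) ∈ G.edges ∧ m = t u + (G.weight u v : WithTop ℝ)) :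
    G.IsShortestPathLength s v m := by
  have hlow : ∀ ℓ, G.HasPath s v ℓ → m ≤ (ℓ : WithTop ℝ) := by
    intro ℓ hℓ
    obtain ⟨u, ℓ', hu, he, rfl⟩ := hℓ.exists_of_ne hv
    refine (hle u he).trans ?_
    rcases ht u he with ⟨-, hno⟩ | ⟨d, hd, hleast⟩
    · exact absurd hu (hno ℓ')
    · rw [hd, ← WithTop.coe_add]
      exact WithTop.coe_le_coe.2 (add_le_add_left (hleast.2 hu) _)
  rcases eq_or_ne m ⊤ with rfl | hm
  · left
    exact ⟨rfl, fun ℓ hℓ => WithTop.coe_ne_top (top_le_iff.1 (hlow ℓ hℓ))⟩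
  · right
    obtain ⟨u, he, hmu⟩ := hmem.resolve_left hm
    rcases ht u he with ⟨htop, -⟩ | ⟨d, hd, hleast⟩
    · rw [htop, top_add] at hmu
      exact absurd hmu hm
    · rw [hd, ← WithTop.coe_add] at hmu
      refine ⟨_, hmu, hleast.1.snoc he, fun ℓ hℓ => ?_⟩
      have := hlow ℓ hℓ
      rw [hmu] at this
      exact WithTop.coe_le_coe.1 this

end ShortestPaths

/-! ### The main part: relaxation in the computed order -/

section MainPart

variable {n : ℕ} [NeZero n] {G : WeightedDAG n} (L : AdjacencyLists G)

/-- The key of an in-neighbour in the main part of the algorithm. -/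
def distanceKey (t : Fin n → WithTop ℝ) (_q : Address n) (a : Answer n) : WithTop ℝ :=
  t a.1 + (a.2 : WithTop ℝ)

/-- The minimum search for the vertex `v` in the main part of the algorithm. -/
def relax (t : Fin n → WithTop ℝ) (v : Fin n) : GraphProgram n (WithTop ℝ) :=
  repeatMin (durrHoyer (window true v 0 (L.inDeg v)) (distanceKey t)) (repetitions n)

/-- The main part of the algorithm for the vertices of a list. -/
def relaxAll (l : List (Fin n)) (t : Fin n → WithTop ℝ) : GraphProgram n (Fin n → WithTop ℝ) :=
  l.foldlM (fun t v => relax L t v >>= fun d => pure (Function.update t v d)) t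

theorem wp_relaxAll_cons (κ : ℝ≥0∞) (v : Fin n) (l : List (Fin n)) (t : Fin n → WithTop ℝ)
    (f : (Fin n → WithTop ℝ) → ℝ≥0∞) : wp L.oracle κ (relaxAll L (v :: l) t) f
      = wp L.oracle κ (relax L t v) fun d =>
          wp L.oracle κ (relaxAll L l (Function.update t v d)) f := by
  rw [relaxAll, List.foldlM_cons, wp_bind, wp_bind]
  rfl

theorem shortestPathAlgorithm_eq (s : Fin n) : shortestPathAlgorithm L.outDeg L.inDeg s
    = topSort L.outDeg L.inDeg >>= fun e =>
        relaxAll L (e.dropWhile fun v => v ≠ s).tail (Function.update (fun _ => ⊤) s 0) := rfl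

theorem oracle_in {v u : Fin n} {p : ℕ} (h : (L.inList v)[p]? = some u) :
    L.oracle ⟨true, v, p⟩ = (u, G.weight u v) := by
  simp [AdjacencyLists.oracle, h]

theorem leastKey_distanceKey_le (t : Fin n → WithTop ℝ) {u v : Fin n} (h : (u, v) ∈ G.edges) :
    leastKey L.oracle (distanceKey t) (window true v 0 (L.inDeg v))
      ≤ t u + (G.weight u v : WithTop ℝ) := by
  obtain ⟨p, hp, hpu⟩ := List.mem_iff_getElem.1 ((L.mem_inList u v).2 h)
  refine (Finset.inf_le (Finset.mem_univ (⟨p, hp⟩ : Fin (L.inDeg v)))).trans (le_of_eq ?_)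
  change distanceKey t ⟨true, v, 0 + p⟩ (L.oracle ⟨true, v, 0 + p⟩) = _
  rw [zero_add, oracle_in L (List.getElem?_eq_some_iff.2 ⟨hp, hpu⟩)]
  rfl

theorem leastKey_distanceKey_eq (t : Fin n → WithTop ℝ) (v : Fin n) :
    leastKey L.oracle (distanceKey t) (window true v 0 (L.inDeg v)) = ⊤ ∨
      ∃ u, (u, v) ∈ G.edges ∧ leastKey L.oracle (distanceKey t) (window true v 0 (L.inDeg v))
        = t u + (G.weight u v : WithTop ℝ) := by
  rcases (Finset.univ : Finset (Fin (L.inDeg v))).eq_empty_or_nonempty with h | h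
  · left
    rw [leastKey, h, Finset.inf_empty]
  · right
    obtain ⟨k, -, hk⟩ := Finset.exists_mem_eq_inf _ h fun k : Fin (L.inDeg v) => distanceKey t
      (window true v 0 (L.inDeg v) k) (L.oracle (window true v 0 (L.inDeg v) k))
    have hget : (L.inList v)[(k : ℕ)]? = some ((L.inList v)[(k : ℕ)]'k.isLt) :=
      List.getElem?_eq_getElem k.isLt
    refine ⟨(L.inList v)[(k : ℕ)]'k.isLt, (L.mem_inList _ v).1 (List.getElem_mem k.isLt), ?_⟩
    refine hk.trans ?_
    change distanceKey t ⟨true, v, 0 + k⟩ (L.oracle ⟨true, v, 0 + k⟩) = _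
    rw [zero_add, oracle_in L hget]
    rfl

theorem wp_relax_failure_le (t : Fin n → WithTop ℝ) (v : Fin n) :
    wp L.oracle 0 (relax L t v) (fun d => if d =
        leastKey L.oracle (distanceKey t) (window true v 0 (L.inDeg v)) then 0 else 1)
      ≤ 2⁻¹ ^ repetitions n := by
  refine wp_repeatMin_failure L.oracle ((always_durrHoyer L.oracle _ _).mono _ fun z hz => hz.1)
    (le_of_eq_of_le ?_ (wp_durrHoyer_failure_le L.oracle (distanceKey t)
      (window true v 0 (L.inDeg v)))) _
  congr 1

/-- The invariant is that `t` is correct off the list of pending vertices. The in-neighbours of the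
head are not pending, by the order and by acyclicity, so the recurrence applies to it; each vertex
adds one chance `ε` of failure. -/
theorem wp_relaxAll_failure_le {ε : ℝ≥0∞} (hε : (2⁻¹ : ℝ≥0∞) ^ repetitions n ≤ ε) {s : Fin n}
    (l : List (Fin n)) (t : Fin n → WithTop ℝ) (hs : s ∉ l) (hnodup : l.Nodup)
    (hsort : l.Pairwise fun u w => (w, u) ∉ G.edges)
    (ht : ∀ v, v ∉ l → G.IsShortestPathLength s v (t v)) :
    wp L.oracle 0 (relaxAll L l t)
        (risk (fun t => ∀ v, G.IsShortestPathLength s v (t v)) fun _ => 0) ≤ l.length * ε := by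
  induction l generalizing t with
  | nil =>
    change risk _ _ t ≤ _
    rw [risk, if_pos fun v => ht v List.not_mem_nil]
    exact (min_le_right _ _).trans zero_le
  | cons v l ih =>
    have h1 := wp_risk_le_of_failure L.oracle ((wp_relax_failure_le L t v).trans hε) (l.length * ε)
    rw [wp_relaxAll_cons, ← wp_bind]
    refine (wp_bind_risk_le L.oracle h1 fun d hd => ?_).trans (le_of_eq ?_)
    · have hv : v ≠ s := fun h => hs (h ▸ List.mem_cons_self)
      rw [List.nodup_cons] at hnodup
      rw [List.pairwise_cons] at hsort
      refine ih _ (fun h => hs (List.mem_cons_of_mem _ h)) hnodup.2 hsort.2 fun u hu => ?_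
      rcases eq_or_ne u v with rfl | huv
      · rw [Function.update_self, hd]
        refine isShortestPathLength_of_forall_ge hv (fun u' he => ht u' fun hmem => ?_)
          (fun u' he => leastKey_distanceKey_le L t he) (leastKey_distanceKey_eq L t u)
        rcases List.mem_cons.1 hmem with rfl | hmem
        · exact G.acyclic u' (.single he)
        · exact hsort.1 u' hmem he
      · rw [Function.update_of_ne huv]
        refine ht u fun hmem => ?_
        rcases List.mem_cons.1 hmem with h | h
        · exact huv h
        · exact hu h
    · rw [List.length_cons]
      push_cast
      ring

/-- No edge leads from `s` or a vertex behind it to a vertex in front of `s`. So the vertices in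
front are unreachable and their initial value `⊤` is already correct. -/
theorem wp_relaxAll_topological_failure_le {ε : ℝ≥0∞}
    (hε : (2⁻¹ : ℝ≥0∞) ^ repetitions n ≤ ε) {s : Fin n} {e : List (Fin n)}
    (he : IsTopologicalOrder G e) :
    wp L.oracle 0 (relaxAll L (e.dropWhile fun v => v ≠ s).tail
        (Function.update (fun _ => ⊤) s 0))
        (risk (fun t => ∀ v, G.IsShortestPathLength s v (t v)) fun _ => 0) ≤ n * ε := by
  obtain ⟨pre, post, rfl⟩ := List.append_of_mem (he.mem s)
  obtain ⟨h1, h2, h3⟩ := List.nodup_append.1 he.nodup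
  have hdrop : ((pre ++ s :: post).dropWhile fun v => v ≠ s) = s :: post := by
    rw [List.dropWhile_append_of_pos fun v hv => by
      simpa using h3 v hv s List.mem_cons_self]
    simp
  rw [hdrop, List.tail_cons]
  obtain ⟨g1, g2, g3⟩ := List.pairwise_append.1 he.sorted
  rw [List.nodup_cons] at h2
  have hlen : post.length ≤ n := by
    have := h2.2.length_le_card
    rwa [Fintype.card_fin] at this
  refine (wp_relaxAll_failure_le L hε post _ h2.1 h2.2 (List.pairwise_cons.1 g2).2
    fun v hv => ?_).trans (by gcongr)
  rcases eq_or_ne v s with rfl | hvs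
  · rw [Function.update_self]
    exact isShortestPathLength_self
  · rw [Function.update_of_ne hvs]
    have hreach : ∀ u ℓ, G.HasPath s u ℓ → u ∈ s :: post := by
      intro u ℓ h
      induction h with
      | nil => exact List.mem_cons_self
      | snoc _ hedge ih =>
        by_contra hnot
        have hmem := (List.mem_append.1 (he.mem _)).resolve_right hnot
        exact g3 _ hmem _ ih hedge
    refine Or.inl ⟨rfl, fun ℓ hℓ => ?_⟩
    rcases List.mem_cons.1 (hreach v ℓ hℓ) with h | h
    · exact hvs h
    · exact hv h

/-- Only distinctness of the vertices matters for the cost, so the bound covers enumerations that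
are not topological. -/
theorem wp_relaxAll_cost_le {a b : ℝ≥0∞}
    (hab : ∀ D : ℕ, repetitions n * ENNReal.ofReal (20000 * Real.sqrt D) ≤ a * D + b)
    (l : List (Fin n)) (hl : l.Nodup) (t : Fin n → WithTop ℝ) :
    wp L.oracle 1 (relaxAll L l t) (fun _ => 0)
      ≤ ∑ v, if 0 < L.inDeg v then a * L.inDeg v + b else 0 := by
  have hstep : ∀ t v, wp L.oracle 1 (relax L t v) (fun _ => 0)
      ≤ if 0 < L.inDeg v then a * L.inDeg v + b else 0 := by
    intro t v
    rw [relax, wp_repeatMin_zero]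
    have h1 := wp_durrHoyer_le L.oracle (distanceKey t) (window true v 0 (L.inDeg v))
    split
    · refine (mul_le_mul_right (h1.trans (ENNReal.ofReal_le_ofReal ?_)) _).trans (hab _)
      gcongr
      norm_num
    · have h0 : L.inDeg v = 0 := by omega
      have h2 : (ENNReal.ofReal (1201 * Real.sqrt (L.inDeg v : ℕ))) = 0 := by simp [h0]
      rw [h2] at h1
      rw [le_zero_iff.1 h1, mul_zero]
  have hsum : ∀ t, wp L.oracle 1 (relaxAll L l t) (fun _ => 0)
      ≤ ∑ v ∈ l.toFinset, if 0 < L.inDeg v then a * L.inDeg v + b else 0 := by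
    induction l with
    | nil => exact fun t => zero_le
    | cons v l ih =>
      intro t
      rw [List.nodup_cons] at hl
      rw [wp_relaxAll_cons, List.toFinset_cons,
        Finset.sum_insert (by simpa using hl.1)]
      exact (wp_le_of_always L.oracle (always_true _ _) fun d _ => ih hl.2 _).trans
        (add_le_add_left (hstep t v) _)
  exact (hsum t).trans (Finset.sum_le_sum_of_subset (Finset.subset_univ _))

theorem expectedQueries_le {a b : ℝ≥0∞}
    (hab : ∀ D : ℕ, repetitions n * ENNReal.ofReal (20000 * Real.sqrt D) ≤ a * D + b)
    (s : Fin n) :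
    (shortestPathAlgorithm L.outDeg L.inDeg s).expectedQueries L.oracle
      ≤ (∑ v, if 0 < L.outDeg v then a * L.outDeg v + b + (b + 1) else 0)
        + ∑ v, if 0 < L.inDeg v then a * L.inDeg v + b else 0 := by
  rw [expectedQueries_eq_wp, shortestPathAlgorithm_eq, wp_bind]
  refine (wp_le_of_always L.oracle always_nodup_topSort fun e he =>
    wp_relaxAll_cost_le L hab _ ?_ _).trans (add_le_add_left (wp_topSort_cost_le L hab) _)
  exact he.sublist ((List.tail_sublist _).trans (List.dropWhile_sublist _))

theorem errorProbability_le {ε : ℝ≥0∞} (hε : (2⁻¹ : ℝ≥0∞) ^ repetitions n ≤ ε) (s : Fin n) :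
    (shortestPathAlgorithm L.outDeg L.inDeg s).errorProbability L.oracle
      (fun t => ∀ v, G.IsShortestPathLength s v (t v)) ≤ n * (ε + ε) + n * ε := by
  rw [errorProbability_eq_wp, shortestPathAlgorithm_eq]
  refine (wp_mono _ _ fun t => ?_).trans (wp_bind_risk_le L.oracle
    (T := fun t => ∀ v, G.IsShortestPathLength s v (t v)) (e' := fun _ => 0)
    (wp_topSort_risk_le hε (n * ε)) fun e he => wp_relaxAll_topological_failure_le L hε he)
  rw [risk]
  split
  · exact zero_le
  · exact le_rfl

end MainPart

/-! ### Degree sums and constants -/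

section Constants

variable {n : ℕ} {G : WeightedDAG n} (L : AdjacencyLists G)

theorem sum_outDeg : ∑ v, L.outDeg v = G.edges.card := by
  rw [Finset.card_eq_sum_card_fiberwise (f := Prod.fst) (t := Finset.univ)
    fun _ _ => Finset.mem_coe.2 (Finset.mem_univ _)]
  refine Finset.sum_congr rfl fun v _ => ?_
  rw [AdjacencyLists.outDeg, ← List.toFinset_card_of_nodup (L.nodup_outList v)]
  refine Finset.card_bij' (fun u _ => (v, u)) (fun e _ => e.2) ?_ ?_ ?_ ?_
  · intro u hu
    exact Finset.mem_filter.2 ⟨(L.mem_outList v u).1 (List.mem_toFinset.1 hu), rfl⟩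
  · rintro ⟨v', u⟩ he
    obtain ⟨h1, h2⟩ := Finset.mem_filter.1 he
    obtain rfl : v' = v := h2
    exact List.mem_toFinset.2 ((L.mem_outList v' u).2 h1)
  · intro u _
    rfl
  · rintro ⟨v', u⟩ he
    obtain ⟨h1, h2⟩ := Finset.mem_filter.1 he
    obtain rfl : v' = v := h2
    rfl

theorem sum_inDeg : ∑ v, L.inDeg v = G.edges.card := by
  rw [Finset.card_eq_sum_card_fiberwise (f := Prod.snd) (t := Finset.univ)
    fun _ _ => Finset.mem_coe.2 (Finset.mem_univ _)]
  refine Finset.sum_congr rfl fun v _ => ?_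
  rw [AdjacencyLists.inDeg, ← List.toFinset_card_of_nodup (L.nodup_inList v)]
  refine Finset.card_bij' (fun u _ => (u, v)) (fun e _ => e.1) ?_ ?_ ?_ ?_
  · intro u hu
    exact Finset.mem_filter.2 ⟨(L.mem_inList u v).1 (List.mem_toFinset.1 hu), rfl⟩
  · rintro ⟨u, v'⟩ he
    obtain ⟨h1, h2⟩ := Finset.mem_filter.1 he
    obtain rfl : v' = v := h2
    exact List.mem_toFinset.2 ((L.mem_inList u v').2 h1)
  · intro u _
    rfl
  · rintro ⟨u, v'⟩ he
    obtain ⟨h1, h2⟩ := Finset.mem_filter.1 he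
    obtain rfl : v' = v := h2
    rfl

theorem card_nonsinks_le :
    ((Finset.univ.filter fun v => 0 < L.outDeg v).card : ℝ)
      ≤ Real.sqrt (n * G.edges.card) := by
  have h1 : (Finset.univ.filter fun v => 0 < L.outDeg v).card ≤ n := by
    have := Finset.card_le_univ (Finset.univ.filter fun v => 0 < L.outDeg v)
    rwa [Fintype.card_fin] at this
  have h2 : (Finset.univ.filter fun v => 0 < L.outDeg v).card ≤ G.edges.card := by
    rw [← sum_outDeg L, Finset.card_filter]
    refine Finset.sum_le_sum fun v _ => ?_
    split <;> omega
  -- The number of non-sinks is at most `n` and at most the number of edges, hence its square is at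
  -- most the product.
  refine Real.le_sqrt_of_sq_le ?_
  rw [sq]
  exact_mod_cast Nat.mul_le_mul h1 h2

/-- The total of the linear cost bounds. -/
theorem sum_costs_le (a b : ℝ≥0∞) :
    (∑ v, if 0 < L.outDeg v then a * L.outDeg v + b + (b + 1) else 0)
        + (∑ v, if 0 < L.inDeg v then a * L.inDeg v + b else 0)
      ≤ 2 * (a * G.edges.card) + 3 * (b * n)
        + (Finset.univ.filter fun v => 0 < L.outDeg v).card := by
  have h1 : (∑ v, if 0 < L.outDeg v then a * L.outDeg v + b + (b + 1) else 0)
      ≤ ∑ v, (a * (L.outDeg v : ℝ≥0∞) + 2 * b + if 0 < L.outDeg v then 1 else 0) := by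
    refine Finset.sum_le_sum fun v _ => ?_
    split
    · exact le_of_eq (by ring)
    · exact zero_le
  have h2 : (∑ v, if 0 < L.inDeg v then a * L.inDeg v + b else 0)
      ≤ ∑ v, (a * (L.inDeg v : ℝ≥0∞) + b) := by
    refine Finset.sum_le_sum fun v _ => ?_
    split
    · exact le_rfl
    · exact zero_le
  refine (add_le_add h1 h2).trans (le_of_eq ?_)
  simp only [Finset.sum_add_distrib, ← Finset.mul_sum, ← Nat.cast_sum, sum_outDeg, sum_inDeg,
    Finset.sum_const, Finset.card_univ, Fintype.card_fin, nsmul_eq_mul, Finset.card_filter]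
  push_cast
  ring

theorem half_pow_repetitions_le (hn : n ≠ 0) :
    (2⁻¹ : ℝ≥0∞) ^ repetitions n ≤ ENNReal.ofReal (((n : ℝ) ^ 2)⁻¹) := by
  have hn0 : (0 : ℝ) < n := by exact_mod_cast Nat.pos_of_ne_zero hn
  have h1 : (2⁻¹ : ℝ≥0∞) ^ repetitions n = ENNReal.ofReal (((2 : ℝ) ^ repetitions n)⁻¹) := by
    rw [ENNReal.ofReal_inv_of_pos (by positivity), ENNReal.ofReal_pow (by norm_num),
      ENNReal.inv_pow]
    simp
  rw [h1]
  refine ENNReal.ofReal_le_ofReal ?_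
  gcongr
  have h2 : 2 * Real.logb 2 n ≤ repetitions n := Nat.le_ceil _
  calc (n : ℝ) ^ 2 = (2 : ℝ) ^ (2 * Real.logb 2 n) := by
        rw [mul_comm, Real.rpow_mul (by norm_num), Real.rpow_logb (by norm_num) (by norm_num) hn0]
        norm_num
    _ ≤ (2 : ℝ) ^ (repetitions n : ℝ) := Real.rpow_le_rpow_of_exponent_le (by norm_num) h2
    _ = (2 : ℝ) ^ repetitions n := Real.rpow_natCast _ _

/-- The rounding adds less than `1 ≤ log₂ n`, and `3 / log 2 < 5`. -/
theorem repetitions_le (hn : 2 ≤ n) : (repetitions n : ℝ) ≤ 5 * Real.log n := by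
  have hn2 : (2 : ℝ) ≤ n := by exact_mod_cast hn
  have hlog2 := Real.log_two_gt_d9
  have hlogn : Real.log 2 ≤ Real.log n := Real.log_le_log (by norm_num) hn2
  have h1 : 0 ≤ 2 * Real.logb 2 n :=
    mul_nonneg (by norm_num) (Real.logb_nonneg (by norm_num) (by linarith))
  have h2 : (repetitions n : ℝ) < 2 * Real.logb 2 n + 1 := Nat.ceil_lt_add_one h1
  have h3 : Real.logb 2 n * Real.log 2 = Real.log n := by
    rw [Real.logb, div_mul_cancel₀ _ (by linarith)]
  nlinarith

theorem two_le_of_edges_nonempty (h : G.edges.Nonempty) : 2 ≤ n := by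
  obtain ⟨⟨u, v⟩, he⟩ := h
  have huv : u ≠ v := fun h => G.acyclic u (.single (h ▸ he))
  have := u.isLt
  have := v.isLt
  have : (u : ℕ) ≠ v := fun h => huv (Fin.ext h)
  omega

/-- The two summands on the right have product `D`, so the square of their sum is at least `D`.
Summed over stretches of total length `m` with `k` constants, each part gives `√(k m)`. -/
theorem sqrt_le_add {m D : ℝ} {k : ℝ} (hk : 0 < k) (hm : 0 < m) (hD : 0 ≤ D) :
    Real.sqrt D ≤ Real.sqrt (k * m) / m * D + Real.sqrt (k * m) / k := by
  have hX : 0 < Real.sqrt (k * m) := Real.sqrt_pos.2 (by positivity)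
  have hX2 : Real.sqrt (k * m) ^ 2 = k * m := Real.sq_sqrt (by positivity)
  refine Real.sqrt_le_iff.2 ⟨by positivity, ?_⟩
  have h1 : Real.sqrt (k * m) / m * D * (Real.sqrt (k * m) / k) = D := by
    field_simp
    rw [hX2]
  nlinarith [sq_nonneg (Real.sqrt (k * m) / m * D), sq_nonneg (Real.sqrt (k * m) / k)]

end Constants

end QuantumShortestPath

/-! ### Assembly of the two bounds -/

theorem theorem5 :
    ∃ C : ℝ, 0 < C ∧
      ∀ (n : ℕ) [NeZero n] (G : QuantumShortestPath.WeightedDAG n)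
        (L : QuantumShortestPath.AdjacencyLists G) (s : Fin n),
        (QuantumShortestPath.shortestPathAlgorithm L.outDeg L.inDeg s).expectedQueries L.oracle
            ≤ ENNReal.ofReal (C * (Real.sqrt (n * G.edges.card) * Real.log n)) ∧
        (QuantumShortestPath.shortestPathAlgorithm L.outDeg L.inDeg s).errorProbability L.oracle
            (fun t => ∀ v, G.IsShortestPathLength s v (t v))
            ≤ ENNReal.ofReal (C / n) := by
  open QuantumShortestPath in
  refine ⟨1000000, by norm_num, fun n _ G L s => ⟨?_, ?_⟩⟩
  · rcases G.edges.eq_empty_or_nonempty with hE | hE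
    -- Without edges the claimed bound is `0`, so no constant may remain: `√D ≤ D` allows `b = 0`,
    -- and all degrees vanish.
    · have hab : ∀ D : ℕ, (repetitions n : ℝ≥0∞) * ENNReal.ofReal (20000 * Real.sqrt D)
          ≤ (repetitions n * ENNReal.ofReal 20000) * D + 0 := by
        intro D
        rw [add_zero, mul_assoc, ← ENNReal.ofReal_natCast D,
          ← ENNReal.ofReal_mul (by norm_num)]
        gcongr
        refine Real.sqrt_le_iff.2 ⟨Nat.cast_nonneg D, ?_⟩
        exact_mod_cast Nat.le_self_pow two_ne_zero D
      have hcard : G.edges.card = 0 := by rw [hE, Finset.card_empty]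
      have hout := sum_outDeg L
      have hin := sum_inDeg L
      rw [hcard, Finset.sum_eq_zero_iff] at hout hin
      refine (expectedQueries_le L hab s).trans ?_
      rw [Finset.sum_eq_zero fun v _ => if_neg (by rw [hout v (Finset.mem_univ v)]; omega),
        Finset.sum_eq_zero fun v _ => if_neg (by rw [hin v (Finset.mem_univ v)]; omega)]
      simp
    · have hn2 := two_le_of_edges_nonempty hE
      have hn0 : (0 : ℝ) < n := by exact_mod_cast (by omega : 0 < n)
      have hm0 : (0 : ℝ) < G.edges.card := by exact_mod_cast hE.card_pos
      set m := G.edges.card with hm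
      set X := Real.sqrt (n * m) with hX
      have hX0 : 0 ≤ X := Real.sqrt_nonneg _
      set R := repetitions n with hR
      have hR0 : (0 : ℝ) ≤ R := Nat.cast_nonneg R
      have hRle : (R : ℝ) ≤ 5 * Real.log n := repetitions_le hn2
      have hab : ∀ D : ℕ, (R : ℝ≥0∞) * ENNReal.ofReal (20000 * Real.sqrt D)
          ≤ ENNReal.ofReal (R * 20000 * (X / m)) * D + ENNReal.ofReal (R * 20000 * (X / n)) := by
        intro D
        rw [← ENNReal.ofReal_natCast R, ← ENNReal.ofReal_natCast D, ← ENNReal.ofReal_mul hR0,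
          ← ENNReal.ofReal_mul (by positivity), ← ENNReal.ofReal_add (by positivity)
            (by positivity)]
        refine ENNReal.ofReal_le_ofReal ?_
        have := mul_le_mul_of_nonneg_left (sqrt_le_add hn0 hm0 (Nat.cast_nonneg (α := ℝ) D))
          (show (0 : ℝ) ≤ R * 20000 by positivity)
        linarith
      refine (expectedQueries_le L hab s).trans ((sum_costs_le L _ _).trans ?_)
      have h1 : ENNReal.ofReal (R * 20000 * (X / m)) * (m : ℝ≥0∞)
          = ENNReal.ofReal (R * 20000 * X) := by
        rw [← ENNReal.ofReal_natCast m, ← ENNReal.ofReal_mul (by positivity)]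
        congr 1
        field_simp
      have h2 : ENNReal.ofReal (R * 20000 * (X / n)) * (n : ℝ≥0∞)
          = ENNReal.ofReal (R * 20000 * X) := by
        rw [← ENNReal.ofReal_natCast n, ← ENNReal.ofReal_mul (by positivity)]
        congr 1
        field_simp
      have h3 := card_nonsinks_le L
      have hlog : Real.log 2 ≤ Real.log n := Real.log_le_log (by norm_num) (by exact_mod_cast hn2)
      have hlog2 := Real.log_two_gt_d9
      have h4 : 2 * ENNReal.ofReal (R * 20000 * X) + 3 * ENNReal.ofReal (R * 20000 * X)
          = ENNReal.ofReal (5 * (R * 20000 * X)) := by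
        rw [← add_mul, ENNReal.ofReal_mul (by norm_num)]
        norm_num
      rw [h1, h2, h4, ← ENNReal.ofReal_natCast, ← ENNReal.ofReal_add (by positivity)
        (Nat.cast_nonneg _)]
      refine ENNReal.ofReal_le_ofReal ?_
      -- The searches contribute `5 * 20000 * 5 = 500000` times `X log n`. The queries that read
      -- found neighbours contribute at most `X ≤ 2 X log n`, because `log 2 > 1 / 2`.
      have h5 : (R : ℝ) * X ≤ 5 * Real.log n * X := mul_le_mul_of_nonneg_right hRle hX0
      have h6 : X ≤ 2 * Real.log n * X := le_mul_of_one_le_left hX0 (by linarith)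
      have h7 : 0 ≤ Real.log n * X := mul_nonneg (by linarith) hX0
      rw [← hm, ← hX] at h3
      linarith
  · have hn : n ≠ 0 := NeZero.ne n
    have hn0 : (0 : ℝ) < n := by exact_mod_cast Nat.pos_of_ne_zero hn
    refine (errorProbability_le L (half_pow_repetitions_le hn) s).trans ?_
    rw [← ENNReal.ofReal_add (by positivity) (by positivity), ← ENNReal.ofReal_natCast n,
      ← ENNReal.ofReal_mul hn0.le, ← ENNReal.ofReal_mul hn0.le,
      ← ENNReal.ofReal_add (by positivity) (by positivity)]
    refine ENNReal.ofReal_le_ofReal ?_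
    -- Two units of `1 / n²` per vertex for the topological sort and one for the main part.
    have : (n : ℝ) * (((n : ℝ) ^ 2)⁻¹ + ((n : ℝ) ^ 2)⁻¹) + n * ((n : ℝ) ^ 2)⁻¹ = 3 / n := by
      field_simp
      norm_num
    rw [this]
    gcongr
    norm_num

end
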